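/- **Setting.** Let $X$ be a simple graph, possibly infinite, with vertex set $VX$, edge set $EX$ and set $\mathrm{OE}$ of oriented edges; for $e\in\mathrm{OE}$ write $o(e)$, $t(e)$, $e^{-1}$ for its origin, its terminal vertex and its reverse. Assume that $X$ has bounded valency, and let $w:\mathrm{OE}\to(0,\infty)$ be a weight with $\sum_{e\in\mathrm{OE}}w(e)<\infty$. For $e\in EX$ with orientations $e_1,e_2$ put $W(e)=w(e_1)w(e_2)$, and for a path $p=(x_0,\dots,x_n)$ put $l(p)=n$ and $w(p)=\prod_{j}w(x_j,x_{j+1})$. A path is *reduced* if $x_{j-1}\ne x_{j+1}$ for $1\le j\le n-1$. A *cycle* is an equivalence class of closed paths of positive length under the relation generated by $(x_0,x_1,\dots,x_n)\sim(x_1,\dots,x_n,x_1)$, all of whose members are reduced; it is *prime* if it is not a power of a shorter cycle. Put $$Z(u)=\prod_{p\text{ prime cycle}}\bigl(1-w(p)u^{l(p)}\bigr)^{-1}.$$ Define bounded operators $\sigma:\ell^2(VX)\to\ell^2(\mathrm{OE})$, $\tau:\ell^2(\mathrm{OE})\to\ell^2(VX)$, $J:\ell^2(\mathrm{OE})\to\ell^2(\mathrm{OE})$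 by $$\sigma(x)=\sum_{o(e)=x}w(e)\,e,\qquad \tau(e)=t(e),\qquad J(e)=w(e^{-1})\,e^{-1}.$$ On $\ell^2(VX)$ let $A_0=B_0=1$; for $m\ge1$ let $A_mx=\sum_p w(p)\,x_p$, the sum over all reduced paths $p$ of length $m$ starting at $x$, where $x_p$ is the end point of $p$; and, with sums over the neighbours $x'$ of $x$, let $B_{2n}x=\sum_{x'}W(x,x')^n x$ for $n\ge1$ and $B_{2n+1}x=\sum_{x'}W(x,x')^n w(x,x')\,x'$ for $n\ge0$. Put $A(u)=\sum_j u^jA_j$ and $B(u)=\sum_j u^jB_j$. For a trace class operator $T$ let $\det(1-T)=\sum_{k\ge0}(-1)^k\operatorname{tr}\bigwedge^kT$; for a formal power series $T(u)=T_1u+T_2u^2+\cdots$ with trace class coefficients let $\det(1+T(u))=\sum_{k\ge0}\operatorname{tr}\bigwedge^kT(u)\in\mathbb C[[u]]$. **Theorem (Ihara–Sunada formula).** 1. The product $P(u)=\prod_{e\in EX}(1-u^2W(e))$ converges locally uniformly on $\mathbb C$ to an entire function, whose zeros are exactly the numbers $\pm1/\sqrt{W(e)}$, $e\in EX$; the multiplicity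 of a zero $z$ is the number of edges $e$ with $z=\pm1/\sqrt{W(e)}$. 2. The product $Z(u)$ converges for $|u|$ sufficiently small, with non-zero value, and $Z(u)^{-1}$ extends to an entire function. For every $u\in\mathbb C$ with $P(u)\neq0$ the operator $1+uJ$ is invertible, $u\tau(1+uJ)^{-1}\sigma$ is of trace class, and $$Z(u)^{-1}=\det\bigl(1-u\tau(1+uJ)^{-1}\sigma\bigr)\prod_{e\in EX}\bigl(1-u^2W(e)\bigr).$$ The first factor $D(u)=\det(1-u\tau(1+uJ)^{-1}\sigma)$ is meromorphic on $\mathbb C$, so this is an identity of meromorphic functions on $\mathbb C$. 3. The first factor equals $\det(B(-u))=\det(A(u))^{-1}$. That is: for $|u|$ sufficiently small the series $B(-u)$ and $A(u)$ converge in operator norm, $1-B(-u)$ and $1-A(u)$ are of trace class, $\det(A(u))\ne0$ and $D(u)=\det(B(-u))=\det(A(u))^{-1}$. The same holds for determinants of formal power series: all $A_j$, $B_j$ with $j\ge1$ are of trace class, the formal power series $\det(B(-u))$ converges to $D(u)$ for small $|u|$, and $\det(A(u))\det(B(-u))=1$ in $\mathbb C[[u]]$. -/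

import Mathlib

noncomputable section

/-! ### Hilbert space notions: trace class operators and Fredholm determinants on `ℓ²(ι)` -/

/-- The complex Hilbert space `ℓ²(ι)` with orthonormal basis indexed by `ι`. -/
abbrev EllTwo (ι : Type*) : Type _ := lp (fun _ : ι => ℂ) 2

open Classical in
/-- The basis vector of `ℓ²(ι)` attached to `i`. -/
def EllTwo.basisVec {ι : Type*} (i : ι) : EllTwo ι := lp.single 2 i (1 : ℂ)

/-- The rank one operator `v ↦ ⟪b, v⟫ a` for the basis vectors attached to `i` and `j`: it sends
the basis vector of `j` to the basis vector of `i` and kills all other basis vectors. -/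
def EllTwo.unit {ι κ : Type*} (i : ι) (j : κ) : EllTwo κ →L[ℂ] EllTwo ι :=
  InnerProductSpace.rankOne ℂ (EllTwo.basisVec i) (EllTwo.basisVec j)

lemma EllTwo.norm_basisVec {ι : Type*} (i : ι) : ‖(EllTwo.basisVec i : EllTwo ι)‖ = 1 := by
  classical
  rw [EllTwo.basisVec, lp.norm_single (by norm_num), norm_one]

lemma EllTwo.norm_unit {ι κ : Type*} (i : ι) (j : κ) : ‖EllTwo.unit i j‖ = 1 := by
  rw [EllTwo.unit, InnerProductSpace.norm_rankOne, norm_basisVec, norm_basisVec, one_mul]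

open Classical in
lemma EllTwo.unit_basisVec {ι κ : Type*} (i : ι) (j k : κ) :
    EllTwo.unit i j (EllTwo.basisVec k) = if j = k then EllTwo.basisVec i else 0 := by
  rw [EllTwo.unit, InnerProductSpace.rankOne_apply, EllTwo.basisVec, EllTwo.basisVec,
    lp.inner_single_left]
  by_cases h : j = k
  · subst h; simp
  · simp [h]

/-- An operator on a Hilbert space is of trace class if it is an absolutely convergent sum of
rank one operators. -/
def IsTraceClass {H : Type*} [NormedAddCommGroup H] [InnerProductSpace ℂ H]
    (T : H →L[ℂ] H) : Prop :=
  ∃ x y : ℕ → H, Summable (fun n => ‖x n‖ * ‖y n‖) ∧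
    ∀ v, HasSum (fun n => inner ℂ (x n) v • y n) (T v)

/-- The matrix entry of an operator on `ℓ²(ι)` in the standard orthonormal basis. -/
def EllTwo.entry {ι : Type*} (T : EllTwo ι →L[ℂ] EllTwo ι) (i j : ι) : ℂ :=
  inner ℂ (EllTwo.basisVec i) (T (EllTwo.basisVec j))

open Classical in
/-- The trace of `⋀ᵏ T` on `⋀ᵏ ℓ²(ι)`, computed in the orthonormal basis
`e_{i₁} ∧ ⋯ ∧ e_{i_k}`, which is indexed by the `k`-element subsets `S` of `ι`; the diagonal
entry of `⋀ᵏ T` at `S` is the principal minor of `T` at `S`. -/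
def traceExteriorPower {ι : Type*} (k : ℕ) (T : EllTwo ι →L[ℂ] EllTwo ι) : ℂ :=
  ∑' S : {S : Finset ι // S.card = k},
    Matrix.det (Matrix.of fun i j : S.1 => EllTwo.entry T i j)

/-- The Fredholm determinant of an operator `R` such that `1 - R` is of trace class:
`det (1 - T) = ∑ₖ (-1)ᵏ tr (⋀ᵏ T)`. -/
def fredholmDet {ι : Type*} (R : EllTwo ι →L[ℂ] EllTwo ι) : ℂ :=
  ∑' k : ℕ, (-1) ^ k * traceExteriorPower k (1 - R)

open Classical in
/-- The Fredholm determinant of a formal power series `1 + T(u)`, `T(u) = T₁ u + T₂ u² + ⋯`, whose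
coefficients `Tⱼ` are of trace class: the formal power series `∑ₖ tr (⋀ᵏ T(u))`, where the trace of
a formal power series of operators is taken coefficientwise. As `⋀ᵏ T(u)` is divisible by `uᵏ`, only
the terms with `k ≤ n` contribute to the coefficient of `uⁿ`. -/
def fredholmDetSeries {ι : Type*} (R : PowerSeries (EllTwo ι →L[ℂ] EllTwo ι)) : PowerSeries ℂ :=
  PowerSeries.mk fun n => ∑ k ∈ Finset.range (n + 1), ∑' S : {S : Finset ι // S.card = k},
    PowerSeries.coeff n (Matrix.det (Matrix.of fun i j : S.1 =>
      PowerSeries.mk fun m => EllTwo.entry (ι := ι) (PowerSeries.coeff m (R - 1)) i j))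

/-! ### Weighted graphs -/

/-- A weighted graph: a simple graph of bounded valency together with a positive weight for
every oriented edge (dart) such that the total weight is finite. -/
structure WeightedGraph (V : Type*) where
  /-- the underlying graph -/
  graph : SimpleGraph V
  /-- the weight of an oriented edge -/
  w : graph.Dart → ℝ
  w_pos : ∀ e, 0 < w e
  bounded_valency : ∃ M : ℕ, ∀ x, (graph.neighborSet x).encard ≤ M
  finite_weight : Summable w

namespace WeightedGraph

variable {V : Type*} (X : WeightedGraph V)

open Classical in
/-- The weight `w(x, y)` of the oriented edge from `x` to `y`, and `0` if there is none. -/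
def weight (x y : V) : ℝ := if h : X.graph.Adj x y then X.w ⟨(x, y), h⟩ else 0

/-- `W(e) = w(e₁) w(e₂)` for the two orientations `e₁, e₂` of the edge `e`. -/
def W : Sym2 V → ℝ :=
  Sym2.lift ⟨fun x y => X.weight x y * X.weight y x, fun _ _ => mul_comm _ _⟩

lemma W_edge (e : X.graph.Dart) : X.W e.edge = X.w e * X.w e.symm := by
  obtain ⟨⟨x, y⟩, h⟩ := e
  have h' : X.graph.Adj x y := h
  simp [W, weight, SimpleGraph.Dart.edge, h', h'.symm]

/-- The weight of a path `(x₀, …, xₙ)`: the product of the weights of its oriented edges. -/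
def pathWeight {x y : V} (p : X.graph.Walk x y) : ℝ := (p.darts.map X.w).prod

/-- A path `(x₀, …, xₙ)` is reduced if it has no backtracking, i.e. if
`x_{j-1} ≠ x_{j+1}` for `1 ≤ j ≤ n - 1`. -/
def IsReduced {x y : V} (p : X.graph.Walk x y) : Prop :=
  ∀ j, j + 2 ≤ p.length → p.getVert j ≠ p.getVert (j + 2)

/-! #### Prime cycles and the zeta function -/

/-- A closed path `(x₀, …, xₙ)`, `xₙ = x₀`, of positive length. -/
structure ClosedPath where
  /-- the base point `x₀` -/
  base : V
  /-- the path -/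
  walk : X.graph.Walk base base
  length_pos : 0 < walk.length

variable {X} in
/-- The shift `(x₀, x₁, …, xₙ) ↦ (x₁, …, xₙ, x₁)`. -/
def ClosedPath.shift : X.ClosedPath → X.ClosedPath
  | ⟨_, .cons h q, _⟩ => ⟨_, q.concat h, by simp⟩

/-- The `(k + 1)`-fold concatenation of a closed path with itself. -/
def powSuccWalk {x : V} (p : X.graph.Walk x x) : ℕ → X.graph.Walk x x
  | 0 => p
  | k + 1 => (powSuccWalk p k).append p

lemma length_powSuccWalk {x : V} (p : X.graph.Walk x x) (k : ℕ) :
    (X.powSuccWalk p k).length = (k + 1) * p.length := by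
  induction k with
  | zero => simp [powSuccWalk]
  | succ k ih => rw [powSuccWalk, SimpleGraph.Walk.length_append, ih]; ring

variable {X} in
/-- The power `p^{k+1}` of a closed path `p`. -/
def ClosedPath.powSucc (p : X.ClosedPath) (k : ℕ) : X.ClosedPath :=
  ⟨p.base, X.powSuccWalk p.walk k, by
    rw [length_powSuccWalk]; exact Nat.mul_pos k.succ_pos p.length_pos⟩

/-- Closed paths modulo the equivalence relation generated by the shift. -/
def ClosedPathClass : Type _ := Quot fun p q : X.ClosedPath => p.shift = q

variable {X} in
/-- The length of a class of closed paths. -/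
def ClosedPathClass.length : X.ClosedPathClass → ℕ :=
  Quot.lift (fun p => p.walk.length) <| by
    rintro ⟨x, p, hp⟩ _ rfl
    cases p with
    | nil => simp at hp
    | cons h q => simp [ClosedPath.shift]

variable {X} in
/-- The weight of a class of closed paths. -/
def ClosedPathClass.weight : X.ClosedPathClass → ℝ :=
  Quot.lift (fun p => X.pathWeight p.walk) <| by
    rintro ⟨x, p, hp⟩ _ rfl
    cases p with
    | nil => simp at hp
    | cons h q => simp [ClosedPath.shift, pathWeight, mul_comm]

variable {X} in
/-- A cycle is an equivalence class which consists of reduced paths only. -/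
def ClosedPathClass.IsCycle (c : X.ClosedPathClass) : Prop :=
  ∀ p : X.ClosedPath, Quot.mk _ p = c → X.IsReduced p.walk

variable {X} in
/-- A cycle is prime if it is not a power of a shorter cycle. -/
def ClosedPathClass.IsPrime (c : X.ClosedPathClass) : Prop :=
  c.IsCycle ∧ ¬ ∃ (p : X.ClosedPath) (k : ℕ), ClosedPathClass.IsCycle (Quot.mk _ p) ∧
    p.walk.length < c.length ∧ Quot.mk _ (p.powSucc k) = c

/-- The prime cycles of `X`. -/
def PrimeCycle : Type _ := {c : X.ClosedPathClass // c.IsPrime}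

/-- The Euler factor `(1 - w(p) u^{l(p)})⁻¹` of a prime cycle `p`. -/
def eulerFactor (u : ℂ) (p : X.PrimeCycle) : ℂ := (1 - (p.1.weight : ℂ) * u ^ p.1.length)⁻¹

/-- The Ihara zeta function `Z(u) = ∏_p (1 - w(p) u^{l(p)})⁻¹`, the product being extended over all
prime cycles; to be used where the product converges. -/
def zeta (u : ℂ) : ℂ := ∏' p : X.PrimeCycle, X.eulerFactor u p

/-- The product `∏_{e ∈ EX} (1 - u² W(e))` over all non-oriented edges. -/
def edgeProduct (u : ℂ) : ℂ := ∏' e : X.graph.edgeSet, (1 - u ^ 2 * (X.W e : ℂ))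

/-! #### The operators -/

/-- `σ : ℓ²(VX) → ℓ²(OE)`, `σ(x) = ∑_{o(e) = x} w(e) e`, as a sum of rank one operators which
converges absolutely in operator norm; see `sigma_basisVec`. -/
def sigma : EllTwo V →L[ℂ] EllTwo X.graph.Dart :=
  ∑' e : X.graph.Dart, (X.w e : ℂ) • EllTwo.unit e e.fst

/-- The weighted flip `J : ℓ²(OE) → ℓ²(OE)`, `J(e) = w(e⁻¹) e⁻¹`; see `J_basisVec`. -/
def J : EllTwo X.graph.Dart →L[ℂ] EllTwo X.graph.Dart :=
  ∑' e : X.graph.Dart, (X.w e.symm : ℂ) • EllTwo.unit e.symm e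

/-- The reduced paths of length `m`. -/
def ReducedPath (m : ℕ) : Type _ :=
  {p : Σ x y : V, X.graph.Walk x y // p.2.2.length = m ∧ X.IsReduced p.2.2}

/-- The operators `A_m` on `ℓ²(VX)`: `A₀ = 1`, and for `m ≥ 1`, `A_m x` is the sum of `w(p) x_p` over
all reduced paths `p` of length `m` starting at `x`, where `x_p` is the end point of `p`;
see `A_basisVec`. -/
def A (m : ℕ) : EllTwo V →L[ℂ] EllTwo V :=
  if m = 0 then 1
  else ∑' p : X.ReducedPath m, (X.pathWeight p.1.2.2 : ℂ) • EllTwo.unit p.1.2.1 p.1.1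

/-- The operators `B_j` on `ℓ²(VX)`: `B₀ = 1`, and with sums over all neighbours `x'` of `x`,
`B_{2n} x = ∑ W(x,x')ⁿ x` for `n ≥ 1` and `B_{2n+1} x = ∑ W(x,x')ⁿ w(x,x') x'` for `n ≥ 0`;
see `B_even_basisVec` and `B_odd_basisVec`. -/
def B (j : ℕ) : EllTwo V →L[ℂ] EllTwo V :=
  if j = 0 then 1
  else if Even j then
    ∑' e : X.graph.Dart, ((X.W e.edge ^ (j / 2) : ℝ) : ℂ) • EllTwo.unit e.fst e.fst
  else
    ∑' e : X.graph.Dart, ((X.W e.edge ^ (j / 2) * X.w e : ℝ) : ℂ) • EllTwo.unit e.snd e.fst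

lemma exists_fiber_bound : ∃ M : ℕ, ∀ x : V,
    Finite {e : X.graph.Dart // e.snd = x} ∧ Nat.card {e : X.graph.Dart // e.snd = x} ≤ M := by
  obtain ⟨M, hM⟩ := X.bounded_valency
  refine ⟨M, fun x => ?_⟩
  have hfin : (X.graph.neighborSet x).Finite :=
    Set.finite_of_encard_le_coe (hM x)
  have : Finite (X.graph.neighborSet x) := hfin
  let φ : {e : X.graph.Dart // e.snd = x} → X.graph.neighborSet x :=
    fun e => ⟨e.1.fst, by
      have h := e.1.adj.symm
      rw [e.2] at h
      exact h⟩
  have hφ : Function.Injective φ := by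
    rintro ⟨⟨⟨a, b⟩, h⟩, rfl⟩ ⟨⟨⟨c, d⟩, h'⟩, hd⟩ hac
    have h1 : a = c := congrArg Subtype.val hac
    have h2 : d = b := hd
    subst h1 h2
    rfl
  refine ⟨Finite.of_injective φ hφ, (Nat.card_le_card_of_injective φ hφ).trans ?_⟩
  have h := hM x
  rw [hfin.encard_eq_coe_toFinset_card, ← Set.ncard_eq_toFinset_card _ hfin] at h
  exact_mod_cast h

lemma exists_tau_bound : ∃ M : ℝ, 0 ≤ M ∧ ∀ (f : EllTwo X.graph.Dart) (s : Finset V),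
    ∑ x ∈ s, ‖∑' e : {e : X.graph.Dart // e.snd = x}, f e‖ ^ 2 ≤ M * ‖f‖ ^ 2 := by
  obtain ⟨M, hM⟩ := X.exists_fiber_bound
  refine ⟨M, M.cast_nonneg, fun f s => ?_⟩
  have hfin : ∀ x, Finite {e : X.graph.Dart // e.snd = x} := fun x => (hM x).1
  have hsum : Summable fun e => ‖f e‖ ^ 2 := by
    have := (lp.memℓp f).summable (by norm_num)
    simpa using this
  have hnorm : ‖f‖ ^ 2 = ∑' e, ‖f e‖ ^ 2 := by
    have := lp.norm_rpow_eq_tsum (p := 2) (by norm_num) f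
    simpa using this
  have hσ := (Equiv.sigmaFiberEquiv (fun e : X.graph.Dart => e.snd)).summable_iff.mpr hsum
  have key : ∀ x, ‖∑' e : {e : X.graph.Dart // e.snd = x}, f e‖ ^ 2 ≤
      M * ∑' e : {e : X.graph.Dart // e.snd = x}, ‖f e‖ ^ 2 := by
    intro x
    have := Fintype.ofFinite {e : X.graph.Dart // e.snd = x}
    have hc : (Fintype.card {e : X.graph.Dart // e.snd = x} : ℝ) ≤ M := by
      rw [← Nat.card_eq_fintype_card]; exact_mod_cast (hM x).2
    rw [tsum_fintype, tsum_fintype]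
    calc ‖∑ e : {e : X.graph.Dart // e.snd = x}, f e‖ ^ 2
        ≤ (∑ e : {e : X.graph.Dart // e.snd = x}, ‖f e‖) ^ 2 := by
          gcongr; exact norm_sum_le _ _
      _ ≤ Fintype.card {e : X.graph.Dart // e.snd = x} *
            ∑ e : {e : X.graph.Dart // e.snd = x}, ‖f e‖ ^ 2 := by
          simpa using sq_sum_le_card_mul_sum_sq
            (s := (Finset.univ : Finset {e : X.graph.Dart // e.snd = x})) (f := fun e => ‖f e‖)
      _ ≤ _ := by gcongr
  calc _ ≤ ∑ x ∈ s, M * ∑' e : {e : X.graph.Dart // e.snd = x}, ‖f e‖ ^ 2 :=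
        Finset.sum_le_sum fun x _ => key x
    _ = M * ∑ x ∈ s, ∑' e : {e : X.graph.Dart // e.snd = x}, ‖f e‖ ^ 2 := by
        rw [Finset.mul_sum]
    _ ≤ M * ∑' x, ∑' e : {e : X.graph.Dart // e.snd = x}, ‖f e‖ ^ 2 := by
        gcongr
        refine Summable.sum_le_tsum s (fun x _ => tsum_nonneg fun e => by positivity) ?_
        exact hσ.sigma
    _ = M * ‖f‖ ^ 2 := by
        rw [hnorm, ← (Equiv.sigmaFiberEquiv (fun e : X.graph.Dart => e.snd)).tsum_eq]
        congr 1
        exact (hσ.tsum_sigma).symm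

/-- `τ : ℓ²(OE) → ℓ²(VX)` is the bounded operator which sends an oriented edge to its terminal
vertex, i.e. `(τ f)(x) = ∑_{t(e) = x} f(e)`; see `tau_basisVec`. -/
def tau : EllTwo X.graph.Dart →L[ℂ] EllTwo V :=
  LinearMap.mkContinuous
    { toFun := fun f =>
        ⟨fun x => ∑' e : {e : X.graph.Dart // e.snd = x}, f e, by
          obtain ⟨M, -, hM⟩ := X.exists_tau_bound
          refine memℓp_gen' (C := M * ‖f‖ ^ 2) fun s => ?_
          simpa using hM f s⟩
      map_add' := fun f g => by
        obtain ⟨M, hM⟩ := X.exists_fiber_bound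
        ext x
        have := (hM x).1
        exact Summable.tsum_add .of_finite .of_finite
      map_smul' := fun c f => by
        ext x
        exact tsum_mul_left }
    (Real.sqrt X.exists_tau_bound.choose) fun f => by
      obtain ⟨h0, hM⟩ := X.exists_tau_bound.choose_spec
      refine lp.norm_le_of_forall_sum_le (p := 2) (by norm_num) (by positivity) fun s => ?_
      have h2 : (Real.sqrt X.exists_tau_bound.choose * ‖f‖) ^ 2 =
          X.exists_tau_bound.choose * ‖f‖ ^ 2 := by rw [mul_pow, Real.sq_sqrt h0]
      simp only [ENNReal.toReal_ofNat, Real.rpow_two, h2]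
      exact hM f s

/-! #### The action of the operators on the basis vectors -/

open EllTwo in
lemma tau_basisVec (e : X.graph.Dart) : X.tau (basisVec e) = basisVec e.snd := by
  classical
  ext x
  change ∑' d : {d : X.graph.Dart // d.snd = x}, basisVec e d.1 = basisVec e.snd x
  by_cases hx : e.snd = x
  · rw [tsum_eq_single ⟨e, hx⟩]
    · simp [basisVec, ← hx]
    · rintro ⟨d, hd⟩ hne
      have : d ≠ e := fun h => hne (Subtype.ext h)
      simp [basisVec, this]
  · have h0 : ∀ d : {d : X.graph.Dart // d.snd = x}, basisVec e d.1 = 0 := by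
      rintro ⟨d, hd⟩
      have : d ≠ e := by rintro rfl; exact hx hd
      simp [basisVec, this]
    simp_rw [h0, tsum_zero]
    simp [basisVec, Ne.symm hx]

open EllTwo in
lemma tsum_unit_basisVec {α ι κ : Type*} {c : α → ℝ} (hc : Summable c) (h0 : ∀ a, 0 ≤ c a)
    (f : α → ι) (g : α → κ) (j : κ) :
    (∑' a, (c a : ℂ) • unit (f a) (g a)) (basisVec j) =
      ∑' a : {a // g a = j}, (c a : ℂ) • basisVec (f a) := by
  classical
  have hs : Summable fun a => (c a : ℂ) • unit (f a) (g a) := by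
    refine Summable.of_norm (hc.congr fun a => ?_)
    rw [norm_smul, norm_unit, mul_one, Complex.norm_real, Real.norm_of_nonneg (h0 a)]
  have h1 : (∑' a, (c a : ℂ) • unit (f a) (g a)) (basisVec j) =
      ∑' a, ((c a : ℂ) • unit (f a) (g a)) (basisVec j) :=
    (ContinuousLinearMap.apply ℂ _ (basisVec j)).map_tsum hs
  rw [h1]
  refine Eq.trans ?_ (tsum_subtype {a | g a = j} fun a => (c a : ℂ) • basisVec (f a)).symm
  refine tsum_congr fun a => ?_
  by_cases h : g a = j
  · rw [Set.indicator_of_mem (show a ∈ {a | g a = j} from h), smul_apply, unit_basisVec, if_pos h]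
  · rw [Set.indicator_of_notMem (show a ∉ {a | g a = j} from h),
      smul_apply, unit_basisVec, if_neg h,
      smul_zero]

open EllTwo in
lemma sigma_basisVec (x : V) :
    X.sigma (basisVec x) = ∑' e : {e : X.graph.Dart // e.fst = x}, (X.w e : ℂ) • basisVec e.1 :=
  tsum_unit_basisVec X.finite_weight (fun e => (X.w_pos e).le) _ _ x

lemma summable_w_symm : Summable fun e : X.graph.Dart => X.w e.symm :=
  (SimpleGraph.Dart.symm_involutive.toPerm.summable_iff (f := X.w)).mpr X.finite_weight

open EllTwo in
lemma J_basisVec (e : X.graph.Dart) :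
    X.J (basisVec e) = (X.w e.symm : ℂ) • basisVec e.symm := by
  rw [J, tsum_unit_basisVec X.summable_w_symm (fun e => (X.w_pos _).le)
    (fun e => e.symm) (fun e => e) e]
  exact tsum_eq_single (⟨e, rfl⟩ : {d : X.graph.Dart // d = e})
    fun d hd => absurd (Subtype.ext d.2) hd

lemma W_edge_pos (e : X.graph.Dart) : 0 < X.W e.edge := by
  rw [W_edge]; exact mul_pos (X.w_pos _) (X.w_pos _)

lemma summable_W_pow_mul_w (n : ℕ) :
    Summable fun e : X.graph.Dart => X.W e.edge ^ n * X.w e := by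
  have hb : ∀ e, X.w e ≤ ∑' d, X.w d := fun e =>
    X.finite_weight.le_tsum e fun d _ => (X.w_pos d).le
  refine Summable.of_nonneg_of_le (fun e => (mul_pos (pow_pos (X.W_edge_pos e) n) (X.w_pos e)).le)
    (fun e => ?_) (X.finite_weight.mul_left (((∑' d, X.w d) * ∑' d, X.w d) ^ n))
  have h0 := fun e => (X.w_pos e).le
  rw [W_edge]
  gcongr
  · exact h0 e
  · exact mul_nonneg (h0 _) (h0 _)
  · exact h0 _
  · exact (h0 e).trans (hb e)
  · exact hb e
  · exact hb _

open EllTwo in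
lemma B_odd_basisVec (n : ℕ) (x : V) :
    X.B (2 * n + 1) (basisVec x) = ∑' e : {e : X.graph.Dart // e.fst = x},
      ((X.W e.1.edge ^ n * X.w e : ℝ) : ℂ) • basisVec e.1.snd := by
  have h : (2 * n + 1) / 2 = n := by omega
  rw [B, if_neg (by omega), if_neg (by simp), h]
  exact tsum_unit_basisVec (X.summable_W_pow_mul_w n)
    (fun e => (mul_pos (pow_pos (X.W_edge_pos e) n) (X.w_pos e)).le) _ _ x

open EllTwo in
lemma B_even_basisVec (n : ℕ) (hn : 1 ≤ n) (x : V) :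
    X.B (2 * n) (basisVec x) = ∑' e : {e : X.graph.Dart // e.fst = x},
      ((X.W e.1.edge ^ n : ℝ) : ℂ) • basisVec x := by
  have h : (2 * n) / 2 = n := by omega
  have hs : Summable fun e : X.graph.Dart => X.W e.edge ^ n := by
    obtain ⟨k, rfl⟩ : ∃ k, n = k + 1 := ⟨n - 1, by omega⟩
    have h2 := (X.summable_W_pow_mul_w k).mul_right (∑' d, X.w d)
    refine Summable.of_nonneg_of_le (fun e => (pow_pos (X.W_edge_pos e) _).le) (fun e => ?_) h2
    have hb := X.finite_weight.le_tsum e.symm fun d _ => (X.w_pos d).le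
    have h1 := (mul_pos (pow_pos (X.W_edge_pos e) k) (X.w_pos e)).le
    calc X.W e.edge ^ (k + 1) = X.W e.edge ^ k * X.w e * X.w e.symm := by
          rw [pow_succ, X.W_edge e]; ring
      _ ≤ _ := mul_le_mul_of_nonneg_left hb h1
  rw [B, if_neg (by omega), if_pos (by simp), h,
    tsum_unit_basisVec hs (fun e => (pow_pos (X.W_edge_pos e) n).le)]
  exact tsum_congr fun e => by rw [e.2]

lemma pathWeight_pos {x y : V} (p : X.graph.Walk x y) : 0 < X.pathWeight p := by
  refine List.prod_pos fun a ha => ?_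
  obtain ⟨e, -, rfl⟩ := List.mem_map.mp ha
  exact X.w_pos e

lemma summable_prod_w (m : ℕ) : Summable fun f : Fin m → X.graph.Dart => ∏ i, X.w (f i) := by
  induction m with
  | zero => exact .of_finite
  | succ m ih =>
    rw [← (Fin.consEquiv fun _ => X.graph.Dart).summable_iff]
    have h := X.finite_weight.mul_of_nonneg ih (fun e => (X.w_pos e).le)
      (fun f => Finset.prod_nonneg fun i _ => (X.w_pos _).le)
    refine h.congr fun p => ?_
    simp [Fin.consEquiv, Fin.prod_univ_succ]

lemma summable_pathWeight {m : ℕ} (hm : m ≠ 0) :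
    Summable fun p : X.ReducedPath m => X.pathWeight p.1.2.2 := by
  let φ : X.ReducedPath m → (Fin m → X.graph.Dart) := fun p i =>
    p.1.2.2.darts.get (i.cast (by rw [SimpleGraph.Walk.length_darts, p.2.1]))
  have hφ : Function.Injective φ := by
    rintro ⟨⟨x, y, p⟩, hp, hp'⟩ ⟨⟨x', y', q⟩, hq, hq'⟩ h
    have hd : p.darts = q.darts := by
      refine List.ext_get (by simp at hp hq; simp [hp, hq]) fun n h1 h2 => ?_
      have hn : n < m := by simp at h1 hp; omega
      exact congrFun h ⟨n, hn⟩
    cases p with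
    | nil => exact absurd hp.symm hm
    | cons a p =>
      cases q with
      | nil => exact absurd hq.symm hm
      | cons b q =>
        have hs : (SimpleGraph.Walk.cons a p).support = (SimpleGraph.Walk.cons b q).support := by
          rw [← SimpleGraph.Walk.cons_map_snd_darts, ← SimpleGraph.Walk.cons_map_snd_darts, hd]
          have : x = x' := by
            have := congrArg (fun l => l.head?.map fun e => e.fst) hd
            simpa using this
          rw [this]
        have h1 : x = x' := by simpa using congrArg List.head? hs
        have h2 : y = y' := by
          have := congrArg List.getLast? hs
          simpa [List.getLast?_eq_getLast_of_ne_nil] using this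
        subst h1 h2
        have h3 := SimpleGraph.Walk.ext_support hs
        refine Subtype.ext ?_
        change (⟨x, y, .cons a p⟩ : Σ x y : V, X.graph.Walk x y) = ⟨x, y, .cons b q⟩
        rw [h3]
  refine (X.summable_prod_w m).comp_injective hφ |>.congr fun p => ?_
  obtain ⟨p, rfl, hp⟩ := p
  simp only [Function.comp, φ, pathWeight]
  rw [← List.prod_ofFn]
  congr 1
  apply List.ext_get <;> simp

open EllTwo in
lemma A_basisVec {m : ℕ} (hm : m ≠ 0) (x : V) :
    X.A m (basisVec x) = ∑' p : {p : X.ReducedPath m // p.1.1 = x},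
      (X.pathWeight p.1.1.2.2 : ℂ) • basisVec p.1.1.2.1 := by
  rw [A, if_neg hm]
  exact tsum_unit_basisVec (X.summable_pathWeight hm) (fun p => (X.pathWeight_pos _).le) _ _ x

/-- The operator `A(u) = ∑ uʲ A_j`, where the series converges in operator norm. -/
def AOp (u : ℂ) : EllTwo V →L[ℂ] EllTwo V := ∑' j : ℕ, u ^ j • X.A j

/-- The operator `B(u) = ∑ uʲ B_j`, where the series converges in operator norm. -/
def BOp (u : ℂ) : EllTwo V →L[ℂ] EllTwo V := ∑' j : ℕ, u ^ j • X.B j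

/-- The formal power series `A(u) = ∑ uʲ A_j` with operator coefficients. -/
def ASeries : PowerSeries (EllTwo V →L[ℂ] EllTwo V) := PowerSeries.mk X.A

/-- The formal power series `B(-u) = ∑ (-u)ʲ B_j` with operator coefficients. -/
def BNegSeries : PowerSeries (EllTwo V →L[ℂ] EllTwo V) :=
  PowerSeries.mk fun j => (-1 : ℂ) ^ j • X.B j

/-- The operator `1 - u τ (1 + u J)⁻¹ σ` on `ℓ²(VX)`, for `1 + u J` invertible. -/
def sunadaOp (u : ℂ) : EllTwo V →L[ℂ] EllTwo V :=
  1 - u • (X.tau ∘L Ring.inverse (1 + u • X.J) ∘L X.sigma)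

end WeightedGraph

end

open scoped ENNReal Topology
open Filter

noncomputable section

/-! ### Determinants of infinite matrices with absolutely summable entries -/

namespace Matrix

/-! Everything rests on the edge operator `T = σ τ - J` (`edgeOp`), whose matrix records how an
oriented edge can be continued without backtracking. Its determinant is computed in two ways.

Algebraically, `1 - u T = (1 + u J) (1 - u (1 + u J)⁻¹ σ τ)`. Multiplicativity together with `det (1
+ S τ) = det (1 + τ S)` gives `det (1 - u T) = det (1 + u J) · det (1 - u τ (1 + u J)⁻¹ σ)`
(`fredholmDet_one_sub_edgeOp`). As `J` only exchanges an edge with its reverse, `1 + u J` splits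
into 2×2 blocks of determinant `1 - u² W(e)`, whence `det (1 + u J) = P(u)`.

Combinatorially, `log det (1 - u T) = -∑ tr (Tᵏ) uᵏ / k`, and the trace is a sum over cyclic
non-backtracking sequences of edges. Each of these is a unique power of a unique prime closed path,
and a prime cycle of length `l` has exactly `l` base points. The series is therefore the logarithm
of the Euler product (`hasSum_neg_log`), so `Z(u)⁻¹ = det (1 - u T)` for small `u`, and the right
side is entire.

For the last part, `B_{n+1} = τ Jⁿ σ` and `A_{n+1} = τ Tⁿ σ`. Hence `B(-u) = 1 - u τ (1 + u J)⁻¹ σ`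
and `A(u) = 1 + u τ (1 - u T)⁻¹ σ` by Neumann series, and the resolvent identity for `u σ τ = (1 + u
J) - (1 - u T)` yields `A(u) B(-u) = 1`.

The analysis uses matrices with absolutely summable entries (`nu T ≠ ∞`), which is stronger than
trace class and easy to check because the weights are summable. The determinant is the sum of all
principal minors, dominated by products of row sums, so identities for finite matrices pass to the
limit over truncations. The operator `τ` is not summable, but bounded valency controls compositions
with it. -/

lemma apply_det_le {R n : Type*} [CommRing R] [Fintype n] [DecidableEq n] (N : R → ℝ≥0∞)
    (h0 : N 0 = 0) (h1 : N 1 ≤ 1) (hneg : ∀ a, N (-a) = N a) (hadd : ∀ a b, N (a + b) ≤ N a + N b)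
    (hmul : ∀ a b, N (a * b) ≤ N a * N b) (M : Matrix n n R) :
    N M.det ≤ ∏ i, ∑ j, N (M i j) := by
  rw [← det_transpose, det_apply, Finset.prod_univ_sum, Fintype.piFinset_univ]
  refine (Finset.le_sum_of_subadditive N h0.le hadd _ _).trans ?_
  have hsgn : ∀ σ : Equiv.Perm n, N (Equiv.Perm.sign σ • ∏ i, Mᵀ (σ i) i) ≤
      ∏ i, N (M i (σ i)) := by
    intro σ
    have : N (Equiv.Perm.sign σ • ∏ i, Mᵀ (σ i) i) = N (∏ i, M i (σ i)) := by
      rcases Int.units_eq_one_or (Equiv.Perm.sign σ) with h | h <;> simp [h, hneg]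
    rw [this]
    exact Finset.le_prod_of_submultiplicative N h1 hmul _ _
  refine (Finset.sum_le_sum fun σ _ => hsgn σ).trans ?_
  -- Permutations are among all functions `n → n`, and the sum over all functions is the expanded
  -- product of the row sums.
  rw [← Finset.sum_image (f := fun g : n → n => ∏ i, N (M i (g i)))
    (g := fun σ : Equiv.Perm n => (σ : n → n)) (DFunLike.coe_injective.injOn)]
  exact Finset.sum_le_sum_of_subset (Finset.subset_univ _)

end Matrix

/-- The left side is the expansion of `∏ (1 + r i)`, which converges along with `∑ r i`. This is the
domination used for every sum of minors. -/
lemma ENNReal.tsum_finset_prod_ne_top {ι : Type*} {r : ι → ℝ≥0∞} (hr : ∑' i, r i ≠ ∞) :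
    ∑' S : Finset ι, ∏ i ∈ S, r i ≠ ∞ := by
  lift r to ι → NNReal using fun i => ENNReal.ne_top_of_tsum_ne_top hr i
  have h : Summable r := ENNReal.tsum_coe_ne_top_iff_summable.mp hr
  have h2 := summable_finsetProd_of_summable_nonneg (f := fun i => (r i : ℝ))
    (fun i => (r i).coe_nonneg) (NNReal.summable_coe.mpr h)
  have h3 : Summable fun S : Finset ι => ∏ i ∈ S, r i := by
    rw [← NNReal.summable_coe]
    simpa using h2
  have := ENNReal.tsum_coe_ne_top_iff_summable.mpr h3
  simpa using this

namespace InfMatrix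

open Classical in
/-- The principal minor of a possibly infinite matrix at a finite set of indices. -/
def minor {R ι : Type*} [CommRing R] (M : ι → ι → R) (S : Finset ι) : R :=
  Matrix.det (Matrix.of fun i j : S => M i j)

/-- The sum of all finite principal minors of an infinite matrix `M`, i.e. `det (1 + M)`. -/
def minorSum {ι : Type*} (M : ι → ι → ℂ) : ℂ := ∑' S : Finset ι, minor M S

/-- The sum of the absolute values of the entries. -/
def absSum {ι κ : Type*} (M : ι → κ → ℂ) : ℝ≥0∞ := ∑' i, ∑' j, ‖M i j‖ₑ

variable {ι κ : Type*}

/-- The size function `N` is left abstract because the bound is needed twice: for the absolute value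
on `ℂ`, and for the weighted `ℓ¹`-norm of power series. -/
lemma apply_minor_le {R : Type*} [CommRing R] (N : R → ℝ≥0∞)
    (h0 : N 0 = 0) (h1 : N 1 ≤ 1) (hneg : ∀ a, N (-a) = N a) (hadd : ∀ a b, N (a + b) ≤ N a + N b)
    (hmul : ∀ a b, N (a * b) ≤ N a * N b) (M : ι → ι → R) (S : Finset ι) :
    N (minor M S) ≤ ∏ i ∈ S, ∑' j, N (M i j) := by
  classical
  refine (Matrix.apply_det_le N h0 h1 hneg hadd hmul _).trans ?_
  rw [← Finset.prod_coe_sort S]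
  refine Finset.prod_le_prod' fun i _ => ?_
  simp only [Matrix.of_apply]
  rw [Finset.sum_coe_sort S fun j => N (M i j)]
  exact ENNReal.sum_le_tsum S

lemma enorm_minor_le (M : ι → ι → ℂ) (S : Finset ι) :
    ‖minor M S‖ₑ ≤ ∏ i ∈ S, ∑' j, ‖M i j‖ₑ :=
  apply_minor_le (fun z : ℂ => ‖z‖ₑ) (by simp) (by simp) (fun a => enorm_neg a)
    (fun a b => enorm_add_le a b) (fun a b => (enorm_mul a b).le) M S

lemma norm_minor_le {M : ι → ι → ℂ} {r : ι → ℝ≥0∞} (hr : ∑' i, r i ≠ ∞)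
    (hM : ∀ i, ∑' j, ‖M i j‖ₑ ≤ r i) (S : Finset ι) :
    ‖minor M S‖ ≤ (∏ i ∈ S, r i).toReal := by
  rw [← toReal_enorm]
  refine ENNReal.toReal_mono ?_ ((enorm_minor_le M S).trans (Finset.prod_le_prod' fun i _ => hM i))
  exact ENNReal.prod_ne_top fun i _ => ENNReal.ne_top_of_tsum_ne_top hr i

lemma summable_prod_toReal {r : ι → ℝ≥0∞} (hr : ∑' i, r i ≠ ∞) :
    Summable fun S : Finset ι => (∏ i ∈ S, r i).toReal :=
  ENNReal.summable_toReal (ENNReal.tsum_finset_prod_ne_top hr)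

lemma summable_norm_minor {M : ι → ι → ℂ} (hM : absSum M ≠ ∞) :
    Summable fun S => ‖minor M S‖ :=
  (summable_prod_toReal hM).of_nonneg_of_le (fun _ => norm_nonneg _)
    (norm_minor_le hM fun _ => le_rfl)

lemma summable_minor {M : ι → ι → ℂ} (hM : absSum M ≠ ∞) : Summable (minor M) :=
  (summable_norm_minor hM).of_norm

lemma tendsto_minor {α : Type*} {l : Filter α} {M : ι → ι → ℂ} {N : α → ι → ι → ℂ}
    (h : ∀ i j, Tendsto (fun a => N a i j) l (𝓝 (M i j))) (S : Finset ι) :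
    Tendsto (fun a => minor (N a) S) l (𝓝 (minor M S)) := by
  classical
  have hc : Continuous fun A : Matrix S S ℂ => A.det := continuous_id.matrix_det
  refine (hc.tendsto _).comp ?_
  refine tendsto_pi_nhds.mpr fun i => tendsto_pi_nhds.mpr fun j => h i j

/-- Dominated convergence over the finite index sets. A uniform bound for the row sums and entrywise
convergence suffice; this is the device that carries finite determinant identities over to infinite
matrices. -/
lemma tendsto_minorSum {α : Type*} {l : Filter α} {M : ι → ι → ℂ} {N : α → ι → ι → ℂ}
    {r : ι → ℝ≥0∞} (hr : ∑' i, r i ≠ ∞) (hN : ∀ a i, ∑' j, ‖N a i j‖ₑ ≤ r i)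
    (h : ∀ i j, Tendsto (fun a => N a i j) l (𝓝 (M i j))) :
    Tendsto (fun a => minorSum (N a)) l (𝓝 (minorSum M)) :=
  tendsto_tsum_of_dominated_convergence (summable_prod_toReal hr) (tendsto_minor h)
    (Eventually.of_forall fun a S => norm_minor_le hr (hN a) S)

lemma minor_eq_zero {M : ι → ι → ℂ} {S : Finset ι} {i : ι} (hi : i ∈ S) (h : ∀ j, M i j = 0) :
    minor M S = 0 := by
  classical
  exact Matrix.det_eq_zero_of_row_eq_zero ⟨i, hi⟩ fun j => h j

lemma _root_.Matrix.det_one_add_eq_sum_minor {n : Type*} [Fintype n] [DecidableEq n]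
    (M : n → n → ℂ) : (1 + Matrix.of M).det = ∑ S : Finset n, minor M S := by
  have h1 : (1 + Matrix.of M).det =
      (Matrix.det (1 + (Polynomial.X : Polynomial ℂ) • (Matrix.of M).map Polynomial.C)).eval 1 := by
    rw [← Polynomial.coe_evalRingHom, RingHom.map_det]
    congr 1
    ext i j
    by_cases hij : i = j <;> simp [hij]
  set p := Matrix.det (1 + (Polynomial.X : Polynomial ℂ) • (Matrix.of M).map Polynomial.C)
  -- The maximum makes the range long enough both for the degree of `p` and for the size of every
  -- subset.
  have h2 : ∀ S ∈ (Finset.univ : Finset (Finset n)),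
      S.card ∈ Finset.range (max p.natDegree (Fintype.card n) + 1) := fun S _ => by
    have := S.card_le_univ
    simp only [Finset.mem_range]
    omega
  rw [h1, Polynomial.eval_eq_sum_range' (n := max p.natDegree (Fintype.card n) + 1) (by omega),
    ← Finset.sum_fiberwise_of_maps_to h2]
  refine Finset.sum_congr rfl fun k _ => ?_
  rw [one_pow, mul_one, Matrix.coeff_det_one_add_X_smul_eq_sum_minors]
  refine Finset.sum_congr ?_ fun S _ => ?_
  · ext S; simp [Finset.mem_powersetCard]
  · unfold minor
    convert rfl
    rfl

lemma minor_map {R : Type*} [CommRing R] (f : κ ↪ ι) (M : ι → ι → R) (S : Finset κ) :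
    minor (fun i j => M (f i) (f j)) S = minor M (S.map f) := by
  classical
  let e : S ≃ (S.map f : Finset ι) :=
    Equiv.ofBijective (fun x => ⟨f x, Finset.mem_map_of_mem f x.2⟩)
      ⟨fun x y h => Subtype.ext (f.injective (congrArg Subtype.val h)), fun ⟨y, hy⟩ => by
        obtain ⟨x, hx, rfl⟩ := Finset.mem_map.mp hy
        exact ⟨⟨x, hx⟩, rfl⟩⟩
  unfold minor
  rw [← Matrix.det_submatrix_equiv_self e]
  rfl

lemma minorSum_reindex (f : κ ≃ ι) (M : ι → ι → ℂ) :
    minorSum (fun i j => M (f i) (f j)) = minorSum M := by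
  unfold minorSum
  rw [← (Equiv.finsetCongr f).tsum_eq]
  exact tsum_congr fun S => minor_map f.toEmbedding M S

lemma minorSum_eq_det [DecidableEq ι] {M : ι → ι → ℂ} (F : Finset ι)
    (h : ∀ i ∉ F, ∀ j, M i j = 0) :
    minorSum M = (1 + Matrix.of fun i j : F => M i j).det := by
  rw [Matrix.det_one_add_eq_sum_minor, minorSum, tsum_eq_sum (s := F.powerset)]
  · symm
    refine Finset.sum_bij (fun S _ => S.map (Function.Embedding.subtype _)) ?_ ?_ ?_ ?_
    · intro S _
      rw [Finset.mem_powerset]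
      intro i hi
      simp at hi
      exact hi.1
    · intro S _ T _ hST
      exact Finset.map_injective _ hST
    · intro S hS
      refine ⟨S.subtype (· ∈ F), Finset.mem_univ _, ?_⟩
      rw [Finset.subtype_map_of_mem]
      exact fun i hi => Finset.mem_powerset.mp hS hi
    · exact fun S _ => minor_map (Function.Embedding.subtype (· ∈ F)) M S
  · intro S hS
    rw [Finset.mem_powerset, Finset.not_subset] at hS
    obtain ⟨i, hi, hiF⟩ := hS
    exact minor_eq_zero hi (h i hiF)

/-- The restriction of a matrix to a finite set of rows and columns, extended by zero. -/
def trunc (F : Finset ι) (G : Finset κ) (M : ι → κ → ℂ) (i : ι) (j : κ) : ℂ := by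
  classical exact if i ∈ F ∧ j ∈ G then M i j else 0

lemma trunc_of_mem {F : Finset ι} {G : Finset κ} {M : ι → κ → ℂ} {i : ι} {j : κ}
    (hi : i ∈ F) (hj : j ∈ G) : trunc F G M i j = M i j := by
  classical exact if_pos ⟨hi, hj⟩

lemma enorm_trunc_le (F : Finset ι) (G : Finset κ) (M : ι → κ → ℂ) (i : ι) (j : κ) :
    ‖trunc F G M i j‖ₑ ≤ ‖M i j‖ₑ := by
  classical
  unfold trunc
  split_ifs <;> simp

lemma tendsto_trunc {α : Type*} {l : Filter α} {F : α → Finset ι} {G : α → Finset κ}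
    (hF : Tendsto F l atTop) (hG : Tendsto G l atTop) (M : ι → κ → ℂ) (i : ι) (j : κ) :
    Tendsto (fun a => trunc (F a) (G a) M i j) l (𝓝 (M i j)) := by
  refine tendsto_const_nhds.congr' ?_
  filter_upwards [hF.eventually_ge_atTop {i}, hG.eventually_ge_atTop {j}] with a h1 h2
  rw [trunc_of_mem] <;> [exact h1 (by simp); exact h2 (by simp)]

lemma minorSum_trunc [DecidableEq ι] (F : Finset ι) (M : ι → ι → ℂ) :
    minorSum (trunc F F M) = (1 + Matrix.of fun i j : F => M i j).det := by
  rw [minorSum_eq_det F]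
  · congr 2
    ext i j
    exact trunc_of_mem i.2 j.2
  · intro i hi j
    classical exact if_neg fun h => hi h.1

lemma tendsto_minorSum_trunc {M : ι → ι → ℂ} (hM : absSum M ≠ ∞) :
    Tendsto (fun F : Finset ι => minorSum (trunc F F M)) atTop (𝓝 (minorSum M)) := by
  exact tendsto_minorSum hM (fun F i => ENNReal.tsum_le_tsum fun j => enorm_trunc_le F F M i j)
    fun i j => tendsto_trunc tendsto_id tendsto_id M i j

/-- The product of infinite matrices. -/
def mul {η : Type*} (M : ι → κ → ℂ) (N : κ → η → ℂ) (i : ι) (j : η) : ℂ := ∑' k, M i k * N k j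

lemma tsum_enorm_mul_le {η : Type*} (M : ι → κ → ℂ) (N : κ → η → ℂ) (i : ι) :
    ∑' j, ‖mul M N i j‖ₑ ≤ ∑' k, ‖M i k‖ₑ * ∑' j, ‖N k j‖ₑ := by
  calc ∑' j, ‖mul M N i j‖ₑ ≤ ∑' j, ∑' k, ‖M i k‖ₑ * ‖N k j‖ₑ := by
        refine ENNReal.tsum_le_tsum fun j => (enorm_tsum_le_tsum_enorm).trans ?_
        exact ENNReal.tsum_le_tsum fun k => (enorm_mul _ _).le
    _ = _ := by
        rw [ENNReal.tsum_comm]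
        exact tsum_congr fun k => ENNReal.tsum_mul_left

lemma tendsto_mul_trunc {η α : Type*} {l : Filter α} {F : α → Finset ι} {G : α → Finset κ}
    {H : α → Finset η} (hF : Tendsto F l atTop) (hG : Tendsto G l atTop) (hH : Tendsto H l atTop)
    (M : ι → κ → ℂ) (N : κ → η → ℂ) (i : ι) (j : η) (h : ∑' k, ‖M i k‖ₑ * ‖N k j‖ₑ ≠ ∞) :
    Tendsto (fun a => mul (trunc (F a) (G a) M) (trunc (G a) (H a) N) i j) l
      (𝓝 (mul M N i j)) := by
  refine tendsto_tsum_of_dominated_convergence (ENNReal.summable_toReal h)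
    (fun k => (tendsto_trunc hF hG M i k).mul (tendsto_trunc hG hH N k j))
    (Eventually.of_forall fun a k => ?_)
  rw [← toReal_enorm, enorm_mul]
  exact ENNReal.toReal_mono (ENNReal.ne_top_of_tsum_ne_top h k)
    (mul_le_mul' (enorm_trunc_le _ _ _ _ _) (enorm_trunc_le _ _ _ _ _))

lemma mul_trunc {η : Type*} (F : Finset ι) (G : Finset κ) (H : Finset η)
    (M : ι → κ → ℂ) (N : κ → η → ℂ) :
    mul (trunc F G M) (trunc G H N) = trunc F H fun i j => ∑ k ∈ G, M i k * N k j := by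
  classical
  ext i j
  unfold mul
  rw [tsum_eq_sum (s := G)]
  · by_cases h : i ∈ F ∧ j ∈ H
    · rw [trunc_of_mem h.1 h.2]
      exact Finset.sum_congr rfl fun k hk => by rw [trunc_of_mem h.1 hk, trunc_of_mem hk h.2]
    · rw [trunc, if_neg h]
      refine Finset.sum_eq_zero fun k hk => ?_
      rcases not_and_or.mp h with h | h <;> simp [trunc, h]
  · intro k hk
    rw [trunc, if_neg fun h => hk h.2, zero_mul]

/-- `det (1 + M N) = det (1 + N M)`. -/
lemma minorSum_mul_comm {M : ι → κ → ℂ} {N : κ → ι → ℂ}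
    (h1 : ∑' i, ∑' k, ‖M i k‖ₑ * ∑' j, ‖N k j‖ₑ ≠ ∞)
    (h2 : ∑' k, ∑' i, ‖N k i‖ₑ * ∑' j, ‖M i j‖ₑ ≠ ∞) :
    minorSum (mul M N) = minorSum (mul N M) := by
  classical
  have hF : Tendsto (fun p : Finset ι × Finset κ => p.1) atTop atTop := by
    rw [← prod_atTop_atTop_eq]; exact tendsto_fst
  have hG : Tendsto (fun p : Finset ι × Finset κ => p.2) atTop atTop := by
    rw [← prod_atTop_atTop_eq]; exact tendsto_snd
  -- Both index sets are truncated at once and the limit is taken over pairs of finite sets. The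
  -- hypotheses do not ask both matrices to be summable: one of them may have merely bounded row and
  -- column sums, as the matrix of `τ` does.
  have t1 : Tendsto (fun p : Finset ι × Finset κ =>
      minorSum (mul (trunc p.1 p.2 M) (trunc p.2 p.1 N))) atTop (𝓝 (minorSum (mul M N))) := by
    refine tendsto_minorSum h1 (fun p i => (tsum_enorm_mul_le _ _ _).trans ?_) fun i j => ?_
    · gcongr <;> apply enorm_trunc_le
    · refine tendsto_mul_trunc hF hG hF M N i j ?_
      refine ne_top_of_le_ne_top (ENNReal.ne_top_of_tsum_ne_top h1 i) ?_
      gcongr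
      exact ENNReal.le_tsum (f := fun j => ‖N _ j‖ₑ) j
  have t2 : Tendsto (fun p : Finset ι × Finset κ =>
      minorSum (mul (trunc p.2 p.1 N) (trunc p.1 p.2 M))) atTop (𝓝 (minorSum (mul N M))) := by
    refine tendsto_minorSum h2 (fun p i => (tsum_enorm_mul_le _ _ _).trans ?_) fun i j => ?_
    · gcongr <;> apply enorm_trunc_le
    · refine tendsto_mul_trunc hG hF hG N M i j ?_
      refine ne_top_of_le_ne_top (ENNReal.ne_top_of_tsum_ne_top h2 i) ?_
      gcongr
      exact ENNReal.le_tsum (f := fun j => ‖M _ j‖ₑ) j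
  refine tendsto_nhds_unique t1 (t2.congr fun p => ?_)
  rw [mul_trunc, mul_trunc, minorSum_trunc, minorSum_trunc]
  have e1 : (Matrix.of fun i j : p.1 => ∑ k ∈ p.2, M i k * N k j) =
      (Matrix.of fun (i : p.1) (k : p.2) => M i k) *
        (Matrix.of fun (k : p.2) (i : p.1) => N k i) := by
    ext i j
    rw [Matrix.mul_apply, Matrix.of_apply, ← Finset.sum_coe_sort]
    rfl
  have e2 : (Matrix.of fun i j : p.2 => ∑ k ∈ p.1, N i k * M k j) =
      (Matrix.of fun (k : p.2) (i : p.1) => N k i) *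
        (Matrix.of fun (i : p.1) (k : p.2) => M i k) := by
    ext i j
    rw [Matrix.mul_apply, Matrix.of_apply, ← Finset.sum_coe_sort]
    rfl
  rw [e1, e2, Matrix.det_one_add_mul_comm]

lemma le_absSum (M : ι → κ → ℂ) (i : ι) : ∑' j, ‖M i j‖ₑ ≤ absSum M :=
  ENNReal.le_tsum (f := fun i => ∑' j, ‖M i j‖ₑ) i

/-- `det ((1 + M) (1 + N)) = det (1 + M) det (1 + N)`. -/
lemma minorSum_mul {M N : ι → ι → ℂ} (hM : absSum M ≠ ∞) (hN : absSum N ≠ ∞) :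
    minorSum (M + N + mul M N) = minorSum M * minorSum N := by
  classical
  -- A row sum of `M N` is at most the row sum of `M` times `absSum N`. So `r i` bounds row `i` of
  -- the matrix for all truncations simultaneously, with total `absSum M + absSum N + absSum M *
  -- absSum N`.
  let r : ι → ℝ≥0∞ := fun i => ∑' j, ‖M i j‖ₑ + ∑' j, ‖N i j‖ₑ + (∑' j, ‖M i j‖ₑ) * absSum N
  have hr : ∑' i, r i ≠ ∞ := by
    simp only [r, ENNReal.tsum_add, ENNReal.tsum_mul_right]
    change absSum M + absSum N + absSum M * absSum N ≠ ∞
    finiteness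
  have t : Tendsto (fun F : Finset ι =>
      minorSum (trunc F F M + trunc F F N + mul (trunc F F M) (trunc F F N))) atTop
      (𝓝 (minorSum (M + N + mul M N))) := by
    refine tendsto_minorSum hr (fun F i => ?_) fun i j => ?_
    · calc ∑' j, ‖(trunc F F M + trunc F F N + mul (trunc F F M) (trunc F F N)) i j‖ₑ
          ≤ ∑' j, (‖trunc F F M i j‖ₑ + ‖trunc F F N i j‖ₑ +
              ‖mul (trunc F F M) (trunc F F N) i j‖ₑ) := by
            refine ENNReal.tsum_le_tsum fun j => (enorm_add_le _ _).trans ?_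
            gcongr
            exact enorm_add_le _ _
        _ ≤ r i := by
            rw [ENNReal.tsum_add, ENNReal.tsum_add]
            refine add_le_add (add_le_add ?_ ?_) ?_
            · exact ENNReal.tsum_le_tsum fun j => enorm_trunc_le _ _ _ _ _
            · exact ENNReal.tsum_le_tsum fun j => enorm_trunc_le _ _ _ _ _
            · refine (tsum_enorm_mul_le _ _ _).trans ?_
              rw [← ENNReal.tsum_mul_right]
              gcongr with k
              · apply enorm_trunc_le
              · refine le_trans ?_ (le_absSum N k)
                gcongr
                apply enorm_trunc_le
    · refine ((tendsto_trunc tendsto_id tendsto_id M i j).add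
        (tendsto_trunc tendsto_id tendsto_id N i j)).add
        (tendsto_mul_trunc tendsto_id tendsto_id tendsto_id M N i j ?_)
      have : (∑' k, ‖M i k‖ₑ) * absSum N ≠ ∞ :=
        ENNReal.mul_ne_top (ne_top_of_le_ne_top hM (le_absSum M i)) hN
      rw [← ENNReal.tsum_mul_right] at this
      refine ne_top_of_le_ne_top this ?_
      gcongr with k
      exact (ENNReal.le_tsum (f := fun j => ‖N k j‖ₑ) j).trans (le_absSum N k)
  refine tendsto_nhds_unique t
    (((tendsto_minorSum_trunc hM).mul (tendsto_minorSum_trunc hN)).congr fun F => ?_)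
  rw [minorSum_trunc, minorSum_trunc, ← Matrix.det_mul, mul_trunc, minorSum_eq_det F]
  · have e : ∀ A B : Matrix F F ℂ, (1 + A) * (1 + B) = 1 + (A + B + A * B) := fun A B => by
      noncomm_ring
    rw [e]
    congr 2
    ext i j
    simp only [Matrix.add_apply, Matrix.of_apply, Pi.add_apply, trunc_of_mem i.2 j.2,
      Matrix.mul_apply]
    rw [← Finset.sum_coe_sort F]
  · intro i hi j
    simp [trunc, hi]

end InfMatrix

/-! ### Operators with absolutely summable matrices -/

namespace EllTwo

open InfMatrix

variable {ι κ η : Type*}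

/-- The matrix entry of an operator `ℓ²(κ) → ℓ²(ι)` as a continuous linear functional. -/
def matCLM (i : ι) (j : κ) : (EllTwo κ →L[ℂ] EllTwo ι) →L[ℂ] ℂ :=
  (innerSL ℂ (basisVec i)) ∘L (ContinuousLinearMap.apply ℂ (EllTwo ι) (basisVec j))

/-- The matrix of an operator `ℓ²(κ) → ℓ²(ι)` in the standard bases. -/
def mat (T : EllTwo κ →L[ℂ] EllTwo ι) (i : ι) (j : κ) : ℂ := matCLM i j T

lemma mat_eq_inner (T : EllTwo κ →L[ℂ] EllTwo ι) (i : ι) (j : κ) :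
    mat T i j = inner ℂ (basisVec i) (T (basisVec j)) := rfl

lemma inner_basisVec (i : ι) (v : EllTwo ι) : inner ℂ (basisVec i) v = v i := by
  classical
  rw [basisVec, lp.inner_single_left]
  simp

lemma mat_eq_apply (T : EllTwo κ →L[ℂ] EllTwo ι) (i : ι) (j : κ) :
    mat T i j = T (basisVec j) i := inner_basisVec i _

lemma mat_add (S T : EllTwo κ →L[ℂ] EllTwo ι) : mat (S + T) = mat S + mat T := by
  ext i j; exact map_add (matCLM i j) S T

lemma mat_sub (S T : EllTwo κ →L[ℂ] EllTwo ι) : mat (S - T) = mat S - mat T := by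
  ext i j; exact map_sub (matCLM i j) S T

lemma mat_neg (T : EllTwo κ →L[ℂ] EllTwo ι) : mat (-T) = -mat T := by
  ext i j; exact map_neg (matCLM i j) T

lemma mat_smul (c : ℂ) (T : EllTwo κ →L[ℂ] EllTwo ι) : mat (c • T) = c • mat T := by
  ext i j; exact map_smul (matCLM i j) c T

open Classical in
lemma basisVec_apply (i j : ι) : basisVec i j = if j = i then (1 : ℂ) else 0 := by
  rw [basisVec, lp.single_apply, Pi.single_apply]

open Classical in
lemma mat_unit (i : ι) (j : κ) (k : ι) (l : κ) :
    mat (unit i j) k l = if (i, j) = (k, l) then 1 else 0 := by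
  rw [mat_eq_apply, unit_basisVec]
  by_cases h : j = l
  · simp [h, basisVec_apply, eq_comm]
  · simp [h]

lemma hasSum_smul_basisVec (v : EllTwo ι) : HasSum (fun i => v i • basisVec i) v := by
  classical
  convert lp.hasSum_single (p := 2) (by norm_num) v using 2 with i
  rw [basisVec, ← lp.single_smul, smul_eq_mul, mul_one]

lemma ext_basisVec {E : Type*} [NormedAddCommGroup E] [NormedSpace ℂ E] {S T : EllTwo κ →L[ℂ] E}
    (h : ∀ j, S (basisVec j) = T (basisVec j)) : S = T := by
  ext1 v
  refine ((hasSum_smul_basisVec v).mapL S).unique ?_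
  simpa [h] using (hasSum_smul_basisVec v).mapL T

lemma ext_mat {S T : EllTwo κ →L[ℂ] EllTwo ι} (h : ∀ i j, mat S i j = mat T i j) : S = T := by
  refine ext_basisVec fun j => ?_
  ext i
  rw [← mat_eq_apply, ← mat_eq_apply, h]

lemma mat_comp (S : EllTwo κ →L[ℂ] EllTwo ι) (T : EllTwo η →L[ℂ] EllTwo κ) :
    mat (S ∘L T) = mul (mat S) (mat T) := by
  ext i j
  have h := (hasSum_smul_basisVec (T (basisVec j))).mapL ((innerSL ℂ (basisVec i)) ∘L S)
  refine h.tsum_eq.symm.trans (tsum_congr fun k => ?_)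
  simp only [map_smul, smul_eq_mul]
  rw [mul_comm, mat_eq_apply T]
  rfl

/-- The sum of the absolute values of the matrix entries of an operator. -/
def nu (T : EllTwo κ →L[ℂ] EllTwo ι) : ℝ≥0∞ := absSum (mat T)

/-- Only an inequality, since several indices may contribute to the same entry. It reads finiteness
of `nu` off a defining series. -/
lemma nu_le_of_hasSum {α : Type*} {c : α → ℂ} {f : α → ι} {g : α → κ}
    {T : EllTwo κ →L[ℂ] EllTwo ι} (h : HasSum (fun a => c a • unit (f a) (g a)) T) :
    nu T ≤ ∑' a, ‖c a‖ₑ := by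
  classical
  have h1 : ∀ i j, ‖mat T i j‖ₑ ≤ ∑' a, if (f a, g a) = (i, j) then ‖c a‖ₑ else 0 := fun i j => by
    have := (h.mapL (matCLM i j)).tsum_eq
    rw [mat, ← this]
    refine enorm_tsum_le_tsum_enorm.trans (ENNReal.tsum_le_tsum fun a => ?_)
    rw [map_smul]
    change ‖c a • mat (unit (f a) (g a)) i j‖ₑ ≤ _
    rw [mat_unit]
    split_ifs <;> simp
  calc nu T ≤ ∑' i, ∑' j, ∑' a, if (f a, g a) = (i, j) then ‖c a‖ₑ else 0 := by
        unfold nu absSum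
        gcongr
        exact h1 _ _
    _ = ∑' a, ∑' p : ι × κ, if (f a, g a) = p then ‖c a‖ₑ else 0 := by
        rw [ENNReal.tsum_comm (α := α)]
        exact (ENNReal.tsum_prod
          (f := fun i j => ∑' a, if (f a, g a) = (i, j) then ‖c a‖ₑ else 0)).symm
    _ = _ := tsum_congr fun a => by simp

lemma hasSum_unit {T : EllTwo κ →L[ℂ] EllTwo ι} (h : nu T ≠ ∞) :
    HasSum (fun p : ι × κ => mat T p.1 p.2 • unit p.1 p.2) T := by
  classical
  have hs : Summable fun p : ι × κ => mat T p.1 p.2 • (unit p.1 p.2 : EllTwo κ →L[ℂ] EllTwo ι) := by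
    refine Summable.of_norm ?_
    have h' : ∑' p : ι × κ, ‖mat T p.1 p.2‖ₑ ≠ ∞ := by
      rwa [ENNReal.tsum_prod (f := fun i j => ‖mat T i j‖ₑ)]
    refine (ENNReal.summable_toReal h').congr fun p => ?_
    rw [norm_smul, norm_unit, mul_one, toReal_enorm]
  convert hs.hasSum
  refine ext_mat fun i j => ?_
  have := (hs.hasSum.mapL (matCLM i j)).tsum_eq
  rw [mat, mat, ← this, tsum_eq_single (i, j)]
  · rw [map_smul]
    change _ = _ • mat (unit i j) i j
    rw [mat_unit]
    simp [mat]
  · rintro ⟨k, l⟩ hne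
    rw [map_smul]
    change _ • mat (unit k l) i j = 0
    rw [mat_unit, if_neg hne, smul_zero]

/-- A summable family has countable support, which embeds into `ℕ`; outside the image the sequences
are extended by zero. -/
lemma _root_.isTraceClass_of_hasSum {α H : Type*} [NormedAddCommGroup H] [InnerProductSpace ℂ H]
    {T : H →L[ℂ] H} {x y : α → H} (hs : Summable fun a => ‖x a‖ * ‖y a‖)
    (h : ∀ v, HasSum (fun a => inner ℂ (x a) v • y a) (T v)) : IsTraceClass T := by
  have hc : Countable (Function.support fun a => ‖x a‖ * ‖y a‖) := hs.countable_support.to_subtype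
  obtain ⟨e, he⟩ := exists_injective_nat (Function.support fun a => ‖x a‖ * ‖y a‖)
  refine ⟨Function.extend e (fun a => x a) 0, Function.extend e (fun a => y a) 0, ?_, fun v => ?_⟩
  · rw [← he.summable_iff]
    · refine (hs.subtype (Function.support fun a => ‖x a‖ * ‖y a‖)).congr fun a => ?_
      simp [he.extend_apply]
    · intro n hn
      rw [Function.extend_apply' _ _ _ (by simpa using hn)]
      simp
  · rw [← he.hasSum_iff]
    · have hsub : Function.support (fun a => inner ℂ (x a) v • y a) ⊆
          Function.support fun a => ‖x a‖ * ‖y a‖ := by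
        intro a ha hxy
        refine ha ?_
        rcases mul_eq_zero.mp hxy with h0 | h0 <;> simp [norm_eq_zero.mp h0]
      have := (hasSum_subtype_iff_of_support_subset hsub).mpr (h v)
      convert this using 1
      funext a
      simp [he.extend_apply]
    · intro n hn
      rw [Function.extend_apply' _ _ _ (by simpa using hn)]
      simp

lemma tsum_enorm_mat (T : EllTwo κ →L[ℂ] EllTwo ι) : ∑' p : ι × κ, ‖mat T p.1 p.2‖ₑ = nu T :=
  ENNReal.tsum_prod (f := fun i j => ‖mat T i j‖ₑ)

lemma isTraceClass_of_nu {T : EllTwo ι →L[ℂ] EllTwo ι} (h : nu T ≠ ∞) : IsTraceClass T := by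
  refine isTraceClass_of_hasSum (α := ι × ι) (x := fun p => basisVec p.2)
    (y := fun p => mat T p.1 p.2 • basisVec p.1) ?_ fun v => ?_
  · refine (ENNReal.summable_toReal ((tsum_enorm_mat T).trans_ne h)).congr fun p => ?_
    rw [norm_smul, norm_basisVec, norm_basisVec, mul_one, one_mul, toReal_enorm]
  · convert (hasSum_unit h).mapL (ContinuousLinearMap.apply ℂ (EllTwo ι) v) using 2 with p
    · simp [unit, smul_smul, mul_comm]
    · rfl

lemma nu_zero : nu (0 : EllTwo κ →L[ℂ] EllTwo ι) = 0 := by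
  simp [nu, absSum, mat]

lemma nu_add_le (S T : EllTwo κ →L[ℂ] EllTwo ι) : nu (S + T) ≤ nu S + nu T := by
  simp only [nu, absSum, mat_add, ← ENNReal.tsum_add]
  gcongr
  exact enorm_add_le _ _

lemma nu_smul (c : ℂ) (T : EllTwo κ →L[ℂ] EllTwo ι) : nu (c • T) = ‖c‖ₑ * nu T := by
  simp only [nu, absSum, mat_smul, ← ENNReal.tsum_mul_left, Pi.smul_apply, smul_eq_mul, enorm_mul]

lemma nu_neg (T : EllTwo κ →L[ℂ] EllTwo ι) : nu (-T) = nu T := by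
  simp [nu, absSum, mat_neg]

lemma nu_sub_le (S T : EllTwo κ →L[ℂ] EllTwo ι) : nu (S - T) ≤ nu S + nu T := by
  rw [sub_eq_add_neg, ← nu_neg T]
  exact nu_add_le _ _

lemma enorm_apply_basisVec_le (T : EllTwo κ →L[ℂ] EllTwo ι) (j : κ) :
    ‖T (basisVec j)‖ₑ ≤ ∑' i, ‖mat T i j‖ₑ := by
  rw [← (hasSum_smul_basisVec (T (basisVec j))).tsum_eq]
  refine enorm_tsum_le_tsum_enorm.trans (ENNReal.tsum_le_tsum fun i => ?_)
  rw [enorm_smul, mat_eq_apply, ← ofReal_norm (basisVec i), norm_basisVec]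
  simp

lemma enorm_mat_le (T : EllTwo κ →L[ℂ] EllTwo ι) (i : ι) (j : κ) :
    ‖mat T i j‖ₑ ≤ ‖T (basisVec j)‖ₑ := by
  rw [mat_eq_inner, enorm_le_iff_norm_le]
  refine (norm_inner_le_norm _ _).trans ?_
  rw [norm_basisVec, one_mul]

/-- Between two summable factors an operator that is merely bounded is harmless: an entry in column
`j` of `K T` is at most `‖K‖` times the `ℓ¹`-norm of column `j` of `T`, uniformly in the row, and
the sum over rows is paid for by `S`. The bound fails for `K T` alone. -/
lemma nu_comp_comp_le {θ : Type*} (S : EllTwo κ →L[ℂ] EllTwo ι) (K : EllTwo η →L[ℂ] EllTwo κ)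
    (T : EllTwo θ →L[ℂ] EllTwo η) : nu (S ∘L K ∘L T) ≤ nu S * (‖K‖ₑ * nu T) := by
  have h1 : ∀ k, ∑' j, ‖mat (K ∘L T) k j‖ₑ ≤ ‖K‖ₑ * nu T := fun k => by
    unfold nu absSum
    rw [ENNReal.tsum_comm, ← ENNReal.tsum_mul_left]
    gcongr with j
    refine (enorm_mat_le _ _ _).trans (le_trans ?_
      (mul_le_mul_right (enorm_apply_basisVec_le T j) _))
    exact ContinuousLinearMap.le_opENorm K _
  unfold nu absSum at *
  rw [mat_comp, ← ENNReal.tsum_mul_right]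
  refine ENNReal.tsum_le_tsum fun i => (tsum_enorm_mul_le _ _ _).trans ?_
  rw [← ENNReal.tsum_mul_right]
  gcongr with k
  exact h1 k

lemma nu_comp_le (S : EllTwo κ →L[ℂ] EllTwo ι) (T : EllTwo η →L[ℂ] EllTwo κ) :
    nu (S ∘L T) ≤ nu S * nu T := by
  unfold nu absSum
  rw [mat_comp, ← ENNReal.tsum_mul_right]
  refine ENNReal.tsum_le_tsum fun i => (tsum_enorm_mul_le _ _ _).trans ?_
  rw [← ENNReal.tsum_mul_right]
  gcongr with k
  exact le_absSum (mat T) k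

lemma nu_pow_comp_le (S : EllTwo ι →L[ℂ] EllTwo ι) (T : EllTwo η →L[ℂ] EllTwo ι) (n : ℕ) :
    nu ((S ^ n) ∘L T) ≤ nu S ^ n * nu T := by
  induction n with
  | zero => simp [ContinuousLinearMap.one_def]
  | succ n ih =>
    rw [pow_succ', pow_succ', mul_assoc]
    exact (nu_comp_le S ((S ^ n) ∘L T)).trans (mul_le_mul_right ih _)

/-- The Fredholm determinant is the sum of all principal minors. -/
lemma _root_.fredholmDet_eq_minorSum {R : EllTwo ι →L[ℂ] EllTwo ι} (h : nu (R - 1) ≠ ∞) :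
    fredholmDet R = minorSum (mat (R - 1)) := by
  classical
  have hs := (Equiv.sigmaFiberEquiv (Finset.card (α := ι))).summable_iff.mpr (summable_minor h)
  rw [minorSum, ← (Equiv.sigmaFiberEquiv (Finset.card (α := ι))).tsum_eq]
  refine Eq.trans ?_ (hs.tsum_sigma).symm
  refine tsum_congr fun k => ?_
  rw [traceExteriorPower, ← tsum_mul_left]
  refine tsum_congr fun S => ?_
  obtain ⟨S, rfl⟩ := S
  change _ = minor (mat (R - 1)) S
  have e : (Matrix.of fun i j : S => entry (ι := ι) (1 - R) i j) =
      -Matrix.of fun i j : S => mat (ι := ι) (κ := ι) (R - 1) i j := by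
    refine Matrix.ext fun i j => ?_
    change mat (1 - R) i.1 j.1 = -mat (R - 1) i.1 j.1
    rw [← neg_sub R 1, mat_neg]
    rfl
  -- The sign `(-1)ᵏ` in the definition is absorbed by passing from `1 - R` to `R - 1` in a minor of
  -- size `k`.
  rw [e, Matrix.det_neg, Fintype.card_coe, ← mul_assoc, ← mul_pow]
  simp [minor]

lemma _root_.fredholmDet_mul {R S : EllTwo ι →L[ℂ] EllTwo ι} (hR : nu (R - 1) ≠ ∞)
    (hS : nu (S - 1) ≠ ∞) : fredholmDet (R * S) = fredholmDet R * fredholmDet S := by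
  have e : R * S - 1 = (R - 1) + (S - 1) + (R - 1) ∘L (S - 1) := by
    change _ = (R - 1) + (S - 1) + (R - 1) * (S - 1)
    noncomm_ring
  have h : nu (R * S - 1) ≠ ∞ := by
    rw [e]
    refine ne_top_of_le_ne_top ?_ ((nu_add_le _ _).trans
      (add_le_add (nu_add_le _ _) (nu_comp_le _ _)))
    finiteness
  rw [fredholmDet_eq_minorSum h, fredholmDet_eq_minorSum hR, fredholmDet_eq_minorSum hS, e,
    ← minorSum_mul hR hS, mat_add, mat_add, mat_comp]

lemma _root_.fredholmDet_one : fredholmDet (1 : EllTwo ι →L[ℂ] EllTwo ι) = 1 := by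
  classical
  rw [fredholmDet_eq_minorSum (by simp [nu_zero]), minorSum_eq_det ∅]
  · simp
  · simp [mat]

/-- A left factor whose inverse differs from the identity by an operator with summable matrix. -/
lemma nu_inverse_comp_ne_top {J : EllTwo ι →L[ℂ] EllTwo ι} (hJ : nu J ≠ ∞)
    {T : EllTwo κ →L[ℂ] EllTwo ι} (hT : nu T ≠ ∞) :
    nu (Ring.inverse (1 + J) ∘L T) ≠ ∞ := by
  by_cases h : IsUnit (1 + J)
  · set K := Ring.inverse (1 + J)
    have h1 : K * (1 + J) = 1 := Ring.inverse_mul_cancel _ h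
    have h2 : (1 + J) * K = 1 := Ring.mul_inverse_cancel _ h
    -- From `K = 1 - J + J K J`, the inverse, which is only known to be bounded, appears only
    -- between two copies of the summable `J`.
    have e : K ∘L T = T - J ∘L T + J ∘L K ∘L J ∘L T := by
      have : K = 1 - J + J * K * J := by
        have h3 : J * K = 1 - K := by rw [← h2]; noncomm_ring
        have h4 : K * J = 1 - K := by rw [← h1]; noncomm_ring
        rw [h3, sub_mul, h4]; noncomm_ring
      conv_lhs => rw [this]
      rfl
    rw [e]
    refine ne_top_of_le_ne_top ?_ ((nu_add_le _ _).trans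
      (add_le_add (nu_sub_le _ _) (nu_comp_comp_le _ _ _)))
    have h5 : nu (J ∘L T) ≠ ∞ := ne_top_of_le_ne_top (ENNReal.mul_ne_top hJ hT) (nu_comp_le _ _)
    finiteness
  -- At a singular argument `Ring.inverse` is `0`, so no invertibility is required.
  · rw [Ring.inverse_non_unit _ h]
    simp [nu_zero]

end EllTwo

/-! ### The operators of a weighted graph -/

namespace WeightedGraph

open EllTwo InfMatrix

variable {V : Type*} (X : WeightedGraph V)

lemma _root_.EllTwo.comp_unit {ι κ η : Type*} {S : EllTwo ι →L[ℂ] EllTwo η} {i : ι} {k : η} {c : ℂ}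
    (h : S (basisVec i) = c • basisVec k) (j : κ) : S ∘L unit i j = c • unit k j := by
  classical
  refine ext_basisVec fun l => ?_
  rw [ContinuousLinearMap.comp_apply, unit_basisVec, smul_apply, unit_basisVec]
  split_ifs <;> simp [h]

lemma tau_comp_unit {κ : Type*} (e : X.graph.Dart) (j : κ) :
    X.tau ∘L unit e j = unit e.snd j := by
  simpa using comp_unit (S := X.tau) (c := 1) (by rw [tau_basisVec, one_smul]) j

lemma J_comp_unit {κ : Type*} (e : X.graph.Dart) (j : κ) :
    X.J ∘L unit e j = (X.w e.symm : ℂ) • unit e.symm j :=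
  comp_unit (X.J_basisVec e) j

lemma enorm_w (e : X.graph.Dart) : ‖(X.w e : ℂ)‖ₑ = ENNReal.ofReal (X.w e) := by
  rw [← ofReal_norm, Complex.norm_real, Real.norm_of_nonneg (X.w_pos e).le]

lemma tsum_enorm_w_ne_top : ∑' e, ‖(X.w e : ℂ)‖ₑ ≠ ∞ := by
  simp_rw [enorm_w]
  exact X.finite_weight.tsum_ofReal_ne_top

lemma _root_.EllTwo.summable_smul_unit {α ι κ : Type*} {c : α → ℝ} (hc : Summable c)
    (h0 : ∀ a, 0 ≤ c a) (f : α → ι) (g : α → κ) :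
    Summable fun a => (c a : ℂ) • (unit (f a) (g a) : EllTwo κ →L[ℂ] EllTwo ι) := by
  refine Summable.of_norm (hc.congr fun a => ?_)
  rw [norm_smul, norm_unit, mul_one, Complex.norm_real, Real.norm_of_nonneg (h0 a)]

lemma hasSum_sigma : HasSum (fun e : X.graph.Dart => (X.w e : ℂ) • unit e e.fst) X.sigma :=
  (summable_smul_unit X.finite_weight (fun e => (X.w_pos e).le) _ _).hasSum

lemma hasSum_J : HasSum (fun e : X.graph.Dart => (X.w e.symm : ℂ) • unit e.symm e) X.J :=
  (summable_smul_unit X.summable_w_symm (fun _ => (X.w_pos _).le) _ _).hasSum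

lemma nu_sigma : nu X.sigma ≠ ∞ :=
  ne_top_of_le_ne_top X.tsum_enorm_w_ne_top (nu_le_of_hasSum X.hasSum_sigma)

lemma nu_J : nu X.J ≠ ∞ := by
  refine ne_top_of_le_ne_top ?_ (nu_le_of_hasSum X.hasSum_J)
  simp_rw [enorm_w]
  exact X.summable_w_symm.tsum_ofReal_ne_top

/-- `τ` sends matrix units to matrix units, so it only adds up entries and no valency constant
appears on this side. -/
lemma nu_tau_comp_le {κ : Type*} (T : EllTwo κ →L[ℂ] EllTwo X.graph.Dart) :
    nu (X.tau ∘L T) ≤ nu T := by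
  by_cases h : nu T = ∞
  · simp [h]
  have := (hasSum_unit h).mapL (ContinuousLinearMap.compL ℂ (EllTwo κ) _ _ X.tau)
  rw [← tsum_enorm_mat T]
  refine nu_le_of_hasSum (f := fun p : X.graph.Dart × κ => p.1.snd) (g := fun p => p.2) ?_
  convert this using 2 with p
  · rw [map_smul, ContinuousLinearMap.compL_apply, tau_comp_unit]
  · rfl

lemma mat_comp_tau {ι : Type*} (S : EllTwo V →L[ℂ] EllTwo ι) (i : ι) (e : X.graph.Dart) :
    mat (S ∘L X.tau) i e = mat S i e.snd := by
  rw [mat_eq_inner, ContinuousLinearMap.comp_apply, tau_basisVec]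
  rfl

open Classical in
lemma mat_tau (x : V) (e : X.graph.Dart) : mat X.tau x e = if x = e.snd then 1 else 0 := by
  rw [mat_eq_apply, tau_basisVec, basisVec_apply]

/-- Bounded valency: every vertex is the terminal vertex of at most `M` oriented edges. -/
lemma exists_tsum_comp_snd_le : ∃ M : ℕ, ∀ f : V → ℝ≥0∞,
    ∑' e : X.graph.Dart, f e.snd ≤ M * ∑' x, f x := by
  obtain ⟨M, hM⟩ := X.exists_fiber_bound
  refine ⟨M, fun f => ?_⟩
  rw [← (Equiv.sigmaFiberEquiv (fun e : X.graph.Dart => e.snd)).tsum_eq, ENNReal.tsum_sigma',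
    ← ENNReal.tsum_mul_left]
  refine ENNReal.tsum_le_tsum fun x => ?_
  have := (hM x).1
  have : ∀ e : {e : X.graph.Dart // e.snd = x},
      f ((Equiv.sigmaFiberEquiv (fun e : X.graph.Dart => e.snd)) ⟨x, e⟩).snd = f x := by
    rintro ⟨e, rfl⟩; rfl
  simp_rw [this, ENNReal.tsum_const]
  gcongr
  rw [ENat.card_eq_coe_natCard]
  exact_mod_cast (hM x).2

/-- Column `e` of `S τ` is column `t(e)` of `S`, so each column is repeated at most `M` times. -/
lemma nu_comp_tau {ι : Type*} {S : EllTwo V →L[ℂ] EllTwo ι} (h : nu S ≠ ∞) :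
    nu (S ∘L X.tau) ≠ ∞ := by
  obtain ⟨M, hM⟩ := X.exists_tsum_comp_snd_le
  refine ne_top_of_le_ne_top (ENNReal.mul_ne_top (ENNReal.natCast_ne_top M) h) ?_
  unfold nu absSum
  rw [← ENNReal.tsum_mul_left]
  refine ENNReal.tsum_le_tsum fun i => ?_
  simp_rw [mat_comp_tau]
  exact hM fun x => ‖mat S i x‖ₑ

/-- Moves a determinant from edges to vertices. The matrix of `τ` has row sums at most `M` and
column sums equal to `1`, which is exactly what `minorSum_mul_comm` tolerates. -/
lemma fredholmDet_one_add_comp_tau {S : EllTwo V →L[ℂ] EllTwo X.graph.Dart} (h : nu S ≠ ∞) :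
    fredholmDet (1 + S ∘L X.tau) = fredholmDet (1 + X.tau ∘L S) := by
  classical
  have e1 : (1 + S ∘L X.tau) - 1 = S ∘L X.tau := add_sub_cancel_left _ _
  have e2 : (1 + X.tau ∘L S) - 1 = X.tau ∘L S := add_sub_cancel_left _ _
  rw [fredholmDet_eq_minorSum (by rw [e1]; exact X.nu_comp_tau h),
    fredholmDet_eq_minorSum (by rw [e2]; exact ne_top_of_le_ne_top h (X.nu_tau_comp_le S)), e1, e2,
    mat_comp, mat_comp]
  refine minorSum_mul_comm ?_ ?_
  · obtain ⟨M, hM⟩ := X.exists_tsum_comp_snd_le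
    have hτ : ∀ x, ∑' e, ‖mat X.tau x e‖ₑ ≤ M := fun x => by
      refine le_trans (le_of_eq ?_) ((hM fun y => if x = y then 1 else 0).trans (by simp))
      refine tsum_congr fun e => ?_
      rw [mat_tau]
      split_ifs <;> simp
    refine ne_top_of_le_ne_top (ENNReal.mul_ne_top h (ENNReal.natCast_ne_top M)) ?_
    unfold nu absSum
    simp_rw [← ENNReal.tsum_mul_right]
    gcongr
    exact hτ _
  · refine ne_top_of_le_ne_top h ?_
    rw [ENNReal.tsum_comm]
    refine ENNReal.tsum_le_tsum fun e => ?_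
    rw [ENNReal.tsum_mul_right]
    refine mul_le_of_le_one_left' (le_of_eq ?_)
    rw [tsum_eq_single e.snd] <;> simp +contextual [mat_tau]

/-- The edge operator `σ τ - J`, which sends an oriented edge to the weighted sum of the oriented
edges that continue it without backtracking. -/
def edgeOp : EllTwo X.graph.Dart →L[ℂ] EllTwo X.graph.Dart := X.sigma ∘L X.tau - X.J

lemma nu_edgeOp : nu X.edgeOp ≠ ∞ := by
  refine ne_top_of_le_ne_top ?_ (nu_sub_le _ _)
  exact ENNReal.add_ne_top.mpr ⟨X.nu_comp_tau X.nu_sigma, X.nu_J⟩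

open Classical in
lemma mat_sigma (e : X.graph.Dart) (x : V) :
    mat X.sigma e x = if e.fst = x then (X.w e : ℂ) else 0 := by
  have := (X.hasSum_sigma.mapL (matCLM e x)).tsum_eq
  rw [mat, ← this, tsum_eq_single e]
  · rw [map_smul]
    change _ • mat (unit e e.fst) e x = _
    rw [mat_unit]
    split_ifs <;> simp_all
  · intro d hd
    rw [map_smul]
    change _ • mat (unit d d.fst) e x = _
    rw [mat_unit, if_neg (by simp [hd]), smul_zero]

open Classical in
lemma mat_J (f e : X.graph.Dart) :
    mat X.J f e = if f = e.symm then (X.w f : ℂ) else 0 := by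
  rw [mat_eq_apply, J_basisVec]
  change (X.w e.symm : ℂ) * basisVec e.symm f = _
  rw [basisVec_apply]
  split_ifs with h <;> simp [h]

open Classical in
lemma mat_edgeOp (f e : X.graph.Dart) :
    mat X.edgeOp f e = if e.snd = f.fst ∧ f ≠ e.symm then (X.w f : ℂ) else 0 := by
  rw [edgeOp, mat_sub, Pi.sub_apply, Pi.sub_apply, mat_comp_tau, mat_sigma, mat_J]
  by_cases h : f = e.symm
  · simp [h]
  · simp [h, eq_comm]

lemma nu_sunadaOp_sub_one (u : ℂ) : nu (X.sunadaOp u - 1) ≠ ∞ := by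
  have : X.sunadaOp u - 1 = -(u • (X.tau ∘L Ring.inverse (1 + u • X.J) ∘L X.sigma)) := by
    rw [sunadaOp]; abel
  rw [this, nu_neg, nu_smul]
  refine ENNReal.mul_ne_top (by simp) (ne_top_of_le_ne_top ?_ (X.nu_tau_comp_le _))
  refine nu_inverse_comp_ne_top ?_ X.nu_sigma
  rw [nu_smul]
  exact ENNReal.mul_ne_top (by simp) X.nu_J

/-- Factor `1 - u T = (1 + u J) (1 + S τ)` with `S = -u (1 + u J)⁻¹ σ`, use multiplicativity, and
exchange `S τ` for `τ S`. -/
lemma fredholmDet_one_sub_edgeOp {u : ℂ} (h : IsUnit (1 + u • X.J)) :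
    fredholmDet (1 - u • X.edgeOp) = fredholmDet (1 + u • X.J) * fredholmDet (X.sunadaOp u) := by
  set K := Ring.inverse (1 + u • X.J)
  have hK : (1 + u • X.J) * K = 1 := Ring.mul_inverse_cancel _ h
  have hJ : nu (u • X.J) ≠ ∞ := by
    rw [nu_smul]; exact ENNReal.mul_ne_top (by simp) X.nu_J
  set S := -(u • (K ∘L X.sigma))
  have hS : nu S ≠ ∞ := by
    rw [nu_neg, nu_smul]
    exact ENNReal.mul_ne_top (by simp) (nu_inverse_comp_ne_top hJ X.nu_sigma)
  have e1 : 1 - u • X.edgeOp = (1 + u • X.J) * (1 + S ∘L X.tau) := by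
    have : S ∘L X.tau = -(u • (K * (X.sigma ∘L X.tau))) := rfl
    rw [this, mul_add, mul_one, mul_neg, mul_smul_comm, ← mul_assoc, hK, one_mul, edgeOp, smul_sub]
    abel
  have e2 : X.sunadaOp u = 1 + X.tau ∘L S := by
    simp only [S, sunadaOp, ContinuousLinearMap.comp_neg, ContinuousLinearMap.comp_smul]
    rw [sub_eq_add_neg]
  rw [e1, e2, fredholmDet_mul, fredholmDet_one_add_comp_tau _ hS]
  · rwa [add_sub_cancel_left]
  · rw [add_sub_cancel_left]; exact X.nu_comp_tau hS

end WeightedGraph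

/-! ### Entire functions with quadratic factors -/

section QuadraticProduct

variable {α : Type*} {ω : α → ℝ}

lemma hasProdLocallyUniformlyOn_quadratic (h0 : ∀ a, 0 ≤ ω a) (hω : Summable ω) :
    HasProdLocallyUniformlyOn (fun (a : α) (u : ℂ) => 1 - u ^ 2 * (ω a : ℂ))
      (fun u => ∏' a, (1 - u ^ 2 * (ω a : ℂ))) Set.univ := by
  refine hasProdLocallyUniformlyOn_of_forall_compact isOpen_univ fun K _ hK => ?_
  obtain ⟨C, hC⟩ := hK.isBounded.exists_norm_le
  simp_rw [sub_eq_add_neg]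
  refine (hω.mul_left (C ^ 2)).hasProdUniformlyOn_one_add hK (Eventually.of_forall fun a u hu => ?_)
    fun a => by fun_prop
  rw [norm_neg, norm_mul, norm_pow, Complex.norm_real, Real.norm_of_nonneg (h0 a)]
  gcongr
  · exact h0 a
  · exact hC u hu

lemma differentiable_quadraticProduct (h0 : ∀ a, 0 ≤ ω a) (hω : Summable ω) :
    Differentiable ℂ fun u : ℂ => ∏' a, (1 - u ^ 2 * (ω a : ℂ)) := by
  rw [← differentiableOn_univ]
  refine (hasProdLocallyUniformlyOn_quadratic h0 hω).differentiableOn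
    (.of_forall fun _ => ?_) isOpen_univ
  simpa [Finset.prod_fn] using DifferentiableOn.finsetProd (fun _ _ => by fun_prop)

lemma summable_norm_quadratic (h0 : ∀ a, 0 ≤ ω a) (hω : Summable ω) (u : ℂ) :
    Summable fun a => ‖-(u ^ 2 * (ω a : ℂ))‖ := by
  refine (hω.mul_left (‖u‖ ^ 2)).congr fun a => ?_
  rw [norm_neg, norm_mul, norm_pow, Complex.norm_real, Real.norm_of_nonneg (h0 a)]

lemma multipliable_quadratic (h0 : ∀ a, 0 ≤ ω a) (hω : Summable ω) (u : ℂ) :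
    Multipliable fun a => 1 - u ^ 2 * (ω a : ℂ) := by
  simpa [sub_eq_add_neg] using multipliable_one_add_of_summable (summable_norm_quadratic h0 hω u)

lemma quadraticProduct_ne_zero (h0 : ∀ a, 0 ≤ ω a) (hω : Summable ω) {u : ℂ}
    (hu : ∀ a, 1 - u ^ 2 * (ω a : ℂ) ≠ 0) : ∏' a, (1 - u ^ 2 * (ω a : ℂ)) ≠ 0 := by
  simpa [sub_eq_add_neg] using tprod_one_add_ne_zero_of_summable
    (f := fun a => -(u ^ 2 * (ω a : ℂ))) (fun a => by simpa [sub_eq_add_neg] using hu a)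
    (summable_norm_quadratic h0 hω u)

lemma finite_quadratic_zeros (h0 : ∀ a, 0 ≤ ω a) (hω : Summable ω) (u : ℂ) :
    {a | 1 - u ^ 2 * (ω a : ℂ) = 0}.Finite := by
  have h := (summable_norm_quadratic h0 hω u).tendsto_cofinite_zero
  have h1 := h.eventually_lt_const (show (0 : ℝ) < 1 by norm_num)
  refine Set.Finite.subset h1 fun a ha hlt => ?_
  have : u ^ 2 * (ω a : ℂ) = 1 := (sub_eq_zero.mp ha).symm
  have hlt' : ‖-(u ^ 2 * (ω a : ℂ))‖ < 1 := hlt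
  rw [this, norm_neg, norm_one] at hlt'
  exact lt_irrefl _ hlt'

lemma analyticOrderAt_quadratic {ω z : ℂ} (hz : 1 - z ^ 2 * ω = 0) :
    analyticOrderAt (fun u : ℂ => 1 - u ^ 2 * ω) z = 1 := by
  refine AnalyticAt.analyticOrderAt_eq_one_of_zero_deriv_ne_zero (by fun_prop) hz ?_
  have : HasDerivAt (fun u : ℂ => 1 - u ^ 2 * ω) (-(2 * z * ω)) z := by
    simpa using (((hasDerivAt_id z).pow 2).mul_const ω).const_sub 1
  rw [this.deriv]
  rintro h
  have h1 : z * ω = 0 := by linear_combination (-1 / 2 : ℂ) * h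
  have : (1 : ℂ) = 0 := by linear_combination hz + z * h1
  exact one_ne_zero this

/-- Only finitely many factors vanish at `z` because `ω` tends to zero, and each of them vanishes
simply. The product of the others is entire and non-zero at `z`. -/
lemma analyticOrderAt_quadraticProduct (h0 : ∀ a, 0 ≤ ω a) (hω : Summable ω) (z : ℂ) :
    analyticOrderAt (fun u : ℂ => ∏' a, (1 - u ^ 2 * (ω a : ℂ))) z =
      {a | 1 - z ^ 2 * (ω a : ℂ) = 0}.encard := by
  classical
  have hfin := finite_quadratic_zeros h0 hω z
  set s : Finset α := hfin.toFinset
  have hs : ∀ a, a ∈ s ↔ 1 - z ^ 2 * (ω a : ℂ) = 0 := fun a => by simp [s]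
  let ω' : {a // a ∉ s} → ℝ := fun a => ω a
  have hω' : Summable ω' := hω.subtype _
  have h0' : ∀ a, 0 ≤ ω' a := fun a => h0 a
  have hsplit : (fun u : ℂ => ∏' a, (1 - u ^ 2 * (ω a : ℂ))) =
      (fun u => ∏ a ∈ s, (1 - u ^ 2 * (ω a : ℂ))) * fun u => ∏' a, (1 - u ^ 2 * (ω' a : ℂ)) := by
    funext u
    have h1 : HasProd (fun a : s => 1 - u ^ 2 * (ω a : ℂ)) (∏ a ∈ s, (1 - u ^ 2 * (ω a : ℂ))) :=
      s.hasProd fun a => 1 - u ^ 2 * (ω a : ℂ)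
    exact (HasProd.mul_compl (s := (s : Set α)) (f := fun a => 1 - u ^ 2 * (ω a : ℂ)) h1
      (multipliable_quadratic h0' hω' u).hasProd).tprod_eq
  have hprod : ∀ t : Finset α, t ⊆ s →
      analyticOrderAt (fun u : ℂ => ∏ a ∈ t, (1 - u ^ 2 * (ω a : ℂ))) z = t.card := by
    intro t
    induction t using Finset.induction_on with
    | empty =>
      intro _
      simp only [Finset.prod_empty, Finset.card_empty, Nat.cast_zero]
      exact analyticOrderAt_eq_zero.mpr (Or.inr one_ne_zero)
    | insert a t ha ih =>
      intro hsub
      have e : (fun u : ℂ => ∏ b ∈ insert a t, (1 - u ^ 2 * (ω b : ℂ))) =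
          (fun u : ℂ => 1 - u ^ 2 * (ω a : ℂ)) * fun u => ∏ b ∈ t, (1 - u ^ 2 * (ω b : ℂ)) := by
        funext u
        simp [Finset.prod_insert ha]
      rw [e, analyticOrderAt_mul (by fun_prop) (by fun_prop),
        ih fun b hb => hsub (Finset.mem_insert_of_mem hb), Finset.card_insert_of_notMem ha,
        analyticOrderAt_quadratic ((hs a).mp (hsub (Finset.mem_insert_self a t)))]
      push_cast
      ring
  have hd : AnalyticAt ℂ (fun u : ℂ => ∏' a, (1 - u ^ 2 * (ω' a : ℂ))) z :=
    (differentiable_quadraticProduct h0' hω').analyticAt z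
  rw [hsplit, analyticOrderAt_mul (by fun_prop) hd, hprod s subset_rfl,
    hd.analyticOrderAt_eq_zero.mpr, add_zero]
  · rw [hfin.encard_eq_coe_toFinset_card]
  · exact quadraticProduct_ne_zero h0' hω' fun a ha => a.2 ((hs _).mpr ha)

lemma one_sub_sq_mul_eq_zero_iff {c : ℝ} (hc : 0 < c) (z : ℂ) : 1 - z ^ 2 * (c : ℂ) = 0 ↔
    z = ((1 / Real.sqrt c : ℝ) : ℂ) ∨ z = -((1 / Real.sqrt c : ℝ) : ℂ) := by
  have h1 : (Real.sqrt c : ℂ) ^ 2 = c := by exact_mod_cast Real.sq_sqrt hc.le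
  have h2 : (Real.sqrt c : ℂ) ≠ 0 := by exact_mod_cast (Real.sqrt_pos.mpr hc).ne'
  rw [← sq_eq_sq_iff_eq_or_eq_neg, ← h1]
  push_cast
  rw [div_pow, one_pow, eq_div_iff (pow_ne_zero 2 h2), sub_eq_zero, eq_comm]

end QuadraticProduct

/-! ### The weighted flip and the product over the edges -/

namespace WeightedGraph

open EllTwo InfMatrix

variable {V : Type*} (X : WeightedGraph V)

lemma exists_dart_edge (e : X.graph.edgeSet) : ∃ d : X.graph.Dart, d.edge = e := by
  obtain ⟨e, he⟩ := e
  induction e with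
  | h x y => exact ⟨⟨(x, y), he⟩, rfl⟩

/-- A dart over an edge. -/
def orient (e : X.graph.edgeSet) : X.graph.Dart := (X.exists_dart_edge e).choose

lemma orient_edge (e : X.graph.edgeSet) : (X.orient e).edge = e :=
  (X.exists_dart_edge e).choose_spec

/-- The edge underlying a dart. -/
def toEdge (d : X.graph.Dart) : X.graph.edgeSet := ⟨d.edge, d.edge_mem⟩

/-- The darts as pairs of an edge and one of two orientations. -/
def dartEquiv : Fin 2 × X.graph.edgeSet ≃ X.graph.Dart :=
  Equiv.ofBijective (fun p => if p.1 = 0 then X.orient p.2 else (X.orient p.2).symm) <| by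
    have hE : ∀ p : Fin 2 × X.graph.edgeSet,
        (if p.1 = 0 then X.orient p.2 else (X.orient p.2).symm).edge = p.2 := fun p => by
      split_ifs <;> simp [orient_edge]
    constructor
    · rintro ⟨i, e⟩ ⟨j, e'⟩ h
      have he : e = e' := by
        have h1 := hE (i, e)
        have h2 := hE (j, e')
        simp only at h h1 h2
        rw [h, h2] at h1
        exact Subtype.ext h1.symm
      subst he
      have := (X.orient e).symm_ne
      fin_cases i <;> fin_cases j <;> simp_all [eq_comm]
    · intro d
      rcases (SimpleGraph.dart_edge_eq_iff d (X.orient (X.toEdge d))).mp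
        (X.orient_edge (X.toEdge d)).symm with h | h
      · exact ⟨(0, X.toEdge d), by simp [← h]⟩
      · exact ⟨(1, X.toEdge d), by simp [← h]⟩

lemma dartEquiv_zero (e : X.graph.edgeSet) : X.dartEquiv (0, e) = X.orient e := rfl

lemma dartEquiv_one (e : X.graph.edgeSet) : X.dartEquiv (1, e) = (X.orient e).symm := rfl

lemma dartEquiv_edge (p : Fin 2 × X.graph.edgeSet) : (X.dartEquiv p).edge = p.2 := by
  match p with
  | (0, e) => exact X.orient_edge e
  | (1, e) => exact (SimpleGraph.Dart.edge_symm _).trans (X.orient_edge e)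

lemma W_eq (e : X.graph.edgeSet) : X.W e = X.w (X.orient e) * X.w (X.orient e).symm := by
  rw [← X.orient_edge e, W_edge]

lemma W_pos (e : X.graph.edgeSet) : 0 < X.W e := by
  rw [← X.orient_edge]; exact X.W_edge_pos _

lemma summable_W_edge : Summable fun e : X.graph.Dart => X.W e.edge := by
  have hb : ∀ e, X.w e ≤ ∑' d, X.w d := fun e =>
    X.finite_weight.le_tsum e fun d _ => (X.w_pos d).le
  refine (X.finite_weight.mul_right (∑' d, X.w d)).of_nonneg_of_le
    (fun e => (X.W_edge_pos e).le) fun e => ?_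
  rw [W_edge]
  exact mul_le_mul_of_nonneg_left (hb _) (X.w_pos e).le

lemma summable_W : Summable fun e : X.graph.edgeSet => X.W e := by
  have hinj : Function.Injective X.orient := fun e e' h => by
    have h1 := X.orient_edge e
    rw [h, X.orient_edge] at h1
    exact Subtype.ext h1.symm
  refine (X.summable_W_edge.comp_injective hinj).congr fun e => ?_
  simp only [Function.comp, orient_edge]

open Classical in
-- Once oriented edges are listed as pairs (orientation, edge), `1 + u J` is block diagonal, and the
-- block of `e` has determinant `1 - u² w(e₁) w(e₂)`.
lemma det_flip_block (u : ℂ) (F : Finset X.graph.edgeSet) :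
    minorSum (trunc (Finset.univ ×ˢ F) (Finset.univ ×ˢ F) fun p q : Fin 2 × X.graph.edgeSet =>
      mat (u • X.J) (X.dartEquiv p) (X.dartEquiv q)) = ∏ e ∈ F, (1 - u ^ 2 * (X.W e : ℂ)) := by
  rw [minorSum_trunc]
  let M : F → Matrix (Fin 2) (Fin 2) ℂ := fun e =>
    !![1, u * X.w (X.orient e); u * X.w (X.orient e).symm, 1]
  let φ : Fin 2 × F ≃ (Finset.univ ×ˢ F : Finset (Fin 2 × X.graph.edgeSet)) :=
    { toFun := fun p => ⟨(p.1, p.2.1), by simp⟩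
      invFun := fun p => (p.1.1, ⟨p.1.2, (Finset.mem_product.mp p.2).2⟩)
      left_inv := fun p => rfl
      right_inv := fun p => rfl }
  have h : (1 + Matrix.of fun p q : (Finset.univ ×ˢ F : Finset (Fin 2 × X.graph.edgeSet)) =>
      mat (u • X.J) (X.dartEquiv p) (X.dartEquiv q)).submatrix φ φ = Matrix.blockDiagonal M := by
    refine Matrix.ext fun ⟨i, e⟩ ⟨j, e'⟩ => ?_
    change (1 : Matrix _ _ ℂ) (φ (i, e)) (φ (j, e')) + mat (u • X.J) (X.dartEquiv (i, e))
      (X.dartEquiv (j, e')) = _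
    rw [Matrix.one_apply, mat_smul, Pi.smul_apply, Pi.smul_apply, mat_J, Matrix.blockDiagonal_apply]
    simp only [φ.injective.eq_iff, Prod.mk.injEq]
    by_cases he : e = e'
    · subst he
      have h1 := (X.orient e).symm_ne
      fin_cases i <;> fin_cases j <;>
        simp [M, dartEquiv_zero, dartEquiv_one, h1, h1.symm]
    · have h2 : X.dartEquiv (i, ↑e) ≠ (X.dartEquiv (j, ↑e')).symm := fun h => he <| by
        have := congrArg SimpleGraph.Dart.edge h
        rw [SimpleGraph.Dart.edge_symm, dartEquiv_edge, dartEquiv_edge] at this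
        exact Subtype.ext (Subtype.ext this)
      simp [he, h2]
  rw [← Matrix.det_submatrix_equiv_self φ, h, Matrix.det_blockDiagonal,
    ← Finset.prod_coe_sort F fun e : X.graph.edgeSet => 1 - u ^ 2 * (X.W e : ℂ)]
  refine Finset.prod_congr rfl fun e _ => ?_
  simp only [M, Matrix.det_fin_two_of, X.W_eq]
  push_cast
  ring

lemma fredholmDet_one_add_J (u : ℂ) : fredholmDet (1 + u • X.J) = X.edgeProduct u := by
  classical
  have hJ : nu (u • X.J) ≠ ∞ := by
    rw [nu_smul]; exact ENNReal.mul_ne_top (by simp) X.nu_J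
  rw [fredholmDet_eq_minorSum (by rwa [add_sub_cancel_left]), add_sub_cancel_left,
    ← minorSum_reindex X.dartEquiv]
  have hM : absSum (fun p q => mat (u • X.J) (X.dartEquiv p) (X.dartEquiv q)) ≠ ∞ := by
    unfold absSum
    rw [X.dartEquiv.tsum_eq fun p => ∑' q, ‖mat (u • X.J) p (X.dartEquiv q)‖ₑ]
    simp_rw [fun p => X.dartEquiv.tsum_eq fun q => ‖mat (u • X.J) p q‖ₑ]
    exact hJ
  -- The finite sets consisting of both orientations of finitely many edges are cofinal, so
  -- truncation along them already computes the full determinant.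
  have hT : Tendsto (fun F : Finset X.graph.edgeSet => (Finset.univ : Finset (Fin 2)) ×ˢ F)
      atTop atTop := by
    refine tendsto_atTop.mpr fun s => ?_
    filter_upwards [eventually_ge_atTop (s.image Prod.snd)] with F hF p hp
    simp only [Finset.mem_product, Finset.mem_univ, true_and]
    exact hF (Finset.mem_image_of_mem _ hp)
  refine tendsto_nhds_unique ((tendsto_minorSum_trunc hM).comp hT) ?_
  refine (multipliable_quadratic (fun e => (X.W_pos e).le) X.summable_W u).hasProd.congr fun F => ?_
  exact (X.det_flip_block u F).symm

/-! #### Invertibility of `1 + u J` -/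

lemma _root_.EllTwo.tsum_smul_unit_basisVec {ι : Type*} {c : ι → ℂ} (hc : Summable c) (j : ι) :
    (∑' i, c i • (unit i i : EllTwo ι →L[ℂ] EllTwo ι)) (basisVec j) = c j • basisVec j := by
  classical
  have hs : Summable fun i => c i • (unit i i : EllTwo ι →L[ℂ] EllTwo ι) := by
    refine Summable.of_norm (hc.norm.congr fun i => ?_)
    rw [norm_smul, norm_unit, mul_one]
  have h := (hs.hasSum.mapL (ContinuousLinearMap.apply ℂ (EllTwo ι) (basisVec j))).tsum_eq
  refine h.symm.trans ?_
  rw [tsum_eq_single j]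
  · simp [unit_basisVec]
  · intro i hi
    simp [unit_basisVec, hi]

lemma J_J_basisVec (e : X.graph.Dart) :
    X.J (X.J (basisVec e)) = (X.W e.edge : ℂ) • basisVec e := by
  rw [J_basisVec, map_smul, J_basisVec, smul_smul, SimpleGraph.Dart.symm_symm, W_edge]
  congr 1
  push_cast
  ring

/-- `(1 + u J) (1 - u J) = 1 - u² J²` is diagonal with entries `1 - a e`, so it suffices to invert
this diagonal operator. -/
lemma isUnit_one_add_J {u : ℂ} (hu : ∀ e : X.graph.edgeSet, 1 - u ^ 2 * (X.W e : ℂ) ≠ 0) :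
    IsUnit (1 + u • X.J) := by
  let a : X.graph.Dart → ℂ := fun e => u ^ 2 * (X.W e.edge : ℂ)
  have ha : Summable a := (Complex.hasSum_ofReal.mpr X.summable_W_edge.hasSum).summable.mul_left _
  have h1 : ∀ e, 1 - a e ≠ 0 := fun e => hu (X.toEdge e)
  -- `(1 - a)⁻¹ = 1 + c`, and `c` is summable since `a` is summable and `|1 - a| ≥ 1/2` outside a
  -- finite set. The diagonal operator `D` is thus a norm convergent series.
  let c : X.graph.Dart → ℂ := fun e => a e / (1 - a e)
  have hc : Summable c := by
    have h0 := ha.norm.tendsto_cofinite_zero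
    refine Summable.of_norm_bounded_eventually (ha.norm.mul_left 2) ?_
    filter_upwards [h0.eventually_lt_const (show (0 : ℝ) < 1 / 2 by norm_num)] with e he
    have h2 : 1 / 2 ≤ ‖1 - a e‖ := by
      have := norm_sub_norm_le (1 : ℂ) (a e)
      rw [norm_one] at this
      linarith
    rw [norm_div, div_le_iff₀ (by linarith)]
    nlinarith [norm_nonneg (a e)]
  let D : EllTwo X.graph.Dart →L[ℂ] EllTwo X.graph.Dart := ∑' e, c e • unit e e
  have hD : ∀ e, D (basisVec e) = c e • basisVec e := tsum_smul_unit_basisVec hc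
  have hJ : ∀ e, (1 + u • X.J) ((1 - u • X.J) (basisVec e)) = (1 - a e) • basisVec e := fun e => by
    simp only [add_apply, sub_apply, smul_apply, one_apply_eq_self, map_sub, map_smul,
      X.J_J_basisVec]
    simp only [a]
    module
  have hJ' : ∀ e, (1 - u • X.J) ((1 + u • X.J) (basisVec e)) = (1 - a e) • basisVec e := fun e => by
    simp only [add_apply, sub_apply, smul_apply, one_apply_eq_self, map_add, map_smul,
      X.J_J_basisVec]
    simp only [a]
    module
  have hc1 : ∀ e, (1 + c e) * (1 - a e) = 1 := fun e => by
    have := h1 e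
    simp only [c]
    field_simp
    ring
  refine isUnit_iff_exists_and_exists.mpr ⟨⟨(1 - u • X.J) * (1 + D), ?_⟩,
    (1 + D) * (1 - u • X.J), ?_⟩
  · refine ext_basisVec fun e => ?_
    have : (1 + D) (basisVec e) = (1 + c e) • basisVec e := by
      simp only [add_apply, one_apply_eq_self, hD]; module
    simp only [mul_apply_eq_comp, this, map_smul, hJ, smul_smul, hc1, one_smul, one_apply_eq_self]
  · refine ext_basisVec fun e => ?_
    have : (1 + D) (basisVec e) = (1 + c e) • basisVec e := by
      simp only [add_apply, one_apply_eq_self, hD]; module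
    simp only [mul_apply_eq_comp, this, map_smul, hJ', smul_smul, mul_comm (1 - a e), hc1, one_smul,
      one_apply_eq_self]

end WeightedGraph

/-! ### The product over the edges -/

namespace WeightedGraph

variable {V : Type*} (X : WeightedGraph V)

lemma edgeProduct_eq_zero_iff (z : ℂ) : X.edgeProduct z = 0 ↔ ∃ e : X.graph.edgeSet,
    1 - z ^ 2 * (X.W e : ℂ) = 0 := by
  constructor
  · intro h
    by_contra! hne
    exact quadraticProduct_ne_zero (fun e => (X.W_pos e).le) X.summable_W hne h
  · rintro ⟨e, he⟩
    exact tprod_of_exists_eq_zero ⟨e, he⟩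

lemma differentiable_edgeProduct : Differentiable ℂ X.edgeProduct :=
  differentiable_quadraticProduct (fun e => (X.W_pos e).le) X.summable_W

lemma analyticOrderAt_edgeProduct (z : ℂ) : analyticOrderAt X.edgeProduct z =
    {e : X.graph.edgeSet | z = ((1 / Real.sqrt (X.W e) : ℝ) : ℂ) ∨
      z = -((1 / Real.sqrt (X.W e) : ℝ) : ℂ)}.encard := by
  simp_rw [← fun e : X.graph.edgeSet => one_sub_sq_mul_eq_zero_iff (X.W_pos e) z]
  exact analyticOrderAt_quadraticProduct (fun e => (X.W_pos e).le) X.summable_W z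

/-- The order of vanishing at `z` is the number of edges in a finite set, hence not infinite, so
zeros are isolated. -/
lemma eventually_edgeProduct_ne_zero (z : ℂ) : ∀ᶠ u in 𝓝[≠] z, X.edgeProduct u ≠ 0 := by
  have ha : AnalyticAt ℂ X.edgeProduct z := X.differentiable_edgeProduct.analyticAt z
  refine ha.eventually_eq_zero_or_eventually_ne_zero.resolve_left fun h => ?_
  have h1 := analyticOrderAt_eq_top.mpr h
  have h2 := analyticOrderAt_quadraticProduct (fun e => (X.W_pos e).le) X.summable_W z
  have h3 := finite_quadratic_zeros (fun e => (X.W_pos e).le) X.summable_W z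
  rw [← Set.encard_ne_top_iff, ← h2] at h3
  exact h3 h1

end WeightedGraph

namespace WeightedGraph

open EllTwo InfMatrix

variable {V : Type*} (X : WeightedGraph V)

/-! ### The operators `B_j` -/

lemma J_pow_even_comp_unit {κ : Type*} (n : ℕ) (e : X.graph.Dart) (j : κ) :
    (X.J ^ (2 * n)) ∘L unit e j = ((X.W e.edge ^ n : ℝ) : ℂ) • unit e j := by
  refine comp_unit ?_ j
  induction n with
  | zero => simp
  | succ n ih =>
    rw [mul_add, pow_add, mul_apply_eq_comp, mul_one, pow_two, mul_apply_eq_comp, X.J_J_basisVec,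
      map_smul, ih, smul_smul, pow_succ]
    push_cast
    ring_nf

lemma J_pow_odd_comp_unit {κ : Type*} (n : ℕ) (e : X.graph.Dart) (j : κ) :
    (X.J ^ (2 * n + 1)) ∘L unit e j =
      ((X.W e.edge ^ n * X.w e.symm : ℝ) : ℂ) • unit e.symm j := by
  rw [pow_succ', ContinuousLinearMap.mul_def, ContinuousLinearMap.comp_assoc, J_pow_even_comp_unit,
    ContinuousLinearMap.comp_smul, J_comp_unit, smul_smul]
  push_cast
  rfl

lemma hasSum_tau_comp_comp_sigma (S : EllTwo X.graph.Dart →L[ℂ] EllTwo X.graph.Dart) :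
    HasSum (fun e : X.graph.Dart => (X.w e : ℂ) • (X.tau ∘L S ∘L unit e e.fst))
      (X.tau ∘L S ∘L X.sigma) := by
  convert X.hasSum_sigma.mapL (ContinuousLinearMap.compL ℂ (EllTwo V) _ _ (X.tau ∘L S)) using 2
  · rw [map_smul]; rfl
  · rfl

/-- `J²` multiplies the basis vector of `e` by `W(e)`. Even powers of `J` therefore keep the edge
and end at the neighbour, while odd powers reverse it and return to the starting vertex, matching
the two cases of the definition of `B`. -/
lemma B_succ (n : ℕ) : X.B (n + 1) = X.tau ∘L (X.J ^ n) ∘L X.sigma := by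
  rw [← (X.hasSum_tau_comp_comp_sigma _).tsum_eq]
  obtain ⟨k, rfl | rfl⟩ := n.even_or_odd'
  · have h : (2 * k + 1) / 2 = k := by omega
    rw [B, if_neg (by omega), if_neg (by simp), h]
    refine tsum_congr fun e => ?_
    rw [J_pow_even_comp_unit, ContinuousLinearMap.comp_smul, tau_comp_unit, smul_smul]
    push_cast
    rw [mul_comm]
  · have h : (2 * k + 1 + 1) / 2 = k + 1 := by omega
    have h2 : Even (2 * k + 1 + 1) := ⟨k + 1, by omega⟩
    rw [B, if_neg (by omega), if_pos h2, h]
    refine tsum_congr fun e => ?_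
    rw [J_pow_odd_comp_unit, ContinuousLinearMap.comp_smul, tau_comp_unit, smul_smul, pow_succ,
      X.W_edge]
    push_cast
    congr 1
    ring

/-! ### Reduced paths as sequences of oriented edges -/

variable {X} in
/-- The oriented edge `f` continues the oriented edge `e` without backtracking. -/
def Continues (e f : X.graph.Dart) : Prop := e.snd = f.fst ∧ f ≠ e.symm

/-- Consecutive edges of a walk always meet, and `x_j = x_{j+2}` says precisely that the second edge
is the reverse of the first. -/
lemma isReduced_iff_isChain {x y : V} (p : X.graph.Walk x y) :
    X.IsReduced p ↔ p.darts.IsChain Continues := by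
  have hd := p.isChain_dartAdj_darts
  rw [List.isChain_iff_getElem] at hd ⊢
  have key : ∀ j (h : j + 1 < p.darts.length),
      p.getVert j = p.getVert (j + 2) ↔ p.darts[j + 1] = p.darts[j].symm := by
    intro j h
    rw [SimpleGraph.Walk.darts_getElem_eq_getVert _ h,
      SimpleGraph.Walk.darts_getElem_eq_getVert _ (by omega), SimpleGraph.Dart.ext_iff]
    simp [SimpleGraph.Dart.symm, eq_comm]
  constructor
  · intro h j hj
    refine ⟨hd j hj, fun h' => h j ?_ ((key j hj).mpr h')⟩
    simp at hj; omega
  · intro h j hj h'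
    have hj' : j + 1 < p.darts.length := by simp; omega
    exact (h j hj').2 ((key j hj').mp h')

/-- The list must be non-empty: a path of length zero has no edges from which to recover its base
point. -/
lemma sigma_walk_ext {p q : Σ x y : V, X.graph.Walk x y} (hp : p.2.2.darts ≠ [])
    (h : p.2.2.darts = q.2.2.darts) : p = q := by
  obtain ⟨x, y, p⟩ := p
  obtain ⟨x', y', q⟩ := q
  simp only at h hp
  have hx : x = x' := by
    cases p <;> cases q <;> simp_all
  subst hx
  have hs : p.support = q.support := by
    rw [← SimpleGraph.Walk.cons_map_snd_darts, ← SimpleGraph.Walk.cons_map_snd_darts, h]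
  have hy : y = y' := by
    have := congrArg List.getLast? hs
    simpa [List.getLast?_eq_getLast_of_ne_nil] using this
  subst hy
  rw [SimpleGraph.Walk.ext_support hs]

open Classical in
/-- The product of the transition weights along a sequence of oriented edges. -/
def chainWeight {n : ℕ} (a : Fin (n + 1) → X.graph.Dart) : ℝ :=
  X.w (a 0) * ∏ i : Fin n, if Continues (a i.castSucc) (a i.succ) then X.w (a i.succ) else 0

lemma chainWeight_nonneg {n : ℕ} (a : Fin (n + 1) → X.graph.Dart) : 0 ≤ X.chainWeight a :=
  mul_nonneg (X.w_pos _).le (Finset.prod_nonneg fun i _ => by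
    split_ifs <;> simp [(X.w_pos _).le])

lemma chainWeight_le {n : ℕ} (a : Fin (n + 1) → X.graph.Dart) :
    X.chainWeight a ≤ ∏ i, X.w (a i) := by
  rw [Fin.prod_univ_succ, chainWeight]
  refine mul_le_mul_of_nonneg_left (Finset.prod_le_prod (fun i _ => ?_) fun i _ => ?_)
    (X.w_pos _).le
  all_goals split_ifs <;> simp [(X.w_pos _).le]

lemma summable_chainWeight (n : ℕ) :
    Summable fun a : Fin (n + 1) → X.graph.Dart => X.chainWeight a :=
  (X.summable_prod_w (n + 1)).of_nonneg_of_le X.chainWeight_nonneg X.chainWeight_le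

open Classical in
lemma chainWeight_snoc {n : ℕ} (a : Fin (n + 1) → X.graph.Dart) (f : X.graph.Dart) :
    X.chainWeight (Fin.snoc (α := fun _ => X.graph.Dart) a f) =
      X.chainWeight a * if Continues (a (Fin.last n)) f then X.w f else 0 := by
  rw [chainWeight, chainWeight, Fin.prod_univ_castSucc, mul_assoc]
  congr 1
  simp only [Fin.succ_last, Fin.snoc_last, Fin.snoc_castSucc, ← Fin.castSucc_succ]

open Classical in
lemma mat_edgeOp_eq (f e : X.graph.Dart) :
    mat X.edgeOp f e = ((if Continues e f then X.w f else 0 : ℝ) : ℂ) := by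
  rw [mat_edgeOp]
  unfold Continues
  split_ifs <;> simp

lemma _root_.EllTwo.hasSum_comp_unit {ι κ : Type*} (S : EllTwo ι →L[ℂ] EllTwo ι)
    (i : ι) (j : κ) : HasSum (fun k => mat S k i • unit k j) (S ∘L unit i j) := by
  have h := (hasSum_smul_basisVec (S (basisVec i))).mapL
    ((InnerProductSpace.rankOne ℂ).flip (basisVec j))
  have e1 : ∀ k, mat S k i • unit k j = (InnerProductSpace.rankOne ℂ).flip (basisVec j)
      (S (basisVec i) k • basisVec k) := fun k => by
    rw [map_smul, mat_eq_apply]; rfl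
  have e2 : S ∘L unit i j = (InnerProductSpace.rankOne ℂ).flip (basisVec j) (S (basisVec i)) :=
    ext_basisVec fun l => by simp [unit]
  rw [funext e1, e2]
  exact h

/-- Expansion of the operator product over all sequences of `n + 1` oriented edges; those which do
not continue without backtracking get weight zero. The induction appends a last edge. -/
lemma hasSum_edgeOp_pow_comp_sigma (n : ℕ) :
    HasSum (fun a : Fin (n + 1) → X.graph.Dart =>
      (X.chainWeight a : ℂ) • unit (a (Fin.last n)) (a 0).fst) ((X.edgeOp ^ n) ∘L X.sigma) := by
  induction n with
  | zero =>
    rw [← (Equiv.funUnique (Fin 1) X.graph.Dart).symm.hasSum_iff]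
    convert X.hasSum_sigma using 2 with e
    · simp [chainWeight]
    · rfl
  | succ n ih =>
    -- Convergence for the longer sequences is known from the weights. Only the value has to be
    -- identified, by summing over the last edge with the initial segment fixed.
    have hs := (summable_smul_unit (X.summable_chainWeight (n + 1)) X.chainWeight_nonneg
      (fun a => a (Fin.last (n + 1))) (fun a => (a 0).fst)).hasSum
    have hs' := ((Equiv.prodComm _ _).trans
      (Fin.snocEquiv fun _ : Fin (n + 2) => X.graph.Dart)).hasSum_iff.mpr hs
    have h1 := hs'.prod_fiberwise (g := fun a : Fin (n + 1) → X.graph.Dart =>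
      (X.chainWeight a : ℂ) • (X.edgeOp ∘L unit (a (Fin.last n)) (a 0).fst)) fun a => by
        convert (hasSum_comp_unit X.edgeOp (a (Fin.last n)) (a 0).fst).const_smul
          (X.chainWeight a : ℂ) using 2 with f
        have e1 : ((Equiv.prodComm _ _).trans
            (Fin.snocEquiv fun _ : Fin (n + 2) => X.graph.Dart)) (a, f) =
            Fin.snoc (α := fun _ => X.graph.Dart) a f := rfl
        have e2 : Fin.snoc (α := fun _ => X.graph.Dart) a f 0 = a 0 := by
          rw [← Fin.castSucc_zero, Fin.snoc_castSucc]
        rw [Function.comp_apply, e1, chainWeight_snoc, Fin.snoc_last, e2, mat_edgeOp_eq, smul_smul]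
        push_cast
        rfl
    have h2 := ih.mapL (ContinuousLinearMap.compL ℂ (EllTwo V) _ _ X.edgeOp)
    have h3 : ((X.edgeOp ^ (n + 1)) ∘L X.sigma) =
        ContinuousLinearMap.compL ℂ (EllTwo V) _ _ X.edgeOp ((X.edgeOp ^ n) ∘L X.sigma) := by
      rw [pow_succ']; rfl
    rw [h3]
    refine (h2.unique ?_) ▸ hs
    convert h1 using 2
    rw [map_smul]; rfl

/-- The sequence of oriented edges of a reduced path. -/
def ReducedPath.toFun {n : ℕ} (p : X.ReducedPath (n + 1)) (i : Fin (n + 1)) : X.graph.Dart :=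
  p.1.2.2.darts.get (i.cast (by rw [SimpleGraph.Walk.length_darts, p.2.1]))

variable {X} in
lemma ReducedPath.ofFn_toFun {n : ℕ} (p : X.ReducedPath (n + 1)) :
    List.ofFn (p.toFun X) = p.1.2.2.darts := by
  refine List.ext_get (by simp [p.2.1]) fun i h1 h2 => ?_
  simp only [ReducedPath.toFun, List.get_eq_getElem, List.getElem_ofFn, Fin.val_cast]

lemma toFun_injective {n : ℕ} :
    Function.Injective (ReducedPath.toFun X : X.ReducedPath (n + 1) → _) := by
  intro p q h
  have h1 := p.ofFn_toFun
  rw [h, q.ofFn_toFun] at h1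
  refine Subtype.ext (X.sigma_walk_ext ?_ h1.symm)
  rw [← p.ofFn_toFun]
  simp

lemma chainWeight_eq_of_isChain {n : ℕ} {a : Fin (n + 1) → X.graph.Dart}
    (h : ∀ i : Fin n, Continues (a i.castSucc) (a i.succ)) :
    X.chainWeight a = ∏ i, X.w (a i) := by
  rw [Fin.prod_univ_succ, chainWeight]
  simp [h]

lemma isChain_ofFn {n : ℕ} {a : Fin (n + 1) → X.graph.Dart} :
    (List.ofFn a).IsChain Continues ↔ ∀ i : Fin n, Continues (a i.castSucc) (a i.succ) := by
  rw [List.isChain_iff_getElem]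
  constructor
  · intro h i
    have := h i (by simp)
    rwa [List.getElem_ofFn, List.getElem_ofFn] at this
  · intro h i hi
    rw [List.getElem_ofFn, List.getElem_ofFn]
    exact h ⟨i, by simpa using hi⟩

variable {X} in
lemma ReducedPath.continues {n : ℕ} (p : X.ReducedPath (n + 1)) (i : Fin n) :
    Continues (p.toFun X i.castSucc) (p.toFun X i.succ) := by
  refine (X.isChain_ofFn).mp ?_ i
  rw [p.ofFn_toFun]
  exact (X.isReduced_iff_isChain _).mp p.2.2

variable {X} in
lemma ReducedPath.chainWeight_toFun {n : ℕ} (p : X.ReducedPath (n + 1)) :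
    X.chainWeight (p.toFun X) = X.pathWeight p.1.2.2 := by
  rw [X.chainWeight_eq_of_isChain p.continues, pathWeight, ← p.ofFn_toFun, List.map_ofFn,
    List.prod_ofFn]
  rfl

variable {X} in
lemma ReducedPath.toFun_zero_fst {n : ℕ} (p : X.ReducedPath (n + 1)) :
    (p.toFun X 0).fst = p.1.1 := by
  obtain ⟨⟨x, y, p⟩, h, h'⟩ := p
  simp [ReducedPath.toFun]

variable {X} in
lemma ReducedPath.toFun_last_snd {n : ℕ} (p : X.ReducedPath (n + 1)) :
    (p.toFun X (Fin.last n)).snd = p.1.2.1 := by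
  obtain ⟨⟨x, y, p⟩, h, h'⟩ := p
  simp only at h
  simp [ReducedPath.toFun, ← h]

lemma exists_reducedPath {n : ℕ} {a : Fin (n + 1) → X.graph.Dart}
    (h : ∀ i : Fin n, Continues (a i.castSucc) (a i.succ)) :
    ∃ p : X.ReducedPath (n + 1), p.toFun X = a := by
  have hc := X.isChain_ofFn.mpr h
  have hne : List.ofFn a ≠ [] := by simp
  have hd : (List.ofFn a).IsChain X.graph.DartAdj := hc.imp fun e f h => h.1
  let p := SimpleGraph.Walk.ofDarts _ hne hd
  have hp : p.darts = List.ofFn a := SimpleGraph.Walk.darts_ofDarts hne hd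
  let P : X.ReducedPath (n + 1) :=
    ⟨⟨_, _, p⟩, by simp [p], by rw [isReduced_iff_isChain, hp]; exact hc⟩
  exact ⟨P, List.ofFn_injective (P.ofFn_toFun.trans hp)⟩

/-- Sequences of non-zero chain weight are exactly those of reduced paths, so the sum over all
sequences collapses to the defining sum of `A`. -/
lemma A_succ (n : ℕ) : X.A (n + 1) = X.tau ∘L (X.edgeOp ^ n) ∘L X.sigma := by
  have h := (X.hasSum_edgeOp_pow_comp_sigma n).mapL
    (ContinuousLinearMap.compL ℂ (EllTwo V) _ _ X.tau)
  rw [A, if_neg (by omega)]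
  refine Eq.trans ?_ h.tsum_eq
  rw [← X.toFun_injective.tsum_eq]
  · refine tsum_congr fun p => ?_
    rw [map_smul, ContinuousLinearMap.compL_apply, tau_comp_unit, p.chainWeight_toFun,
      p.toFun_zero_fst, p.toFun_last_snd]
  · intro a ha
    refine X.exists_reducedPath fun i => ?_
    by_contra hi
    refine ha ?_
    have : X.chainWeight a = 0 := by
      rw [chainWeight, Finset.prod_eq_zero (Finset.mem_univ i) (if_neg hi), mul_zero]
    simp [this]

end WeightedGraph

namespace WeightedGraph

open EllTwo InfMatrix

variable {V : Type*} (X : WeightedGraph V)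

/-! ### The operators `A(u)` and `B(-u)` for small `u` -/

lemma _root_.NormedRing.hasSum_pow_inverse_one_sub {R : Type*} [NormedRing R] [CompleteSpace R]
    {t : R} (h : ‖t‖ < 1) : HasSum (fun n : ℕ => t ^ n) (Ring.inverse (1 - t)) := by
  have h1 := summable_geometric_of_norm_lt_one h
  have : Ring.inverse (1 - t) = ∑' n : ℕ, t ^ n := by
    rw [NormedRing.inverse_one_sub t h]; rfl
  rw [this]
  exact h1.hasSum

lemma isUnit_one_sub_smul {S : EllTwo X.graph.Dart →L[ℂ] EllTwo X.graph.Dart} {u : ℂ}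
    (h : ‖u‖ * ‖S‖ < 1) : IsUnit (1 - u • S) := by
  refine (Units.oneSub (u • S) ?_).isUnit
  rwa [norm_smul]

/-- Used for `S = T` at `u`, giving `A(u)`, and for `S = J` at `-u`, giving `B(-u)`. The term of
index `n + 1` is `u τ (u S)ⁿ σ`, and the term of index `0` is the identity. -/
lemma hasSum_neumann {S : EllTwo X.graph.Dart →L[ℂ] EllTwo X.graph.Dart} {u : ℂ}
    (h : ‖u‖ * ‖S‖ < 1) {C : ℕ → EllTwo V →L[ℂ] EllTwo V} (h0 : C 0 = 1)
    (hC : ∀ n, C (n + 1) = X.tau ∘L (S ^ n) ∘L X.sigma) :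
    HasSum (fun j : ℕ => u ^ j • C j)
      (1 + u • (X.tau ∘L Ring.inverse (1 - u • S) ∘L X.sigma)) := by
  have h1 : HasSum (fun n : ℕ => (u • S) ^ n) (Ring.inverse (1 - u • S)) :=
    NormedRing.hasSum_pow_inverse_one_sub (by rwa [norm_smul])
  have h2 := ((h1.mapL ((ContinuousLinearMap.compL ℂ (EllTwo V) _ _).flip X.sigma)).mapL
    (ContinuousLinearMap.compL ℂ (EllTwo V) _ _ X.tau)).const_smul u
  have e1 : ∀ n, u • (ContinuousLinearMap.compL ℂ (EllTwo V) _ _ X.tau)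
      (((ContinuousLinearMap.compL ℂ (EllTwo V) _ _).flip X.sigma) ((u • S) ^ n)) =
      u ^ (n + 1) • C (n + 1) := fun n => by
    rw [smul_pow, map_smul, map_smul, hC, smul_smul, pow_succ']
    rfl
  simp_rw [e1] at h2
  have h3 := (hasSum_nat_add_iff (f := fun j => u ^ j • C j) 1).mp h2
  rw [add_comm]
  simpa [h0] using h3

lemma A_zero : X.A 0 = 1 := if_pos rfl

lemma B_zero : X.B 0 = 1 := if_pos rfl

lemma hasSum_A {u : ℂ} (h : ‖u‖ * ‖X.edgeOp‖ < 1) : HasSum (fun j : ℕ => u ^ j • X.A j)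
    (1 + u • (X.tau ∘L Ring.inverse (1 - u • X.edgeOp) ∘L X.sigma)) :=
  X.hasSum_neumann h X.A_zero X.A_succ

lemma hasSum_B {u : ℂ} (h : ‖u‖ * ‖X.J‖ < 1) :
    HasSum (fun j : ℕ => (-u) ^ j • X.B j) (X.sunadaOp u) := by
  have := X.hasSum_neumann (S := X.J) (u := -u) (by rwa [norm_neg]) X.B_zero X.B_succ
  rwa [neg_smul, neg_smul, sub_neg_eq_add, ← sub_eq_add_neg] at this

/-- With `L = (1 - u T)⁻¹` and `K = (1 + u J)⁻¹`, the resolvent identity is `L (u σ τ) K = L - K`.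
Multiplying out `(1 + u τ L σ) (1 - u τ K σ)`, the quadratic term cancels the linear ones. -/
lemma AOp_mul_sunadaOp {u : ℂ} (hT : ‖u‖ * ‖X.edgeOp‖ < 1) (hJ : ‖u‖ * ‖X.J‖ < 1) :
    X.AOp u * X.sunadaOp u = 1 := by
  rw [AOp, (X.hasSum_A hT).tsum_eq, sunadaOp]
  have hL : Ring.inverse (1 - u • X.edgeOp) * (1 - u • X.edgeOp) = 1 :=
    Ring.inverse_mul_cancel _ (X.isUnit_one_sub_smul hT)
  have hK : (1 + u • X.J) * Ring.inverse (1 + u • X.J) = 1 := by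
    refine Ring.mul_inverse_cancel _ ?_
    simpa using X.isUnit_one_sub_smul (S := X.J) (u := -u) (by rwa [norm_neg])
  set L := Ring.inverse (1 - u • X.edgeOp)
  set K := Ring.inverse (1 + u • X.J)
  have key : L * (u • (X.sigma ∘L X.tau)) * K = L - K := by
    have : u • (X.sigma ∘L X.tau) = (1 + u • X.J) - (1 - u • X.edgeOp) := by
      rw [edgeOp, smul_sub]; abel
    rw [this, mul_sub, sub_mul, hL, one_mul, mul_assoc, hK, mul_one]
  have e : (X.tau ∘L L ∘L X.sigma) * (u • (X.tau ∘L K ∘L X.sigma)) =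
      X.tau ∘L (L - K) ∘L X.sigma := by
    rw [← key]
    refine ext_basisVec fun x => ?_
    simp
  have e' : X.tau ∘L (L - K) ∘L X.sigma = X.tau ∘L L ∘L X.sigma - X.tau ∘L K ∘L X.sigma := by
    rw [ContinuousLinearMap.sub_comp, ContinuousLinearMap.comp_sub]
  rw [mul_sub, mul_one, add_mul, one_mul, smul_mul_assoc, e, e', smul_sub]
  abel

lemma nu_AOp_sub_one {u : ℂ} (h : ‖u‖ * ‖X.edgeOp‖ < 1) : nu (X.AOp u - 1) ≠ ∞ := by
  rw [AOp, (X.hasSum_A h).tsum_eq, add_sub_cancel_left, nu_smul, sub_eq_add_neg]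
  refine ENNReal.mul_ne_top (by simp) (ne_top_of_le_ne_top ?_ (X.nu_tau_comp_le _))
  refine nu_inverse_comp_ne_top ?_ X.nu_sigma
  rw [nu_neg, nu_smul]
  exact ENNReal.mul_ne_top (by simp) X.nu_edgeOp

lemma fredholmDet_AOp_mul {u : ℂ} (hT : ‖u‖ * ‖X.edgeOp‖ < 1) (hJ : ‖u‖ * ‖X.J‖ < 1) :
    fredholmDet (X.AOp u) * fredholmDet (X.sunadaOp u) = 1 := by
  rw [← fredholmDet_mul (X.nu_AOp_sub_one hT) (X.nu_sunadaOp_sub_one u),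
    X.AOp_mul_sunadaOp hT hJ, fredholmDet_one]

lemma nu_A_succ_le (n : ℕ) : nu (X.A (n + 1)) ≤ nu X.edgeOp ^ n * nu X.sigma := by
  rw [A_succ]
  exact (X.nu_tau_comp_le _).trans (nu_pow_comp_le _ _ n)

lemma nu_B_succ_le (n : ℕ) : nu (X.B (n + 1)) ≤ nu X.J ^ n * nu X.sigma := by
  rw [B_succ]
  exact (X.nu_tau_comp_le _).trans (nu_pow_comp_le _ _ n)

lemma _root_.isTraceClass_one_sub {ι : Type*} {R : EllTwo ι →L[ℂ] EllTwo ι}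
    (h : nu (R - 1) ≠ ∞) : IsTraceClass (1 - R) := by
  refine isTraceClass_of_nu ?_
  rwa [← neg_sub R 1, nu_neg]

lemma isTraceClass_A_B {j : ℕ} (hj : 1 ≤ j) : IsTraceClass (X.A j) ∧ IsTraceClass (X.B j) := by
  obtain ⟨n, rfl⟩ : ∃ n, j = n + 1 := ⟨j - 1, by omega⟩
  refine ⟨isTraceClass_of_nu (ne_top_of_le_ne_top ?_ (X.nu_A_succ_le n)),
    isTraceClass_of_nu (ne_top_of_le_ne_top ?_ (X.nu_B_succ_le n))⟩
  · exact ENNReal.mul_ne_top (ENNReal.pow_ne_top X.nu_edgeOp) X.nu_sigma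
  · exact ENNReal.mul_ne_top (ENNReal.pow_ne_top X.nu_J) X.nu_sigma

end WeightedGraph

/-! ### Power series with a given radius of absolute convergence -/

namespace PowerSeries

/-- The weighted `ℓ¹`-norm of a power series. -/
def weightedNorm (ρ : ℝ≥0∞) (p : PowerSeries ℂ) : ℝ≥0∞ := ∑' n, ‖coeff n p‖ₑ * ρ ^ n

variable {ρ : ℝ≥0∞}

lemma weightedNorm_zero : weightedNorm ρ 0 = 0 := by simp [weightedNorm]

lemma weightedNorm_one : weightedNorm ρ 1 = 1 := by
  rw [weightedNorm, tsum_eq_single 0]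
  · simp
  · intro n hn; simp [coeff_one, hn]

lemma weightedNorm_neg (p : PowerSeries ℂ) : weightedNorm ρ (-p) = weightedNorm ρ p := by
  simp [weightedNorm]

lemma weightedNorm_add_le (p q : PowerSeries ℂ) :
    weightedNorm ρ (p + q) ≤ weightedNorm ρ p + weightedNorm ρ q := by
  unfold weightedNorm
  rw [← ENNReal.tsum_add]
  gcongr with n
  rw [map_add, ← add_mul]
  gcongr
  exact enorm_add_le _ _

lemma weightedNorm_mul_le (p q : PowerSeries ℂ) :
    weightedNorm ρ (p * q) ≤ weightedNorm ρ p * weightedNorm ρ q := by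
  unfold weightedNorm
  calc ∑' n, ‖coeff n (p * q)‖ₑ * ρ ^ n
      ≤ ∑' n, ∑ x ∈ Finset.HasAntidiagonal.antidiagonal n,
          (‖coeff x.1 p‖ₑ * ρ ^ x.1) * (‖coeff x.2 q‖ₑ * ρ ^ x.2) := by
        gcongr with n
        rw [coeff_mul]
        refine (mul_le_mul_left (enorm_sum_le _ _) _).trans (le_of_eq ?_)
        rw [Finset.sum_mul]
        refine Finset.sum_congr rfl fun x hx => ?_
        rw [enorm_mul, ← Finset.HasAntidiagonal.mem_antidiagonal.mp hx, pow_add]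
        ring
    _ = ∑' x : ℕ × ℕ, (‖coeff x.1 p‖ₑ * ρ ^ x.1) * (‖coeff x.2 q‖ₑ * ρ ^ x.2) := by
        rw [← Finset.HasAntidiagonal.sigmaAntidiagonalEquivProd.tsum_eq, ENNReal.tsum_sigma']
        refine tsum_congr fun n => ?_
        rw [tsum_fintype, ← Finset.sum_coe_sort]
        rfl
    _ = _ := by
        rw [ENNReal.tsum_prod (f := fun m n =>
          (‖coeff m p‖ₑ * ρ ^ m) * (‖coeff n q‖ₑ * ρ ^ n)), ← ENNReal.tsum_mul_right]
        exact tsum_congr fun m => ENNReal.tsum_mul_left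

/-- The power series which converge absolutely at radius `ρ`. -/
def convergent (ρ : ℝ≥0∞) : Subring (PowerSeries ℂ) where
  carrier := {p | weightedNorm ρ p ≠ ∞}
  mul_mem' {p q} hp hq :=
    ne_top_of_le_ne_top (ENNReal.mul_ne_top hp hq) (weightedNorm_mul_le p q)
  one_mem' := by simp [weightedNorm_one]
  add_mem' {p q} hp hq :=
    ne_top_of_le_ne_top (ENNReal.add_ne_top.mpr ⟨hp, hq⟩) (weightedNorm_add_le p q)
  zero_mem' := by simp [weightedNorm_zero]
  neg_mem' {p} hp := by simpa [weightedNorm_neg] using hp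

lemma summable_norm_of_mem {u : ℂ} (hu : ‖u‖ₑ ≤ ρ) {p : PowerSeries ℂ} (hp : p ∈ convergent ρ) :
    Summable fun n => ‖coeff n p * u ^ n‖ := by
  have : ∑' n, ‖coeff n p * u ^ n‖ₑ ≠ ∞ := by
    refine ne_top_of_le_ne_top hp (ENNReal.tsum_le_tsum fun n => ?_)
    rw [enorm_mul, enorm_pow]
    gcongr
  simpa using ENNReal.summable_toReal this

/-- Evaluation of absolutely convergent power series. -/
def evalHom {u : ℂ} (hu : ‖u‖ₑ ≤ ρ) : convergent ρ →+* ℂ where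
  toFun p := ∑' n, coeff n p.1 * u ^ n
  map_one' := by
    rw [tsum_eq_single 0]
    · simp
    · intro n hn; simp [coeff_one, hn]
  map_zero' := by simp
  map_add' p q := by
    rw [← (summable_norm_of_mem hu p.2).of_norm.tsum_add (summable_norm_of_mem hu q.2).of_norm]
    exact tsum_congr fun n => by simp [add_mul]
  map_mul' p q := by
    rw [tsum_mul_tsum_eq_tsum_sum_antidiagonal_of_summable_norm (summable_norm_of_mem hu p.2)
      (summable_norm_of_mem hu q.2)]
    refine tsum_congr fun n => ?_
    rw [Subring.coe_mul, coeff_mul, Finset.sum_mul]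
    refine Finset.sum_congr rfl fun x hx => ?_
    rw [← Finset.HasAntidiagonal.mem_antidiagonal.mp hx, pow_add]
    ring

end PowerSeries

/-! ### Formal determinants of power series of operators, and their evaluation. -/

namespace EllTwo

open InfMatrix PowerSeries

variable {ι : Type*}

/-- The matrix of power series of a power series of operators. -/
def seriesMat (R : PowerSeries (EllTwo ι →L[ℂ] EllTwo ι)) (i j : ι) : PowerSeries ℂ :=
  PowerSeries.mk fun m => mat (PowerSeries.coeff m R) i j

/-- Each entry is divisible by the variable, so a minor of size `k` is divisible by its `k`-th
power. Hence cutting off at `k ≤ n` in `fredholmDetSeries` loses nothing. -/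
lemma coeff_minor_eq_zero {M : ι → ι → PowerSeries ℂ} (hM : ∀ i j, coeff 0 (M i j) = 0)
    {S : Finset ι} {n : ℕ} (hn : n < S.card) : coeff n (minor M S) = 0 := by
  classical
  have h : ∀ i j, ∃ p, M i j = X * p := fun i j => X_dvd_iff.mpr (by simpa using hM i j)
  choose P hP using h
  have : minor M S = X ^ S.card * minor P S := by
    have e : (Matrix.of fun i j : S => M i j) =
        (X : PowerSeries ℂ) • Matrix.of fun i j : S => P i j := by
      ext1 i j
      simp [hP]
    unfold minor
    rw [e, Matrix.det_smul, Fintype.card_coe]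
  rw [this, coeff_X_pow_mul', if_neg (by omega)]

/-- Joint absolute summability in the subset and the degree, which later permits summing in either
order. -/
lemma summable_coeff_minor {M : ι → ι → PowerSeries ℂ} {ρ : ℝ≥0∞}
    (hr : ∑' i, ∑' j, weightedNorm ρ (M i j) ≠ ∞) :
    ∑' S : Finset ι, ∑' n, ‖coeff n (minor M S)‖ₑ * ρ ^ n ≠ ∞ := by
  refine ne_top_of_le_ne_top (ENNReal.tsum_finset_prod_ne_top hr) ?_
  exact ENNReal.tsum_le_tsum fun S =>
    apply_minor_le (weightedNorm ρ) weightedNorm_zero weightedNorm_one.le weightedNorm_neg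
      weightedNorm_add_le weightedNorm_mul_le M S

lemma coeff_fredholmDetSeries {R : PowerSeries (EllTwo ι →L[ℂ] EllTwo ι)} {ρ : ℝ≥0∞}
    (hρ : ρ ≠ 0) (h0 : coeff 0 R = 1)
    (hr : ∑' i, ∑' j, weightedNorm ρ (seriesMat (R - 1) i j) ≠ ∞) (n : ℕ) :
    coeff n (fredholmDetSeries R) = ∑' S : Finset ι, coeff n (minor (seriesMat (R - 1)) S) := by
  classical
  set f : Finset ι → ℂ := fun S => coeff n (minor (seriesMat (R - 1)) S)
  have hf : Summable f := by
    have h1 : ∑' S, ‖f S‖ₑ * ρ ^ n ≠ ∞ := by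
      refine ne_top_of_le_ne_top (summable_coeff_minor hr) ?_
      exact ENNReal.tsum_le_tsum fun S => ENNReal.le_tsum
        (f := fun n => ‖coeff n (minor (seriesMat (R - 1)) S)‖ₑ * ρ ^ n) n
    rw [ENNReal.tsum_mul_right] at h1
    have h2 : ∑' S, ‖f S‖ₑ ≠ ∞ := fun h => by
      rw [h, ENNReal.top_mul (pow_ne_zero n hρ)] at h1
      exact h1 rfl
    refine Summable.of_norm ?_
    simpa using ENNReal.summable_toReal h2
  have hf0 : ∀ S, n < S.card → f S = 0 := fun S hS =>
    coeff_minor_eq_zero (fun i j => by simp [seriesMat, h0, mat]) hS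
  have hs := (Equiv.sigmaFiberEquiv (Finset.card (α := ι))).summable_iff.mpr hf
  rw [← (Equiv.sigmaFiberEquiv (Finset.card (α := ι))).tsum_eq f]
  refine Eq.trans ?_ (hs.tsum_sigma).symm
  rw [tsum_eq_sum (s := Finset.range (n + 1))]
  · rw [fredholmDetSeries, coeff_mk]
    rfl
  · intro k hk
    refine (tsum_congr fun S => ?_).trans tsum_zero
    obtain ⟨S, rfl⟩ := S
    exact hf0 S (by simpa using hk)

/-- The determinant of a convergent power series of operators is the sum of the formal
determinant. -/
lemma hasSum_fredholmDetSeries {R : PowerSeries (EllTwo ι →L[ℂ] EllTwo ι)} {ρ : ℝ≥0∞} {u : ℂ}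
    (hρ : ρ ≠ 0) (hu : ‖u‖ₑ ≤ ρ) (h0 : coeff 0 R = 1)
    (hR : ∑' n, nu (coeff n (R - 1)) * ρ ^ n ≠ ∞) {Q : EllTwo ι →L[ℂ] EllTwo ι}
    (hQ : HasSum (fun n => u ^ n • coeff n R) Q) (hQnu : nu (Q - 1) ≠ ∞) :
    HasSum (fun n => coeff n (fredholmDetSeries R) * u ^ n) (fredholmDet Q) := by
  classical
  set M := seriesMat (R - 1)
  have hr : ∑' i, ∑' j, weightedNorm ρ (M i j) ≠ ∞ := by
    refine ne_of_eq_of_ne ?_ hR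
    simp only [weightedNorm, M, seriesMat, coeff_mk]
    simp_rw [ENNReal.tsum_comm (β := ℕ), ENNReal.tsum_mul_right]
    rfl
  have hmem : ∀ i j, M i j ∈ convergent ρ := fun i j =>
    ENNReal.ne_top_of_tsum_ne_top (ENNReal.ne_top_of_tsum_ne_top hr i) j
  have hQ1 : HasSum (fun n => u ^ n • coeff n (R - 1)) (Q - 1) := by
    have h1 : HasSum (fun n => u ^ n • coeff n (1 : PowerSeries (EllTwo ι →L[ℂ] EllTwo ι)))
        (u ^ 0 • coeff 0 (1 : PowerSeries (EllTwo ι →L[ℂ] EllTwo ι))) :=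
      hasSum_single 0 fun n hn => by simp [coeff_one, hn]
    have h2 := hQ.sub h1
    simp only [← smul_sub, ← map_sub] at h2
    simpa using h2
  have hmat : ∀ i j, mat (Q - 1) i j = evalHom hu ⟨M i j, hmem i j⟩ := fun i j => by
    refine (hQ1.mapL (matCLM i j)).tsum_eq.symm.trans (tsum_congr fun n => ?_)
    rw [map_smul, smul_eq_mul, mul_comm]
    simp [M, seriesMat, mat]
  -- Evaluation is a ring homomorphism on the subring of convergent series, so it commutes with the
  -- determinants defining the minors.
  have hev : ∀ S, minor (mat (Q - 1)) S = ∑' n, coeff n (minor M S) * u ^ n := fun S => by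
    let N : Matrix S S (convergent ρ) := Matrix.of fun i j => ⟨M i j, hmem i j⟩
    have e1 : minor M S = (convergent ρ).subtype N.det := by
      rw [RingHom.map_det]; rfl
    have e2 : minor (mat (Q - 1)) S = evalHom hu N.det := by
      rw [RingHom.map_det, minor]
      congr 1
      ext i j
      exact hmat i j
    rw [e1, e2]
    rfl
  let g : Finset ι × ℕ → ℂ := fun p => coeff p.2 (minor M p.1) * u ^ p.2
  have hg : Summable g := by
    have h1 : ∑' p, ‖g p‖ₑ ≠ ∞ := by
      refine ne_top_of_le_ne_top (summable_coeff_minor hr) ?_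
      rw [ENNReal.tsum_prod']
      gcongr with S n
      simp only [g, enorm_mul, enorm_pow]
      gcongr
    refine Summable.of_norm ?_
    simpa using ENNReal.summable_toReal h1
  have hg' := (Equiv.prodComm ℕ (Finset ι)).summable_iff.mpr hg
  have h1 := hg'.hasSum.prod_fiberwise fun n => (hg'.prod_factor n).hasSum
  have h2 : ∑' p, (g ∘ Equiv.prodComm ℕ (Finset ι)) p = ∑' p, g p :=
    (Equiv.prodComm ℕ (Finset ι)).tsum_eq g
  rw [h2, hg.tsum_prod] at h1
  rw [fredholmDet_eq_minorSum hQnu, minorSum]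
  simp_rw [hev]
  convert h1 using 2 with n
  rw [coeff_fredholmDetSeries hρ h0 hr, ← tsum_mul_right]
  rfl

/-- A convergent product identity between power series is a formal one. -/
lemma _root_.PowerSeries.mul_eq_one_of_hasSum {p q : PowerSeries ℂ} {r : ℝ} (hr : 0 < r)
    {f g : ℂ → ℂ} (hp : ∀ u : ℂ, ‖u‖ < r → HasSum (fun n => coeff n p * u ^ n) (f u))
    (hq : ∀ u : ℂ, ‖u‖ < r → HasSum (fun n => coeff n q * u ^ n) (g u))
    (h : ∀ u : ℂ, ‖u‖ < r → f u * g u = 1) : p * q = 1 := by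
  have hpq : ∀ u : ℂ, ‖u‖ < r → HasSum (fun n => coeff n (p * q) * u ^ n) 1 := fun u hu => by
    have h1 := (hp u hu).summable.norm
    have h2 := (hq u hu).summable.norm
    have h3 := (summable_norm_sum_mul_antidiagonal_of_summable_norm h1 h2).of_norm.hasSum
    rw [← tsum_mul_tsum_eq_tsum_sum_antidiagonal_of_summable_norm h1 h2, (hp u hu).tsum_eq,
      (hq u hu).tsum_eq, h u hu] at h3
    refine (funext fun n => ?_ : (fun n => coeff n (p * q) * u ^ n) = _) ▸ h3
    rw [coeff_mul, Finset.sum_mul]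
    refine Finset.sum_congr rfl fun x hx => ?_
    rw [← Finset.HasAntidiagonal.mem_antidiagonal.mp hx, pow_add]
    ring
  -- Both `p * q` and `1` are power series expansions at `0` of the constant function `1`, so their
  -- coefficients agree.
  have ps : ∀ c : PowerSeries ℂ, (∀ u : ℂ, ‖u‖ < r → HasSum (fun n => coeff n c * u ^ n) 1) →
      HasFPowerSeriesAt (fun _ : ℂ => (1 : ℂ))
        (FormalMultilinearSeries.ofScalars ℂ fun n => coeff n c) 0 := by
    intro c hc
    rw [hasFPowerSeriesAt_iff]
    filter_upwards [Metric.ball_mem_nhds (0 : ℂ) hr] with u hu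
    have := hc u (by simpa using hu)
    simpa [FormalMultilinearSeries.coeff_ofScalars, mul_comm] using this
  have h1 := ps (p * q) hpq
  have h2 := ps 1 fun u _ => by
    have := hasSum_single (f := fun n => coeff n (1 : PowerSeries ℂ) * u ^ n) 0
      fun n hn => by simp [coeff_one, hn]
    simpa using this
  have h3 := h1.eq_formalMultilinearSeries h2
  ext n
  have := congrArg (fun F => F.coeff n) h3
  simpa [FormalMultilinearSeries.coeff_ofScalars] using this

end EllTwo

/-! ### The logarithm of the determinant -/

namespace Matrix

variable {n : Type*} [Fintype n] [DecidableEq n]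

lemma hasDerivAt_det_one_add_smul (M : Matrix n n ℂ) :
    HasDerivAt (fun h : ℂ => (1 + h • M).det) M.trace 0 := by
  have h1 : ∀ h : ℂ, (1 + h • M).det =
      (det (1 + (Polynomial.X : Polynomial ℂ) • M.map Polynomial.C)).eval h := fun h => by
    rw [← Polynomial.coe_evalRingHom, RingHom.map_det]
    congr 1
    ext i j
    by_cases hij : i = j <;> simp [hij, mul_comm h]
  rw [funext h1, ← derivative_det_one_add_X_smul M]
  exact Polynomial.hasDerivAt _ _

/-- Jacobi's formula along the line `1 - u M`. -/
lemma hasDerivAt_det_one_sub_smul (M N : Matrix n n ℂ) (u : ℂ) (hN : (1 - u • M) * N = 1) :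
    HasDerivAt (fun v : ℂ => (1 - v • M).det) (-((1 - u • M).det * (N * M).trace)) u := by
  -- Factoring out `1 - u M` turns the derivative at `u` into a derivative at the identity, where it
  -- is a trace.
  have h1 : ∀ v : ℂ, (1 - v • M).det = (1 - u • M).det * (1 + (v - u) • (-(N * M))).det := by
    intro v
    rw [← det_mul, mul_add, mul_one, mul_smul_comm, mul_neg, ← mul_assoc, hN, one_mul]
    congr 1
    rw [sub_smul, smul_neg, smul_neg]
    abel
  rw [funext h1]
  have h2 := hasDerivAt_det_one_add_smul (-(N * M))
  rw [← sub_self u] at h2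
  have h3 := (h2.comp_sub_const u u).const_mul (1 - u • M).det
  simpa [trace_neg] using h3

attribute [local instance] Matrix.linftyOpNormedRing Matrix.linftyOpNormedAlgebra

/-- By Jacobi's formula `det (1 - v M) · exp (∑ tr (Mᵏ) vᵏ / k)` has derivative zero on the disc of
radius `ρ`, and it is `1` at `v = 0`. The strict bound `ρ ‖M‖ < 1` gives a geometric majorant for
the differentiated series. -/
lemma det_one_sub_smul_eq_exp_of_norm (M : Matrix n n ℂ) {ρ : ℝ} (hρ : ρ * ‖M‖ < 1) {u : ℂ}
    (hu : ‖u‖ < ρ) :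
    (1 - u • M).det = Complex.exp (-∑' k : ℕ, (M ^ (k + 1)).trace * u ^ (k + 1) / (k + 1)) := by
  have hρ0 : 0 < ρ := (norm_nonneg u).trans_lt hu
  have hbound : ∀ A : Matrix n n ℂ, ‖Matrix.traceLinearMap n ℂ ℂ A‖ ≤ Fintype.card n * ‖A‖ := by
    intro A
    have h : ∀ i, ‖A i i‖ ≤ ‖A‖ := fun i => by
      rw [linfty_opNorm_def, ← coe_nnnorm, NNReal.coe_le_coe]
      exact (Finset.single_le_sum (f := fun j => ‖A i j‖₊) (fun _ _ => zero_le)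
        (Finset.mem_univ i)).trans
        (Finset.le_sup (f := fun i => ∑ j, ‖A i j‖₊) (Finset.mem_univ i))
    calc ‖Matrix.traceLinearMap n ℂ ℂ A‖ ≤ ∑ i, ‖A i i‖ := norm_sum_le _ _
      _ ≤ ∑ _i : n, ‖A‖ := Finset.sum_le_sum fun i _ => h i
      _ = _ := by simp
  let tr := (Matrix.traceLinearMap n ℂ ℂ).mkContinuous _ hbound
  have htr : ∀ A, tr A = A.trace := fun A => rfl
  let L : ℂ → ℂ := fun v => ∑' k : ℕ, (M ^ (k + 1)).trace * v ^ (k + 1) / (k + 1)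
  have hL : ∀ v : ℂ, ‖v‖ < ρ →
      HasDerivAt L (∑' k : ℕ, (M ^ (k + 1)).trace * v ^ k) v := by
    intro v hv
    refine hasDerivAt_tsum_of_isPreconnected (u := fun k => ‖tr‖ * ‖M‖ * (ρ * ‖M‖) ^ k)
      (g := fun (k : ℕ) (v : ℂ) => (M ^ (k + 1)).trace * v ^ (k + 1) / (k + 1))
      (g' := fun (k : ℕ) (v : ℂ) => (M ^ (k + 1)).trace * v ^ k)
      (t := Metric.ball (0 : ℂ) ρ) (y₀ := (0 : ℂ))
      ((summable_geometric_of_lt_one (by positivity) hρ).mul_left _) Metric.isOpen_ball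
      (convex_ball 0 ρ).isPreconnected ?_ ?_ (by simpa using hρ0) ?_ (by simpa using hv)
    · intro k y _
      have h := (((hasDerivAt_id y).pow (k + 1)).const_mul (M ^ (k + 1)).trace).div_const
        ((k : ℂ) + 1)
      have hk : ((k : ℂ) + 1) ≠ 0 := by exact_mod_cast k.succ_ne_zero
      refine h.congr_deriv ?_
      simp only [id_eq, Nat.add_sub_cancel, mul_one, Nat.cast_add, Nat.cast_one]
      field_simp
    · intro k y hy
      rw [← htr, norm_mul, norm_pow]
      have hy' : ‖y‖ ≤ ρ := by simpa using (Metric.mem_ball.mp hy).le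
      calc ‖tr (M ^ (k + 1))‖ * ‖y‖ ^ k ≤ (‖tr‖ * ‖M‖ ^ (k + 1)) * ρ ^ k := by
            gcongr
            exact (tr.le_opNorm _).trans (by gcongr; exact norm_pow_le' M k.succ_pos)
        _ = _ := by rw [mul_pow]; ring
    · refine summable_zero.congr fun k => ?_
      simp
  have hD : ∀ v : ℂ, ‖v‖ < ρ →
      HasDerivAt (fun v => (1 - v • M).det * Complex.exp (L v)) 0 v := by
    intro v hv
    have hvM : ‖v • M‖ < 1 := by
      rw [norm_smul]
      exact (mul_le_mul_of_nonneg_right hv.le (norm_nonneg _)).trans_lt hρ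
    have hN := NormedRing.hasSum_pow_inverse_one_sub hvM
    set N := Ring.inverse (1 - v • M)
    have h1 : (1 - v • M) * N = 1 :=
      Ring.mul_inverse_cancel _ (Units.oneSub (v • M) hvM).isUnit
    have h2 : ∑' k : ℕ, (M ^ (k + 1)).trace * v ^ k = (N * M).trace := by
      have := ((hN.mul_right M).mapL tr).tsum_eq
      rw [← htr, ← this]
      refine tsum_congr fun k => ?_
      rw [smul_pow, smul_mul_assoc, ← pow_succ, map_smul, htr, smul_eq_mul, mul_comm]
    have h3 := (hasDerivAt_det_one_sub_smul M N v h1).mul (hL v hv).cexp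
    rw [h2] at h3
    exact h3.congr_deriv (by ring)
  have hconst : (1 - u • M).det * Complex.exp (L u) = 1 := by
    have := Metric.isOpen_ball.is_const_of_deriv_eq_zero (convex_ball (0 : ℂ) ρ).isPreconnected
      (f := fun v => (1 - v • M).det * Complex.exp (L v))
      (fun v hv => (hD v (by simpa using hv)).differentiableAt.differentiableWithinAt)
      (fun v hv => (hD v (by simpa using hv)).deriv)
      (show u ∈ Metric.ball 0 ρ by simpa using hu)
      (show (0 : ℂ) ∈ Metric.ball 0 ρ by simpa using hρ0)
    simpa [L] using this
  rw [Complex.exp_neg]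
  exact eq_inv_of_mul_eq_one_left hconst

/-- `det (1 - u M) = exp (- ∑ tr (Mᵏ) uᵏ / k)`. -/
lemma det_one_sub_smul_eq_exp (M : Matrix n n ℂ) {s : ℝ} (hs : 0 ≤ s)
    (hM : ∀ i, ∑ j, ‖M i j‖ ≤ s) {u : ℂ} (hu : ‖u‖ * s < 1) :
    (1 - u • M).det = Complex.exp (-∑' k : ℕ, (M ^ (k + 1)).trace * u ^ (k + 1) / (k + 1)) := by
  have h1 : ‖M‖ ≤ s := by
    rw [linfty_opNorm_def]
    lift s to NNReal using hs
    refine NNReal.coe_le_coe.mpr (Finset.sup_le fun i _ => ?_)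
    have := hM i
    rw [← NNReal.coe_le_coe]
    simpa using this
  -- A disc slightly larger than `‖u‖` on which the series still converges.
  obtain ⟨ρ, h2, h3⟩ : ∃ ρ, ‖u‖ < ρ ∧ ρ * s < 1 := by
    have hc : Tendsto (fun ρ : ℝ => ρ * s) (𝓝[>] ‖u‖) (𝓝 (‖u‖ * s)) :=
      ((continuous_id.mul continuous_const).tendsto _).mono_left nhdsWithin_le_nhds
    obtain ⟨ρ, h⟩ := ((hc.eventually_lt_const hu).and self_mem_nhdsWithin).exists
    exact ⟨ρ, h.2, h.1⟩
  refine det_one_sub_smul_eq_exp_of_norm M (ρ := ρ) (lt_of_le_of_lt ?_ h3) h2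
  exact mul_le_mul_of_nonneg_left h1 ((norm_nonneg u).trans h2.le)

/-- `a` lists the interior indices; `cons i a` gives the sources of the successive steps and `snoc a
j` their targets. -/
lemma pow_succ_apply_eq_sum (M : Matrix n n ℂ) (k : ℕ) (i j : n) :
    (M ^ (k + 1)) i j = ∑ a : Fin k → n,
      ∏ l : Fin (k + 1), M (Fin.cons (α := fun _ => n) i a l)
        (Fin.snoc (α := fun _ => n) a j l) := by
  induction k generalizing i with
  | zero => simp [Fin.snoc]
  | succ k ih =>
    rw [pow_succ', mul_apply, ← (Fin.consEquiv fun _ => n).sum_comp, Fintype.sum_prod_type]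
    refine Finset.sum_congr rfl fun x _ => ?_
    rw [ih, Finset.mul_sum]
    refine Finset.sum_congr rfl fun a _ => ?_
    have e : (Fin.consEquiv fun _ => n) (x, a) = Fin.cons (α := fun _ => n) x a := rfl
    conv_rhs => rw [e, ← Fin.cons_snoc_eq_snoc_cons, Fin.prod_univ_succ]
    simp only [Fin.cons_zero, Fin.cons_succ]

/-- The trace of a power as a sum over cyclic sequences of indices. -/
lemma trace_pow_succ (M : Matrix n n ℂ) (k : ℕ) :
    (M ^ (k + 1)).trace = ∑ a : Fin (k + 1) → n, ∏ l, M (a l) (a (l + 1)) := by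
  rw [trace, ← (Fin.consEquiv fun _ => n).sum_comp, Fintype.sum_prod_type]
  refine Finset.sum_congr rfl fun i _ => ?_
  rw [diag_apply, pow_succ_apply_eq_sum]
  refine Finset.sum_congr rfl fun a _ => Finset.prod_congr rfl fun l _ => ?_
  have e : (Fin.consEquiv fun _ => n) (i, a) = Fin.cons (α := fun _ => n) i a := rfl
  rw [e]
  congr 1
  -- Addition in `Fin (k + 1)` is cyclic: the successor of the last index is `0`, which closes the
  -- sequence at `i`.
  induction l using Fin.lastCases with
  | last => simp
  | cast l => rw [Fin.snoc_castSucc, Fin.coeSucc_eq_succ, Fin.cons_succ]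

end Matrix

/-! ### The trace expansion of infinite determinants, and their dependence on `u`. -/

namespace InfMatrix

variable {ι : Type*}

lemma hasSum_prod_fin {w : ι → ℝ} (h0 : ∀ i, 0 ≤ w i) (hw : Summable w) (m : ℕ) :
    HasSum (fun a : Fin m → ι => ∏ l, w (a l)) ((∑' i, w i) ^ m) := by
  induction m with
  | zero =>
    have h := hasSum_fintype fun a : Fin 0 → ι => ∏ l, w (a l)
    rw [Fintype.sum_unique] at h
    simpa only [Finset.univ_eq_empty, Finset.prod_empty, pow_zero] using h
  | succ m ih =>
    rw [← (Fin.consEquiv fun _ => ι).hasSum_iff, pow_succ']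
    have hs := hw.mul_of_nonneg ih.summable h0 fun a => Finset.prod_nonneg fun l _ => h0 _
    have h := hw.hasSum.mul ih hs
    have e : ((fun a : Fin (m + 1) → ι => ∏ l, w (a l)) ∘ Fin.consEquiv fun _ => ι) =
        fun p => w p.1 * ∏ l, w (p.2 l) := by
      funext p
      simp [Fin.consEquiv, Fin.prod_univ_succ]
    rw [e]
    exact h

/-- The contribution of a cyclic sequence of indices to the logarithm of a determinant. -/
def cyclicTerm (M : ι → ι → ℂ) (u : ℂ) (c : Σ k : ℕ, Fin (k + 1) → ι) : ℂ :=
  (∏ l, M (c.2 l) (c.2 (l + 1))) * u ^ (c.1 + 1) / (c.1 + 1)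

/-- The sequences of length `k + 1` contribute exactly `(‖u‖ ∑ w)^(k+1)`, so the total is a
geometric series. -/
lemma summable_cyclic_bound {w : ι → ℝ} (h0 : ∀ i, 0 ≤ w i) (hw : Summable w) {u : ℂ}
    (hu : ‖u‖ * ∑' i, w i < 1) :
    Summable fun c : Σ k : ℕ, Fin (k + 1) → ι => (∏ l, w (c.2 l)) * ‖u‖ ^ (c.1 + 1) := by
  have hs : 0 ≤ ∑' i, w i := tsum_nonneg h0
  have hk : ∀ k : ℕ, HasSum (fun a : Fin (k + 1) → ι => (∏ l, w (a l)) * ‖u‖ ^ (k + 1))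
      ((‖u‖ * ∑' i, w i) ^ (k + 1)) := fun k => by
    rw [mul_comm, mul_pow]
    exact (hasSum_prod_fin h0 hw (k + 1)).mul_right _
  have hg : Summable fun k : ℕ => (‖u‖ * ∑' i, w i) ^ (k + 1) :=
    (summable_nat_add_iff 1).mpr
      (summable_geometric_of_lt_one (mul_nonneg (norm_nonneg u) hs) hu)
  refine (summable_sigma_of_nonneg fun c =>
    mul_nonneg (Finset.prod_nonneg fun l _ => h0 _) (pow_nonneg (norm_nonneg u) _)).mpr
      ⟨fun k => (hk k).summable, hg.congr fun k => ((hk k).tsum_eq).symm⟩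

lemma norm_cyclicTerm_le {M : ι → ι → ℂ} {w : ι → ℝ} (hM : ∀ i j, ‖M i j‖ ≤ w j) (u : ℂ)
    (c : Σ k : ℕ, Fin (k + 1) → ι) : ‖cyclicTerm M u c‖ ≤ (∏ l, w (c.2 l)) * ‖u‖ ^ (c.1 + 1) := by
  have h1 : ‖∏ l, M (c.2 l) (c.2 (l + 1))‖ ≤ ∏ l, w (c.2 l) := by
    -- The cyclic shift `l ↦ l + 1` permutes the indices, so bounds by the target index multiply to
    -- the weight of the whole sequence.
    rw [norm_prod, ← Equiv.prod_comp (Equiv.addRight (1 : Fin (c.1 + 1))) fun l => w (c.2 l)]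
    exact Finset.prod_le_prod (fun _ _ => norm_nonneg _) fun l _ => hM _ _
  have h2 : (1 : ℝ) ≤ ‖((c.1 : ℂ) + 1)‖ := by
    have : ‖((c.1 : ℂ) + 1)‖ = (c.1 : ℝ) + 1 := by
      rw [← Nat.cast_add_one, Complex.norm_natCast]; push_cast; rfl
    rw [this]; linarith [Nat.cast_nonneg (α := ℝ) c.1]
  rw [cyclicTerm, norm_div, norm_mul, norm_pow]
  refine (div_le_self (by positivity) h2).trans ?_
  gcongr

lemma summable_cyclicTerm {M : ι → ι → ℂ} {w : ι → ℝ} (h0 : ∀ i, 0 ≤ w i) (hw : Summable w)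
    (hM : ∀ i j, ‖M i j‖ ≤ w j) {u : ℂ} (hu : ‖u‖ * ∑' i, w i < 1) : Summable (cyclicTerm M u) :=
  Summable.of_norm_bounded (summable_cyclic_bound h0 hw hu) (norm_cyclicTerm_le hM u)

lemma norm_trunc_le (F G : Finset ι) (M : ι → ι → ℂ) (i j : ι) : ‖trunc F G M i j‖ ≤ ‖M i j‖ := by
  rw [← enorm_le_iff_norm_le]
  exact enorm_trunc_le F G M i j

lemma minorSum_trunc_eq_exp {M : ι → ι → ℂ} {w : ι → ℝ} (h0 : ∀ i, 0 ≤ w i) (hw : Summable w)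
    (hM : ∀ i j, ‖M i j‖ ≤ w j) {u : ℂ} (hu : ‖u‖ * ∑' i, w i < 1) (F : Finset ι) :
    minorSum (trunc F F fun i j => -(u * M i j)) =
      Complex.exp (-∑' c, cyclicTerm (trunc F F M) u c) := by
  classical
  let A : Matrix F F ℂ := Matrix.of fun i j => M i j
  have e1 : (1 + Matrix.of fun i j : F => -(u * M i j)) = 1 - u • A := by
    rw [sub_eq_add_neg]; rfl
  have hrow : ∀ i : F, ∑ j, ‖A i j‖ ≤ ∑' i, w i := fun i => by
    calc ∑ j : F, ‖M i j‖ ≤ ∑ j : F, w j := Finset.sum_le_sum fun j _ => hM i j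
      _ = ∑ j ∈ F, w j := Finset.sum_coe_sort F w
      _ ≤ _ := hw.sum_le_tsum F fun i _ => h0 i
  have hM' : ∀ i j, ‖trunc F F M i j‖ ≤ w j := fun i j => (norm_trunc_le F F M i j).trans (hM i j)
  rw [minorSum_trunc, e1, Matrix.det_one_sub_smul_eq_exp A (tsum_nonneg h0) hrow hu,
    (summable_cyclicTerm h0 hw hM' hu).tsum_sigma]
  congr 2
  refine tsum_congr fun k => ?_
  simp only [cyclicTerm, mul_div_assoc]
  rw [tsum_mul_right, Matrix.trace_pow_succ]
  congr 1
  let φ : (Fin (k + 1) → F) → (Fin (k + 1) → ι) := fun a l => a l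
  have hφ : Function.Injective φ := fun a b h => funext fun l => Subtype.ext (congrFun h l)
  rw [← hφ.tsum_eq, tsum_fintype]
  · refine Finset.sum_congr rfl fun a _ => Finset.prod_congr rfl fun l _ => ?_
    exact (trunc_of_mem (a l).2 (a (l + 1)).2).symm
  -- A sequence leaving `F` meets a zero of the truncated matrix, so only sequences inside `F`
  -- remain.
  · intro a ha
    have : ∀ l, a l ∈ F := fun l => by
      by_contra hl
      refine ha (Finset.prod_eq_zero (Finset.mem_univ l) ?_)
      simp [trunc, hl]
    exact ⟨fun l => ⟨a l, this l⟩, rfl⟩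

/-- `det (1 - u M) = exp (- ∑ tr (Mᵏ) uᵏ / k)` for infinite matrices. -/
lemma minorSum_eq_exp {M : ι → ι → ℂ} {w : ι → ℝ} (h0 : ∀ i, 0 ≤ w i) (hw : Summable w)
    (hM : ∀ i j, ‖M i j‖ ≤ w j) {u : ℂ} (hu : ‖u‖ * ∑' i, w i < 1) (hs : absSum M ≠ ∞) :
    minorSum (fun i j => -(u * M i j)) = Complex.exp (-∑' c, cyclicTerm M u c) := by
  have hs' : absSum (fun i j => -(u * M i j)) ≠ ∞ := by
    simp only [absSum, enorm_neg, enorm_mul, ENNReal.tsum_mul_left]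
    exact ENNReal.mul_ne_top (by simp) hs
  refine tendsto_nhds_unique (tendsto_minorSum_trunc hs') ?_
  simp_rw [minorSum_trunc_eq_exp h0 hw hM hu]
  refine (Complex.continuous_exp.tendsto _).comp (Tendsto.neg ?_)
  -- The majorant depends only on `w` and `u`, not on `F`.
  refine tendsto_tsum_of_dominated_convergence (summable_cyclic_bound h0 hw hu) (fun c => ?_)
    (Eventually.of_forall fun F c => norm_cyclicTerm_le
      (fun i j => (norm_trunc_le F F M i j).trans (hM i j)) u c)
  unfold cyclicTerm
  refine ((tendsto_finsetProd _ fun l _ => ?_).mul_const _).div_const _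
  exact tendsto_trunc tendsto_id tendsto_id M _ _

/-- Reconciles two conventions: `mat X.edgeOp` has the target edge as row index, whereas cyclic
sequences are read from source to target. -/
lemma minorSum_transpose (M : ι → ι → ℂ) : minorSum (fun i j => M j i) = minorSum M := by
  classical
  refine tsum_congr fun S => ?_
  unfold minor
  rw [← Matrix.det_transpose]
  rfl

/-- The minor at `S` is a multiple of `u ^ S.card`, and on the unit ball around `u₀` all rows are
dominated by `‖u₀‖ + 1` times those of `M`. The series of polynomials thus converges locally
uniformly. -/
lemma differentiable_minorSum_smul {M : ι → ι → ℂ} (hM : absSum M ≠ ∞) :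
    Differentiable ℂ fun u : ℂ => minorSum (fun i j => -(u * M i j)) := by
  classical
  have hminor : ∀ (u : ℂ) S, minor (fun i j => -(u * M i j)) S = (-u) ^ S.card * minor M S := by
    intro u S
    have e : (Matrix.of fun i j : S => -(u * M i j)) = (-u) • Matrix.of fun i j : S => M i j := by
      ext i j; simp
    unfold minor
    rw [e, Matrix.det_smul, Fintype.card_coe]
  intro u₀
  have hr : ∑' i, ENNReal.ofReal (‖u₀‖ + 1) * ∑' j, ‖M i j‖ₑ ≠ ∞ := by
    rw [ENNReal.tsum_mul_left]
    exact ENNReal.mul_ne_top ENNReal.ofReal_ne_top hM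
  have := Complex.differentiableOn_tsum_of_summable_norm (summable_prod_toReal hr)
    (F := fun (S : Finset ι) (u : ℂ) => minor (fun i j => -(u * M i j)) S)
    (U := Metric.ball u₀ 1) (fun S => ?_) Metric.isOpen_ball (fun S u hu => ?_)
  · exact (this u₀ (Metric.mem_ball_self one_pos)).differentiableAt
      (Metric.isOpen_ball.mem_nhds (Metric.mem_ball_self one_pos))
  · simp_rw [hminor]
    fun_prop
  · refine norm_minor_le hr (fun i => ?_) S
    simp only [enorm_neg, enorm_mul, ENNReal.tsum_mul_left]
    gcongr
    rw [← ofReal_norm]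
    refine ENNReal.ofReal_le_ofReal ?_
    have h1 : ‖u - u₀‖ < 1 := by simpa [dist_eq_norm] using hu
    have h2 := norm_add_le (u - u₀) u₀
    rw [sub_add_cancel] at h2
    linarith

end InfMatrix

/-! ### Periodic sequences -/

/-- The shift of a sequence. -/
def seqShift {α : Type*} (b : ℕ → α) (i : ℕ) : α := b (i + 1)

lemma seqShift_iterate {α : Type*} (b : ℕ → α) (j i : ℕ) : seqShift^[j] b i = b (i + j) := by
  induction j generalizing b with
  | zero => rfl
  | succ j ih => rw [Function.iterate_succ_apply, ih]; rfl

lemma isPeriodicPt_seqShift {α : Type*} {b : ℕ → α} {n : ℕ} :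
    Function.IsPeriodicPt seqShift n b ↔ ∀ i, b (i + n) = b i := by
  refine ⟨fun h i => ?_, fun h => funext fun i => ?_⟩
  · rw [← seqShift_iterate b, h.eq]
  · rw [seqShift_iterate, h]

lemma eq_of_isPeriodicPt_seqShift {α : Type*} {b c : ℕ → α} {n : ℕ} (hn : 0 < n)
    (hb : Function.IsPeriodicPt seqShift n b) (hc : Function.IsPeriodicPt seqShift n c)
    (h : ∀ i < n, b i = c i) : b = c := by
  have key : ∀ {a : ℕ → α}, Function.IsPeriodicPt seqShift n a → ∀ i, a i = a (i % n) := by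
    intro a ha i
    exact (Function.Periodic.map_mod_nat (isPeriodicPt_seqShift.mp ha) i).symm
  funext i
  rw [key hb, key hc, h _ (Nat.mod_lt _ hn)]

namespace WeightedGraph

variable {V : Type*} {X : WeightedGraph V}

/-! ### Closed paths as periodic sequences of oriented edges -/

/-- The periodic sequence of oriented edges of a closed path. -/
def ClosedPath.seq (γ : X.ClosedPath) (i : ℕ) : X.graph.Dart :=
  γ.walk.darts[i % γ.walk.length]'(by
    rw [SimpleGraph.Walk.length_darts]; exact Nat.mod_lt _ γ.length_pos)

namespace ClosedPath

lemma getElem?_darts_mod (γ : X.ClosedPath) (i : ℕ) :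
    γ.walk.darts[i % γ.walk.length]? = some (γ.seq i) :=
  List.getElem?_eq_getElem _

lemma getElem_darts (γ : X.ClosedPath) {i : ℕ} (h : i < γ.walk.darts.length) :
    γ.walk.darts[i] = γ.seq i := by
  have h' : i < γ.walk.length := by simpa using h
  simp only [seq, Nat.mod_eq_of_lt h']

lemma getElem?_darts (γ : X.ClosedPath) {i : ℕ} (h : i < γ.walk.length) :
    γ.walk.darts[i]? = some (γ.seq i) := by
  rw [← getElem?_darts_mod, Nat.mod_eq_of_lt h]

lemma isPeriodicPt_seq (γ : X.ClosedPath) :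
    Function.IsPeriodicPt seqShift γ.walk.length γ.seq :=
  isPeriodicPt_seqShift.mpr fun i => by simp only [seq, Nat.add_mod_right]

lemma darts_shift (γ : X.ClosedPath) : γ.shift.walk.darts = γ.walk.darts.rotate 1 := by
  obtain ⟨x, p, hp⟩ := γ
  cases p with
  | nil => simp at hp
  | cons h q => simp [shift]

lemma length_shift (γ : X.ClosedPath) : γ.shift.walk.length = γ.walk.length := by
  rw [← SimpleGraph.Walk.length_darts, darts_shift, List.length_rotate,
    SimpleGraph.Walk.length_darts]

lemma seq_shift (γ : X.ClosedPath) : γ.shift.seq = seqShift γ.seq := by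
  funext i
  refine Option.some_injective _ ?_
  rw [← getElem?_darts_mod, seqShift, ← getElem?_darts_mod, darts_shift, length_shift,
    List.getElem?_rotate (by simpa using Nat.mod_lt _ γ.length_pos),
    SimpleGraph.Walk.length_darts, Nat.mod_add_mod]

lemma length_shift_iterate (γ : X.ClosedPath) (j : ℕ) :
    (shift^[j] γ).walk.length = γ.walk.length := by
  induction j generalizing γ with
  | zero => rfl
  | succ j ih => rw [Function.iterate_succ_apply, ih, length_shift]

lemma seq_shift_iterate (γ : X.ClosedPath) (j : ℕ) : (shift^[j] γ).seq = seqShift^[j] γ.seq := by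
  induction j generalizing γ with
  | zero => rfl
  | succ j ih => rw [Function.iterate_succ_apply, ih, seq_shift, Function.iterate_succ_apply]

/-- The length is needed as well as the sequence, because a closed path and its powers have the same
periodic sequence. -/
lemma ext_seq {γ δ : X.ClosedPath} (hl : γ.walk.length = δ.walk.length) (hs : γ.seq = δ.seq) :
    γ = δ := by
  have hd : γ.walk.darts = δ.walk.darts := by
    refine List.ext_getElem (by simpa using hl) fun i h1 h2 => ?_
    rw [getElem_darts, getElem_darts, hs]
  have hne : γ.walk.darts ≠ [] := by
    rw [← List.length_pos_iff_ne_nil, SimpleGraph.Walk.length_darts]; exact γ.length_pos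
  have h := X.sigma_walk_ext (p := ⟨_, _, γ.walk⟩) (q := ⟨_, _, δ.walk⟩) hne hd
  obtain ⟨x, p, hp⟩ := γ
  obtain ⟨y, q, hq⟩ := δ
  obtain ⟨rfl, h⟩ := Sigma.mk.inj h
  obtain ⟨-, h⟩ := Sigma.mk.inj (eq_of_heq h)
  obtain rfl := eq_of_heq h
  rfl

lemma shift_iterate_length (γ : X.ClosedPath) : shift^[γ.walk.length] γ = γ :=
  ext_seq (length_shift_iterate _ _) ((seq_shift_iterate _ _).trans γ.isPeriodicPt_seq.eq)

lemma exists_shift_iterate_eq (γ : X.ClosedPath) (j : ℕ) : ∃ k, shift^[k] (shift^[j] γ) = γ := by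
  have h : ∀ m, shift^[m * γ.walk.length] γ = γ := fun m => by
    rw [mul_comm]
    exact (Function.IsPeriodicPt.mul_const (m := γ.walk.length) γ.shift_iterate_length m).eq
  -- Together with the `j` shifts already made, this is `j` full turns.
  refine ⟨j * γ.walk.length - j, ?_⟩
  rw [← Function.iterate_add_apply, Nat.sub_add_cancel (Nat.le_mul_of_pos_right _ γ.length_pos), h]

lemma mk_shift_iterate (γ : X.ClosedPath) (j : ℕ) :
    (Quot.mk _ (shift^[j] γ) : X.ClosedPathClass) = Quot.mk _ γ := by
  induction j generalizing γ with
  | zero => rfl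
  | succ j ih =>
    rw [Function.iterate_succ_apply, ih]
    exact (Quot.sound (r := fun p q : X.ClosedPath => p.shift = q) rfl).symm

/-- The orbit relation of the shift is already symmetric, since the shift has finite order on each
closed path; hence it equals the generated equivalence relation. -/
lemma mk_eq_mk_iff {γ δ : X.ClosedPath} :
    (Quot.mk _ γ : X.ClosedPathClass) = Quot.mk _ δ ↔ ∃ j, shift^[j] γ = δ := by
  refine ⟨fun h => ?_, ?_⟩
  · replace h := Quot.eqvGen_exact h
    induction h with
    | rel γ δ h => exact ⟨1, h⟩
    | refl γ => exact ⟨0, rfl⟩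
    | symm γ δ h ih =>
      obtain ⟨j, rfl⟩ := ih
      exact γ.exists_shift_iterate_eq j
    | trans γ δ ε h1 h2 ih1 ih2 =>
      obtain ⟨j, rfl⟩ := ih1
      obtain ⟨k, rfl⟩ := ih2
      exact ⟨k + j, Function.iterate_add_apply _ _ _ _⟩
  · rintro ⟨j, rfl⟩
    exact (γ.mk_shift_iterate j).symm

lemma getElem?_darts_powSuccWalk {x : V} (p : X.graph.Walk x x) (k : ℕ) {i : ℕ}
    (hi : i < (k + 1) * p.length) :
    (X.powSuccWalk p k).darts[i]? = p.darts[i % p.length]? := by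
  induction k with
  | zero => rw [powSuccWalk, Nat.mod_eq_of_lt (by simpa using hi)]
  | succ k ih =>
    rw [powSuccWalk, SimpleGraph.Walk.darts_append]
    by_cases h : i < (k + 1) * p.length
    · rw [List.getElem?_append_left (by
        rw [SimpleGraph.Walk.length_darts, length_powSuccWalk]; exact h), ih h]
    · obtain ⟨m, rfl⟩ := Nat.exists_eq_add_of_le (not_lt.mp h)
      have hm : m < p.length := by rw [add_mul (k + 1) 1, one_mul] at hi; omega
      rw [List.getElem?_append_right (by
        rw [SimpleGraph.Walk.length_darts, length_powSuccWalk]; omega),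
        SimpleGraph.Walk.length_darts, length_powSuccWalk, Nat.add_sub_cancel_left,
        Nat.mul_add_mod_self_right, Nat.mod_eq_of_lt hm]

lemma length_powSucc (γ : X.ClosedPath) (k : ℕ) :
    (γ.powSucc k).walk.length = (k + 1) * γ.walk.length :=
  X.length_powSuccWalk γ.walk k

lemma seq_powSucc (γ : X.ClosedPath) (k : ℕ) : (γ.powSucc k).seq = γ.seq := by
  funext i
  refine Option.some_injective _ ?_
  rw [← getElem?_darts_mod, ← getElem?_darts_mod, length_powSucc]
  have h := getElem?_darts_powSuccWalk γ.walk k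
    (Nat.mod_lt i (Nat.mul_pos k.succ_pos γ.length_pos))
  refine h.trans ?_
  rw [Nat.mod_mod_of_dvd _ (Dvd.intro_left _ rfl)]

lemma pathWeight_eq_prod (γ : X.ClosedPath) :
    X.pathWeight γ.walk = ∏ i ∈ Finset.range γ.walk.length, X.w (γ.seq i) := by
  have h : γ.walk.darts = List.ofFn fun i : Fin γ.walk.length => γ.seq i := by
    refine List.ext_getElem (by simp) fun i h1 h2 => ?_
    rw [getElem_darts, List.getElem_ofFn]
  rw [pathWeight, h, List.map_ofFn, List.prod_ofFn, Finset.prod_range]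
  rfl

lemma pathWeight_powSucc (γ : X.ClosedPath) (k : ℕ) :
    X.pathWeight (γ.powSucc k).walk = X.pathWeight γ.walk ^ (k + 1) := by
  change X.pathWeight (X.powSuccWalk γ.walk k) = _
  induction k with
  | zero => simp [powSuccWalk]
  | succ k ih =>
    rw [pow_succ, ← ih]
    simp [powSuccWalk, pathWeight]

lemma pathWeight_shift (γ : X.ClosedPath) : X.pathWeight γ.shift.walk = X.pathWeight γ.walk :=
  (congrArg ClosedPathClass.weight (γ.mk_shift_iterate 1) :)

/-- A periodic sequence of oriented edges which continue each other comes from a closed path. -/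
lemma exists_seq_eq {b : ℕ → X.graph.Dart} {n : ℕ} (hn : 0 < n)
    (hb : Function.IsPeriodicPt seqShift n b) (hc : ∀ i, Continues (b i) (b (i + 1))) :
    ∃ γ : X.ClosedPath, γ.walk.length = n ∧ γ.seq = b := by
  obtain ⟨n, rfl⟩ := Nat.exists_eq_succ_of_ne_zero hn.ne'
  obtain ⟨p, hp⟩ := X.exists_reducedPath (a := fun i : Fin (n + 1) => b i) fun i => hc i
  have h0 := p.toFun_zero_fst
  have h1 := p.toFun_last_snd
  have h2 := p.ofFn_toFun
  rw [hp] at h0 h1 h2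
  have hxy : p.1.1 = p.1.2.1 := by
    refine h0.symm.trans (Eq.trans ?_ h1)
    have h := isPeriodicPt_seqShift.mp hb 0
    rw [zero_add] at h
    exact (congrArg (fun d : X.graph.Dart => d.fst) h).symm.trans (hc n).1.symm
  obtain ⟨⟨x, y, p⟩, hl, hr⟩ := p
  simp only at hxy hl h2
  subst hxy
  let γ : X.ClosedPath := ⟨x, p, by omega⟩
  refine ⟨γ, hl, eq_of_isPeriodicPt_seqShift hn ?_ hb fun i hi => ?_⟩
  · have h := γ.isPeriodicPt_seq
    rwa [show γ.walk.length = n + 1 from hl] at h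
  refine Option.some_injective _ ?_
  rw [← γ.getElem?_darts (hi.trans_eq hl.symm)]
  change p.darts[i]? = _
  rw [← h2, List.getElem?_ofFn, dif_pos hi]

lemma two_le_length (γ : X.ClosedPath) : 2 ≤ γ.walk.length := by
  have h0 := γ.length_pos
  by_contra h
  exact (SimpleGraph.Walk.adj_of_length_eq_one (p := γ.walk) (by omega)).ne rfl

/-- Reducedness of all rotations also covers the junction at the base point, so it says that the
periodic sequence never backtracks. Rotation `i` exposes terms `i` and `i + 1` as its first two
edges, which exist as a simple graph has no loops. -/
lemma isCycle_iff (γ : X.ClosedPath) :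
    ClosedPathClass.IsCycle (Quot.mk _ γ) ↔ ∀ i, Continues (γ.seq i) (γ.seq (i + 1)) := by
  refine ⟨fun h i => ?_, fun h q hq => ?_⟩
  · have h1 := (X.isReduced_iff_isChain _).mp (h _ (γ.mk_shift_iterate i))
    rw [List.isChain_iff_getElem] at h1
    have h2 := h1 0 (by
      rw [SimpleGraph.Walk.length_darts]; exact (shift^[i] γ).two_le_length)
    rwa [getElem_darts, getElem_darts, seq_shift_iterate, seqShift_iterate, seqShift_iterate,
      zero_add, zero_add, add_comm 1] at h2
  · obtain ⟨j, rfl⟩ := mk_eq_mk_iff.mp hq.symm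
    rw [isReduced_iff_isChain, List.isChain_iff_getElem]
    intro i hi
    rw [getElem_darts, getElem_darts, seq_shift_iterate, seqShift_iterate, seqShift_iterate,
      add_right_comm]
    exact h _

lemma seq_mem_periodicPts (γ : X.ClosedPath) : γ.seq ∈ Function.periodicPts seqShift :=
  ⟨_, γ.length_pos, γ.isPeriodicPt_seq⟩

/-- If the minimal period is smaller than the length, the closed path running once through a period
is a shorter root. Conversely a shorter root would give the same sequence, up to shift, a period
below the minimal one. -/
lemma isPrime_iff (γ : X.ClosedPath) :
    ClosedPathClass.IsPrime (Quot.mk _ γ) ↔ (∀ i, Continues (γ.seq i) (γ.seq (i + 1))) ∧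
      Function.minimalPeriod seqShift γ.seq = γ.walk.length := by
  refine (and_congr_left' γ.isCycle_iff).trans <| and_congr_right fun hc => ⟨fun h => ?_, ?_⟩
  · obtain ⟨k, hk⟩ := γ.isPeriodicPt_seq.minimalPeriod_dvd
    have hd := Function.minimalPeriod_pos_of_mem_periodicPts γ.seq_mem_periodicPts
    obtain ⟨δ, hδ, hs⟩ := exists_seq_eq hd (Function.isPeriodicPt_minimalPeriod _ _) hc
    by_contra hne
    have hlt : δ.walk.length < γ.walk.length := by
      rw [hδ]
      exact lt_of_le_of_ne (Nat.le_of_dvd γ.length_pos ⟨k, hk⟩) hne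
    obtain ⟨k, rfl⟩ : ∃ m, k = m + 1 := Nat.exists_eq_succ_of_ne_zero fun h0 => by
      rw [h0, mul_zero] at hk; exact γ.length_pos.ne' hk
    refine h ⟨δ, k, ?_, hlt, congrArg _ (ext_seq ?_ ?_)⟩
    · rw [isCycle_iff, hs]; exact hc
    · rw [length_powSucc, hδ, mul_comm, ← hk]
    · rw [seq_powSucc, hs]
  · rintro hd ⟨δ, k, -, hlt, h⟩
    obtain ⟨j, hj⟩ := mk_eq_mk_iff.mp h.symm
    have hs : δ.seq = seqShift^[j] γ.seq := by
      rw [← seq_powSucc δ k, ← hj, seq_shift_iterate]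
    have h1 := δ.isPeriodicPt_seq.minimalPeriod_le δ.length_pos
    rw [hs, Function.minimalPeriod_apply_iterate γ.seq_mem_periodicPts, hd] at h1
    exact absurd hlt (not_lt.mpr h1)

end ClosedPath
end WeightedGraph

namespace WeightedGraph

open EllTwo InfMatrix

variable {V : Type*} (X : WeightedGraph V)

/-! ### The Euler product -/

/-- The closed paths whose class is a prime cycle. -/
def PrimePath : Type _ := {γ : X.ClosedPath // ClosedPathClass.IsPrime (Quot.mk _ γ)}

variable {X} in
/-- The term `w(p) u^{l(p)}` of a closed path. -/
def ClosedPath.term (γ : X.ClosedPath) (u : ℂ) : ℂ :=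
  (X.pathWeight γ.walk : ℂ) * u ^ γ.walk.length

variable {X} in
/-- The prime cycle of a closed path. -/
def PrimePath.cycle (γ : X.PrimePath) : X.PrimeCycle := ⟨Quot.mk _ γ.1, γ.2⟩

variable {X} in
/-- The cyclic sequence of oriented edges of the power `γ^{k+1}`. -/
def PrimePath.powSeq (c : X.PrimePath × ℕ) : Σ k : ℕ, Fin (k + 1) → X.graph.Dart :=
  -- Sequences of length `N` are stored at index `N - 1`, as in `cyclicTerm`.
  ⟨(c.2 + 1) * c.1.1.walk.length - 1, fun i => c.1.1.seq i⟩

variable {X} in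
lemma PrimePath.powSeq_fst_add_one (c : X.PrimePath × ℕ) :
    (PrimePath.powSeq c).1 + 1 = (c.2 + 1) * c.1.1.walk.length :=
  Nat.sub_add_cancel (Nat.mul_pos c.2.succ_pos c.1.1.length_pos)

lemma sigma_fin_apply {α : Type*} {c d : Σ k : ℕ, Fin (k + 1) → α} (h : c = d) :
    c.1 = d.1 ∧ ∀ i (h1 : i < c.1 + 1) (h2 : i < d.1 + 1), c.2 ⟨i, h1⟩ = d.2 ⟨i, h2⟩ := by
  subst h
  exact ⟨rfl, fun _ _ _ => rfl⟩

/-- The sequence determines the prime path, whose length is the minimal period; the total length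
then determines the exponent. -/
lemma powSeq_injective : Function.Injective (PrimePath.powSeq (X := X)) := by
  rintro ⟨⟨γ, hγ⟩, k⟩ ⟨⟨δ, hδ⟩, m⟩ h
  have hγ' := γ.isPrime_iff.mp hγ
  have hδ' := δ.isPrime_iff.mp hδ
  obtain ⟨h1, h2⟩ := sigma_fin_apply h
  have e1 := PrimePath.powSeq_fst_add_one (X := X) (⟨γ, hγ⟩, k)
  have e2 := PrimePath.powSeq_fst_add_one (X := X) (⟨δ, hδ⟩, m)
  have e3 : (k + 1) * γ.walk.length = (m + 1) * δ.walk.length := by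
    rw [← e1, ← e2, h1]
  have hs : γ.seq = δ.seq := by
    refine eq_of_isPeriodicPt_seqShift (Nat.mul_pos k.succ_pos γ.length_pos)
      (γ.isPeriodicPt_seq.const_mul _) ?_ fun i hi => ?_
    · rw [e3]; exact δ.isPeriodicPt_seq.const_mul _
    · exact h2 i (by rw [e1]; exact hi) (by rw [e2, ← e3]; exact hi)
  have hl : γ.walk.length = δ.walk.length := by rw [← hγ'.2, ← hδ'.2, hs]
  obtain rfl := ClosedPath.ext_seq hl hs
  have hk := Nat.eq_of_mul_eq_mul_right γ.length_pos e3
  exact Prod.ext rfl (Nat.succ_injective hk)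

open Classical in
/-- The transition matrix of the oriented edges. -/
def transition (e f : X.graph.Dart) : ℂ := ((if Continues e f then X.w f else 0 : ℝ) : ℂ)

lemma norm_transition_le (e f : X.graph.Dart) : ‖X.transition e f‖ ≤ X.w f := by
  rw [transition, Complex.norm_real, Real.norm_eq_abs]
  split_ifs
  · exact (abs_of_pos (X.w_pos f)).le
  · simpa using (X.w_pos f).le

lemma continues_of_transition_ne_zero {e f : X.graph.Dart} (h : X.transition e f ≠ 0) :
    Continues e f := by
  by_contra hc
  exact h (by simp [transition, hc])

lemma transition_of_continues {e f : X.graph.Dart} (h : Continues e f) :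
    X.transition e f = X.w f := by
  simp [transition, h]

/-- A cyclic sequence with non-zero term never backtracks. Its periodic extension, cut at the
minimal period, is a prime closed path, and the exponent is the quotient of the two periods. -/
lemma support_cyclicTerm_subset (u : ℂ) :
    Function.support (cyclicTerm X.transition u) ⊆ Set.range (PrimePath.powSeq (X := X)) := by
  rintro ⟨k, a⟩ hc
  have hc' : ∀ l, Continues (a l) (a (l + 1)) := fun l => by
    refine X.continues_of_transition_ne_zero fun h0 => hc ?_
    rw [cyclicTerm, Finset.prod_eq_zero (Finset.mem_univ l) h0, zero_mul, zero_div]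
  let b : ℕ → X.graph.Dart := fun i => a (Fin.ofNat (k + 1) i)
  have hb : Function.IsPeriodicPt seqShift (k + 1) b := isPeriodicPt_seqShift.mpr fun i => by
    simp only [b]
    congr 1
    ext
    simp
  have hbc : ∀ i, Continues (b i) (b (i + 1)) := fun i => by
    have e : Fin.ofNat (k + 1) (i + 1) = Fin.ofNat (k + 1) i + 1 := by
      ext
      simp [Fin.val_add]
    simp only [b, e]
    exact hc' _
  have hd := Function.minimalPeriod_pos_of_mem_periodicPts ⟨k + 1, k.succ_pos, hb⟩
  obtain ⟨γ, hγ, hs⟩ := ClosedPath.exists_seq_eq hd (Function.isPeriodicPt_minimalPeriod _ _) hbc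
  have hp : ClosedPathClass.IsPrime (Quot.mk _ γ) := by
    rw [γ.isPrime_iff, hs]
    exact ⟨hbc, hγ.symm⟩
  obtain ⟨m, hm⟩ := hb.minimalPeriod_dvd
  obtain ⟨m, rfl⟩ : ∃ j, m = j + 1 := Nat.exists_eq_succ_of_ne_zero fun h0 => by
    rw [h0, mul_zero] at hm; omega
  refine ⟨(⟨γ, hp⟩, m), ?_⟩
  have e1 := PrimePath.powSeq_fst_add_one (X := X) (⟨γ, hp⟩, m)
  have e2 : (PrimePath.powSeq (X := X) (⟨γ, hp⟩, m)).1 = k := by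
    simp only [hγ] at e1
    rw [mul_comm, ← hm] at e1
    omega
  have e3 : ∀ (c : Σ k : ℕ, Fin (k + 1) → X.graph.Dart), c.1 = k →
      (∀ i : Fin (c.1 + 1), c.2 i = b i) → c = ⟨k, a⟩ := by
    rintro ⟨k', a'⟩ h h'
    simp only at h h'
    subst h
    congr 1
    funext i
    rw [h' i]
    simp only [b]
    congr 1
    ext
    exact Nat.mod_eq_of_lt i.2
  exact e3 _ e2 fun i => congrFun hs i

/-- The total length is `(k + 1) l`. Its reciprocal splits into `1 / (k + 1)`, which belongs to the
logarithm series, and `1 / l`, which is to cancel against the choice of base point. -/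
lemma cyclicTerm_powSeq (u : ℂ) (c : X.PrimePath × ℕ) :
    cyclicTerm X.transition u (PrimePath.powSeq c) =
      (c.1.1.term u ^ (c.2 + 1) / (c.2 + 1)) / c.1.1.walk.length := by
  obtain ⟨⟨γ, hγ⟩, k⟩ := c
  have hγ' := γ.isPrime_iff.mp hγ
  have e1 := PrimePath.powSeq_fst_add_one (X := X) (⟨γ, hγ⟩, k)
  have e2 : ((PrimePath.powSeq (X := X) (⟨γ, hγ⟩, k)).1 : ℂ) + 1 =
      (k + 1) * γ.walk.length := by
    exact_mod_cast e1
  have hper : ∀ N : ℕ, N + 1 = (k + 1) * γ.walk.length →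
      ∏ l : Fin (N + 1), X.transition (γ.seq l) (γ.seq (l + 1 : Fin (N + 1))) =
        (X.pathWeight γ.walk : ℂ) ^ (k + 1) := by
    intro N hN
    -- A transition carries the weight of its target edge, so the product is that of the path
    -- rotated by one step, and weights are invariant under rotation.
    have h1 : ∀ l : Fin (N + 1), X.transition (γ.seq l) (γ.seq (l + 1 : Fin (N + 1))) =
        ((X.w (γ.shift.seq l) : ℝ) : ℂ) := fun l => by
      have hp : Function.Periodic γ.seq (N + 1) := by
        have := γ.isPeriodicPt_seq.const_mul (k + 1)
        rw [← hN] at this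
        exact isPeriodicPt_seqShift.mp this
      have : γ.seq (l + 1 : Fin (N + 1)) = γ.seq (l + 1) := by
        rw [← hp.map_mod_nat (l + 1)]
        congr 1
        simp [Fin.val_add]
      rw [this, X.transition_of_continues (hγ'.1 _), γ.seq_shift]
      rfl
    rw [Finset.prod_congr rfl fun l _ => h1 l,
      Fin.prod_univ_eq_prod_range (fun i => ((X.w (γ.shift.seq i) : ℝ) : ℂ)), hN,
      ← γ.pathWeight_shift, ← Complex.ofReal_pow, ← γ.shift.pathWeight_powSucc,
      ClosedPath.pathWeight_eq_prod, ClosedPath.length_powSucc, ClosedPath.seq_powSucc,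
      ClosedPath.length_shift, Complex.ofReal_prod]
  have e3 : ∏ l, X.transition ((PrimePath.powSeq (X := X) (⟨γ, hγ⟩, k)).2 l)
      ((PrimePath.powSeq (X := X) (⟨γ, hγ⟩, k)).2 (l + 1)) =
        (X.pathWeight γ.walk : ℂ) ^ (k + 1) := hper _ e1
  have e4 : u ^ ((PrimePath.powSeq (X := X) (⟨γ, hγ⟩, k)).1 + 1) =
      (u ^ γ.walk.length) ^ (k + 1) := by
    rw [e1, mul_comm, pow_mul]
  rw [cyclicTerm, e2, e3, e4, ClosedPath.term, div_div, mul_pow]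

variable {X} in
lemma ClosedPath.norm_term_lt_one (γ : X.ClosedPath) {u : ℂ} (hu : ‖u‖ * ∑' e, X.w e < 1) :
    ‖γ.term u‖ < 1 := by
  have h0 : 0 ≤ ‖u‖ * ∑' e, X.w e :=
    mul_nonneg (norm_nonneg u) (tsum_nonneg fun e => (X.w_pos e).le)
  have h1 : X.pathWeight γ.walk ≤ (∑' e, X.w e) ^ γ.walk.length := by
    rw [γ.pathWeight_eq_prod]
    refine (Finset.prod_le_prod (fun i _ => (X.w_pos _).le) fun i _ =>
      X.finite_weight.le_tsum (γ.seq i) fun e _ => (X.w_pos e).le).trans_eq ?_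
    rw [Finset.prod_const, Finset.card_range]
  calc ‖γ.term u‖ = X.pathWeight γ.walk * ‖u‖ ^ γ.walk.length := by
        rw [term, norm_mul, norm_pow, Complex.norm_real,
          Real.norm_of_nonneg (X.pathWeight_pos _).le]
    _ ≤ (∑' e, X.w e) ^ γ.walk.length * ‖u‖ ^ γ.walk.length := by gcongr
    _ = (‖u‖ * ∑' e, X.w e) ^ γ.walk.length := by rw [mul_pow, mul_comm]
    _ < 1 := pow_lt_one₀ h0 hu γ.length_pos.ne'

lemma hasSum_neg_log_div {u : ℂ} (hu : ‖u‖ * ∑' e, X.w e < 1) :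
    HasSum (fun γ : X.PrimePath => -Complex.log (1 - γ.1.term u) / γ.1.walk.length)
      (∑' c, cyclicTerm X.transition u c) := by
  have h := (summable_cyclicTerm (fun e => (X.w_pos e).le) X.finite_weight X.norm_transition_le
    hu).hasSum
  rw [← X.powSeq_injective.hasSum_iff fun c hc => by
    by_contra h0
    exact hc (X.support_cyclicTerm_subset u h0)] at h
  have e : cyclicTerm X.transition u ∘ PrimePath.powSeq = fun c : X.PrimePath × ℕ =>
      (c.1.1.term u ^ (c.2 + 1) / (c.2 + 1)) / c.1.1.walk.length :=
    funext fun c => X.cyclicTerm_powSeq u c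
  rw [e] at h
  refine h.prod_fiberwise fun γ => ?_
  have h1 := Complex.hasSum_taylorSeries_neg_log (γ.1.norm_term_lt_one hu)
  -- The Taylor series has a term of index `0`, which is `1 / 0 = 0`; dropping it starts the
  -- exponents at `1`.
  have h2 := (hasSum_nat_add_iff' 1).mpr h1
  simp only [Finset.range_one, Finset.sum_singleton, pow_zero, Nat.cast_zero, div_zero,
    sub_zero] at h2
  have h3 := h2.div_const (γ.1.walk.length : ℂ)
  push_cast at h3
  exact h3

/-- The rotations of a prime closed path by fewer steps than its length are pairwise distinct,
because the length is the minimal period. -/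
lemma card_cycle_fiber (p : X.PrimeCycle) :
    Nat.card {γ : X.PrimePath // γ.cycle = p} = p.1.length := by
  obtain ⟨⟨γ⟩, hγ⟩ := p
  have hγ' := γ.isPrime_iff.mp hγ
  let φ : Fin γ.walk.length → {δ : X.PrimePath // δ.cycle = ⟨Quot.mk _ γ, hγ⟩} := fun j =>
    ⟨⟨ClosedPath.shift^[j] γ, by rw [γ.mk_shift_iterate j]; exact hγ⟩,
      Subtype.ext (γ.mk_shift_iterate j)⟩
  have hseq : ∀ j : Fin γ.walk.length, (φ j).1.1.seq = seqShift^[j] γ.seq := fun j =>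
    γ.seq_shift_iterate j
  have hφ : Function.Bijective φ := by
    refine ⟨fun i j h => ?_, ?_⟩
    · have h1 : seqShift^[i] γ.seq = seqShift^[j] γ.seq := by rw [← hseq, ← hseq, h]
      have h2 := (Function.iterate_eq_iterate_iff_of_lt_minimalPeriod
        (i.2.trans_eq hγ'.2.symm) (j.2.trans_eq hγ'.2.symm)).mp h1
      exact Fin.ext h2
    · rintro ⟨⟨δ, hδ⟩, h⟩
      obtain ⟨j, rfl⟩ := ClosedPath.mk_eq_mk_iff.mp (congrArg Subtype.val h).symm
      refine ⟨⟨j % γ.walk.length, Nat.mod_lt _ γ.length_pos⟩, Subtype.ext (Subtype.ext ?_)⟩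
      exact Function.IsPeriodicPt.iterate_mod_apply γ.shift_iterate_length j
  rw [← Nat.card_congr (Equiv.ofBijective φ hφ), Nat.card_fin]
  rfl

/-- Summing over the `l(p)` closed paths of a prime cycle `p` cancels the factor `1 / l(p)`. -/
lemma hasSum_neg_log {u : ℂ} (hu : ‖u‖ * ∑' e, X.w e < 1) :
    HasSum (fun p : X.PrimeCycle => -Complex.log (1 - (p.1.weight : ℂ) * u ^ p.1.length))
      (∑' c, cyclicTerm X.transition u c) := by
  have h := X.hasSum_neg_log_div hu
  rw [← (Equiv.sigmaFiberEquiv (PrimePath.cycle (X := X))).hasSum_iff] at h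
  refine h.sigma fun p => ?_
  have hpos : 0 < p.1.length := by
    obtain ⟨⟨γ⟩, hγ⟩ := p
    exact γ.length_pos
  have hc := X.card_cycle_fiber p
  have : Finite {γ : X.PrimePath // γ.cycle = p} :=
    Nat.finite_of_card_ne_zero (by rw [hc]; exact hpos.ne')
  have := Fintype.ofFinite {γ : X.PrimePath // γ.cycle = p}
  have e : ∀ γ : {γ : X.PrimePath // γ.cycle = p},
      -Complex.log (1 - γ.1.1.term u) / γ.1.1.walk.length =
        -Complex.log (1 - (p.1.weight : ℂ) * u ^ p.1.length) / p.1.length := by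
    rintro ⟨γ, rfl⟩
    rfl
  have h1 := hasSum_fintype fun γ : {γ : X.PrimePath // γ.cycle = p} =>
    -Complex.log (1 - γ.1.1.term u) / γ.1.1.walk.length
  have h2 : ∑ γ : {γ : X.PrimePath // γ.cycle = p},
      -Complex.log (1 - γ.1.1.term u) / γ.1.1.walk.length =
        -Complex.log (1 - (p.1.weight : ℂ) * u ^ p.1.length) := by
    rw [Finset.sum_congr rfl fun γ _ => e γ, Finset.sum_const, Finset.card_univ,
      ← Nat.card_eq_fintype_card, hc, nsmul_eq_mul]
    exact mul_div_cancel₀ _ (Nat.cast_ne_zero.mpr hpos.ne')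
  rw [h2] at h1
  exact h1

lemma hasProd_eulerFactor {u : ℂ} (hu : ‖u‖ * ∑' e, X.w e < 1) :
    HasProd (X.eulerFactor u) (Complex.exp (∑' c, cyclicTerm X.transition u c)) := by
  have h := (X.hasSum_neg_log hu).cexp
  have e : Complex.exp ∘ (fun p : X.PrimeCycle =>
      -Complex.log (1 - (p.1.weight : ℂ) * u ^ p.1.length)) = X.eulerFactor u := by
    funext p
    have hlt : ‖(p.1.weight : ℂ) * u ^ p.1.length‖ < 1 := by
      obtain ⟨⟨γ⟩, hγ⟩ := p
      exact γ.norm_term_lt_one hu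
    have hne : 1 - (p.1.weight : ℂ) * u ^ p.1.length ≠ 0 := fun h0 => by
      rw [← sub_eq_zero.mp h0, norm_one] at hlt
      exact lt_irrefl _ hlt
    rw [Function.comp_apply, Complex.exp_neg, Complex.exp_log hne, eulerFactor]
  rw [← e]
  exact h

lemma fredholmDet_one_sub_smul_edgeOp (u : ℂ) :
    fredholmDet (1 - u • X.edgeOp) = minorSum fun i j => -(u * mat X.edgeOp i j) := by
  have e : (1 - u • X.edgeOp) - 1 = -(u • X.edgeOp) := by abel
  rw [fredholmDet_eq_minorSum]
  · rw [e]
    congr 1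
    funext i j
    rw [mat_neg, mat_smul]
    rfl
  · rw [e, nu_neg, nu_smul]
    exact ENNReal.mul_ne_top (by simp) X.nu_edgeOp

lemma fredholmDet_one_sub_edgeOp_eq_exp {u : ℂ} (hu : ‖u‖ * ∑' e, X.w e < 1) :
    fredholmDet (1 - u • X.edgeOp) = Complex.exp (-∑' c, cyclicTerm X.transition u c) := by
  have e : X.transition = fun e f => mat X.edgeOp f e :=
    funext fun e => funext fun f => (X.mat_edgeOp_eq f e).symm
  have hs : absSum X.transition ≠ ∞ := by
    have h := X.nu_edgeOp
    rw [nu, absSum, ENNReal.tsum_comm] at h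
    rw [e]
    exact h
  rw [← minorSum_eq_exp (fun e => (X.w_pos e).le) X.finite_weight X.norm_transition_le hu hs,
    fredholmDet_one_sub_smul_edgeOp, ← minorSum_transpose, e]

end WeightedGraph

namespace WeightedGraph

open EllTwo InfMatrix

variable {V : Type*} (X : WeightedGraph V)

/-! ### Determinants of formal power series -/

lemma _root_.mul_lt_one_of_lt_one_div {x c K : ℝ} (hc : 0 ≤ c) (hK : c ≤ K)
    (h : x < 1 / (K + 1)) : x * c < 1 := by
  have hK' : 0 < K + 1 := by linarith
  rcases hc.eq_or_lt with rfl | hc'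
  · simp
  · calc x * c < 1 / (K + 1) * c := by gcongr
      _ ≤ 1 / (K + 1) * (K + 1) := by gcongr; linarith
      _ = 1 := one_div_mul_cancel hK'.ne'

lemma _root_.EllTwo.tsum_nu_coeff_ne_top {ι : Type*} {C : ℕ → EllTwo ι →L[ℂ] EllTwo ι}
    (h0 : C 0 = 1) {s t ρ : ℝ≥0∞} (hs : s ≠ ∞) (hρ : ρ ≠ ∞) (hρt : ρ * t < 1)
    (hC : ∀ n, nu (C (n + 1)) ≤ t ^ n * s) :
    ∑' n, nu (PowerSeries.coeff n (PowerSeries.mk C - 1)) * ρ ^ n ≠ ∞ := by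
  rw [tsum_eq_zero_add' ENNReal.summable]
  have e0 : PowerSeries.coeff 0 (PowerSeries.mk C - 1) = 0 := by
    rw [map_sub, PowerSeries.coeff_mk, PowerSeries.coeff_zero_one, h0, sub_self]
  have e1 : ∀ n, PowerSeries.coeff (n + 1) (PowerSeries.mk C - 1) = C (n + 1) := fun n => by
    rw [map_sub, PowerSeries.coeff_mk, PowerSeries.coeff_one, if_neg n.succ_ne_zero, sub_zero]
  simp_rw [e0, e1, nu_zero, zero_mul, zero_add]
  refine ne_top_of_le_ne_top (b := ∑' n : ℕ, (ρ * t) ^ n * (s * ρ)) ?_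
    (ENNReal.tsum_le_tsum fun n => ?_)
  · rw [ENNReal.tsum_mul_right, ENNReal.tsum_geometric]
    refine ENNReal.mul_ne_top (ENNReal.inv_ne_top.mpr ?_) (ENNReal.mul_ne_top hs hρ)
    exact (tsub_pos_of_lt hρt).ne'
  · calc nu (C (n + 1)) * ρ ^ (n + 1) ≤ t ^ n * s * ρ ^ (n + 1) := by gcongr; exact hC n
      _ = (ρ * t) ^ n * (s * ρ) := by rw [mul_pow]; ring

/-- A radius in which all the power series converge. -/
def radius : ℝ :=
  -- For `‖u‖` below this, `‖u‖` times each summand is less than `1`. The operator norms serve the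
  -- Neumann series, the two values of `nu` the formal determinants, the total weight the Euler
  -- product; the final `1` keeps the denominator positive.
  1 / (‖X.edgeOp‖ + ‖X.J‖ + (nu X.edgeOp).toReal + (nu X.J).toReal + ∑' e, X.w e + 1)

lemma radius_pos : 0 < X.radius := by
  have : 0 ≤ ∑' e, X.w e := tsum_nonneg fun e => (X.w_pos e).le
  unfold radius
  positivity

lemma mul_lt_one_of_lt_radius {x : ℝ} (h : x < X.radius) :
    x * ‖X.edgeOp‖ < 1 ∧ x * ‖X.J‖ < 1 ∧ x * ∑' e, X.w e < 1 := by
  have h0 : 0 ≤ ∑' e, X.w e := tsum_nonneg fun e => (X.w_pos e).le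
  have h1 := norm_nonneg X.edgeOp
  have h2 := norm_nonneg X.J
  have h3 := (nu X.edgeOp).toReal_nonneg
  have h4 := (nu X.J).toReal_nonneg
  exact ⟨mul_lt_one_of_lt_one_div h1 (by linarith) h, mul_lt_one_of_lt_one_div h2 (by linarith) h,
    mul_lt_one_of_lt_one_div h0 (by linarith) h⟩

lemma ofReal_mul_nu_lt_one {x : ℝ} (h0 : 0 ≤ x) (h : x < X.radius) :
    ENNReal.ofReal x * nu X.edgeOp < 1 ∧ ENNReal.ofReal x * nu X.J < 1 := by
  have h5 : 0 ≤ ∑' e, X.w e := tsum_nonneg fun e => (X.w_pos e).le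
  have h1 := norm_nonneg X.edgeOp
  have h2 := norm_nonneg X.J
  have h3 := (nu X.edgeOp).toReal_nonneg
  have h4 := (nu X.J).toReal_nonneg
  rw [← ENNReal.ofReal_toReal X.nu_edgeOp, ← ENNReal.ofReal_toReal X.nu_J,
    ← ENNReal.ofReal_mul h0, ← ENNReal.ofReal_mul h0, ENNReal.ofReal_lt_one,
    ENNReal.ofReal_lt_one]
  exact ⟨mul_lt_one_of_lt_one_div h3 (by linarith) h, mul_lt_one_of_lt_one_div h4 (by linarith) h⟩

lemma hasSum_fredholmDetSeries_A {u : ℂ} (hu : ‖u‖ < X.radius) :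
    HasSum (fun n => PowerSeries.coeff n (fredholmDetSeries X.ASeries) * u ^ n)
      (fredholmDet (X.AOp u)) := by
  -- An intermediate radius is used rather than `‖u‖` itself, since the radius of convergence has to
  -- be non-zero even when `u = 0`.
  obtain ⟨x, hx1, hx2⟩ := exists_between hu
  have hx0 : 0 < x := (norm_nonneg u).trans_lt hx1
  obtain ⟨hT, -, -⟩ := X.mul_lt_one_of_lt_radius hu
  refine hasSum_fredholmDetSeries (ρ := ENNReal.ofReal x) (by simpa using hx0) ?_ ?_ ?_ ?_
    (X.nu_AOp_sub_one hT)
  · rw [← ofReal_norm]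
    exact ENNReal.ofReal_le_ofReal hx1.le
  · rw [ASeries, PowerSeries.coeff_mk, A_zero]
  · exact tsum_nu_coeff_ne_top X.A_zero X.nu_sigma ENNReal.ofReal_ne_top
      (X.ofReal_mul_nu_lt_one hx0.le hx2).1 X.nu_A_succ_le
  · simp_rw [ASeries, PowerSeries.coeff_mk]
    rw [AOp]
    exact (X.hasSum_A hT).summable.hasSum

lemma hasSum_fredholmDetSeries_B {u : ℂ} (hu : ‖u‖ < X.radius) :
    HasSum (fun n => PowerSeries.coeff n (fredholmDetSeries X.BNegSeries) * u ^ n)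
      (fredholmDet (X.sunadaOp u)) := by
  obtain ⟨x, hx1, hx2⟩ := exists_between hu
  have hx0 : 0 < x := (norm_nonneg u).trans_lt hx1
  obtain ⟨-, hJ, -⟩ := X.mul_lt_one_of_lt_radius hu
  refine hasSum_fredholmDetSeries (ρ := ENNReal.ofReal x) (by simpa using hx0) ?_ ?_ ?_ ?_
    (X.nu_sunadaOp_sub_one u)
  · rw [← ofReal_norm]
    exact ENNReal.ofReal_le_ofReal hx1.le
  · rw [BNegSeries, PowerSeries.coeff_mk, B_zero, pow_zero, one_smul]
  · refine tsum_nu_coeff_ne_top (by rw [B_zero, pow_zero, one_smul]) X.nu_sigma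
      ENNReal.ofReal_ne_top (X.ofReal_mul_nu_lt_one hx0.le hx2).2 fun n => ?_
    rw [nu_smul, enorm_pow, enorm_neg, enorm_one, one_pow, one_mul]
    exact X.nu_B_succ_le n
  · have e : ∀ n, u ^ n • PowerSeries.coeff n X.BNegSeries = (-u) ^ n • X.B n := fun n => by
      rw [BNegSeries, PowerSeries.coeff_mk, smul_smul, ← mul_pow, mul_neg_one]
    rw [funext e]
    exact X.hasSum_B hJ

/-! ### Meromorphy of the first factor -/

lemma differentiable_fredholmDet_edgeOp :
    Differentiable ℂ fun u : ℂ => fredholmDet (1 - u • X.edgeOp) := by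
  simp_rw [fredholmDet_one_sub_smul_edgeOp]
  exact differentiable_minorSum_smul X.nu_edgeOp

lemma isUnit_one_add_J_of_edgeProduct_ne_zero {u : ℂ} (hu : X.edgeProduct u ≠ 0) :
    IsUnit (1 + u • X.J) := by
  refine X.isUnit_one_add_J fun e he => hu ?_
  exact (X.edgeProduct_eq_zero_iff u).mpr ⟨e, he⟩

lemma fredholmDet_edgeOp_eq {u : ℂ} (hu : X.edgeProduct u ≠ 0) :
    fredholmDet (1 - u • X.edgeOp) = fredholmDet (X.sunadaOp u) * X.edgeProduct u := by
  rw [X.fredholmDet_one_sub_edgeOp (X.isUnit_one_add_J_of_edgeProduct_ne_zero hu),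
    fredholmDet_one_add_J, mul_comm]

/-- On a punctured neighbourhood of any point the function is the quotient of `det (1 - u T)` by the
edge product, both entire. Its values at the zeros of the edge product do not matter. -/
lemma meromorphic_fredholmDet_sunadaOp :
    Meromorphic fun u : ℂ => fredholmDet (X.sunadaOp u) := by
  intro z
  have h := (X.differentiable_fredholmDet_edgeOp.analyticAt z).meromorphicAt.div
    (X.differentiable_edgeProduct.analyticAt z).meromorphicAt
  refine h.congr ?_
  filter_upwards [X.eventually_edgeProduct_ne_zero z] with u hu
  rw [Pi.div_apply, X.fredholmDet_edgeOp_eq hu, mul_div_cancel_right₀ _ hu]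

end WeightedGraph

end

/-! ### The Ihara–Sunada formula. -/

theorem theorem2p10 {V : Type*} (X : WeightedGraph V) :
    -- the product over the edges converges to an entire function
    HasProdLocallyUniformlyOn
      (fun (e : X.graph.edgeSet) (u : ℂ) => 1 - u ^ 2 * (X.W e : ℂ)) X.edgeProduct Set.univ ∧
    Differentiable ℂ X.edgeProduct ∧
    -- its zeros are the numbers `±1/√W(e)`, counted with multiplicity as `e` runs through the edges
    (∀ z : ℂ, X.edgeProduct z = 0 ↔ ∃ e : X.graph.edgeSet,
      z = ((1 / Real.sqrt (X.W e) : ℝ) : ℂ) ∨ z = -((1 / Real.sqrt (X.W e) : ℝ) : ℂ)) ∧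
    (∀ z : ℂ, analyticOrderAt X.edgeProduct z =
      {e : X.graph.edgeSet | z = ((1 / Real.sqrt (X.W e) : ℝ) : ℂ) ∨
        z = -((1 / Real.sqrt (X.W e) : ℝ) : ℂ)}.encard) ∧
    -- `Z(u)` converges for small `|u|`, and `Z(u)⁻¹` extends to an entire function, given by the
    -- Ihara-Sunada formula
    (∃ Zinv : ℂ → ℂ, Differentiable ℂ Zinv ∧
      (∃ r > 0, ∀ u : ℂ, ‖u‖ < r →
        Multipliable (X.eulerFactor u) ∧ X.zeta u ≠ 0 ∧ Zinv u = (X.zeta u)⁻¹) ∧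
      (∀ u : ℂ, X.edgeProduct u ≠ 0 →
        IsUnit (1 + u • X.J) ∧ IsTraceClass (1 - X.sunadaOp u) ∧
        Zinv u = fredholmDet (X.sunadaOp u) * X.edgeProduct u)) ∧
    Meromorphic (fun u : ℂ => fredholmDet (X.sunadaOp u)) ∧
    -- the first factor equals `det B(-u) = (det A(u))⁻¹`, for small `|u|`
    (∃ r > 0, ∀ u : ℂ, ‖u‖ < r →
      Summable (fun j : ℕ => (-u) ^ j • X.B j) ∧ Summable (fun j : ℕ => u ^ j • X.A j) ∧
      IsTraceClass (1 - X.BOp (-u)) ∧ IsTraceClass (1 - X.AOp u) ∧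
      fredholmDet (X.sunadaOp u) = fredholmDet (X.BOp (-u)) ∧
      fredholmDet (X.AOp u) ≠ 0 ∧
      fredholmDet (X.BOp (-u)) = (fredholmDet (X.AOp u))⁻¹) ∧
    -- and the same for the determinants of formal power series of operators
    (∀ j ≥ 1, IsTraceClass (X.A j) ∧ IsTraceClass (X.B j)) ∧
    (∃ r > 0, ∀ u : ℂ, ‖u‖ < r →
      HasSum (fun n : ℕ => PowerSeries.coeff n (fredholmDetSeries X.BNegSeries) * u ^ n)
        (fredholmDet (X.sunadaOp u))) ∧
    fredholmDetSeries X.ASeries * fredholmDetSeries X.BNegSeries = 1 := by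
  refine ⟨hasProdLocallyUniformlyOn_quadratic (fun e => (X.W_pos e).le) X.summable_W,
    X.differentiable_edgeProduct, fun z => ?_, X.analyticOrderAt_edgeProduct,
    -- The entire extension of `Z(u)⁻¹` is the determinant of `1 - u T`.
    ⟨fun u => fredholmDet (1 - u • X.edgeOp), X.differentiable_fredholmDet_edgeOp,
      ⟨X.radius, X.radius_pos, fun u hu => ?_⟩, fun u hu => ?_⟩,
    X.meromorphic_fredholmDet_sunadaOp, ⟨X.radius, X.radius_pos, fun u hu => ?_⟩,
    fun j hj => X.isTraceClass_A_B hj,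
    ⟨X.radius, X.radius_pos, fun u hu => X.hasSum_fredholmDetSeries_B hu⟩,
    PowerSeries.mul_eq_one_of_hasSum X.radius_pos (fun u hu => X.hasSum_fredholmDetSeries_A hu)
      (fun u hu => X.hasSum_fredholmDetSeries_B hu) fun u hu => ?_⟩
  · rw [X.edgeProduct_eq_zero_iff]
    exact exists_congr fun e => one_sub_sq_mul_eq_zero_iff (X.W_pos e) z
  · obtain ⟨-, -, hw⟩ := X.mul_lt_one_of_lt_radius hu
    have h := X.hasProd_eulerFactor hw
    have hz : X.zeta u = _ := h.tprod_eq
    refine ⟨h.multipliable, ?_, ?_⟩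
    · rw [hz]
      exact Complex.exp_ne_zero _
    · change fredholmDet (1 - u • X.edgeOp) = _
      rw [hz, X.fredholmDet_one_sub_edgeOp_eq_exp hw, Complex.exp_neg]
  · exact ⟨X.isUnit_one_add_J_of_edgeProduct_ne_zero hu,
      isTraceClass_one_sub (X.nu_sunadaOp_sub_one u), X.fredholmDet_edgeOp_eq hu⟩
  · obtain ⟨hT, hJ, -⟩ := X.mul_lt_one_of_lt_radius hu
    have hB : X.BOp (-u) = X.sunadaOp u := (X.hasSum_B hJ).tsum_eq
    have h1 := X.fredholmDet_AOp_mul hT hJ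
    rw [hB]
    exact ⟨(X.hasSum_B hJ).summable, (X.hasSum_A hT).summable,
      isTraceClass_one_sub (X.nu_sunadaOp_sub_one u), isTraceClass_one_sub (X.nu_AOp_sub_one hT),
      rfl, left_ne_zero_of_mul_eq_one h1, eq_inv_of_mul_eq_one_right h1⟩
  · obtain ⟨hT, hJ, -⟩ := X.mul_lt_one_of_lt_radius hu
    exact X.fredholmDet_AOp_mul hT hJ
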